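/- For $\alpha\in\{0,1\}^3$ a real function $f$ on $\mathbb R^3$ has parity $\alpha$ if $f((-1)^{\gamma_1}x_1,(-1)^{\gamma_2}x_2,(-1)^{\gamma_3}x_3)=(-1)^{\gamma\cdot\alpha}f(x)$ for all $\gamma\in\{0,1\}^3$ and a.e. $x$ (the symmetry of the monomial $x^\alpha$). A symmetry type is a triple $\tau=(\alpha_l+i\beta_l)_{l=1,2,3}$ with $\alpha_l,\beta_l\in\{0,1\}^3$; a complex vector field $v=(v_1,v_2,v_3)$ has type $\tau$, written $Tv=\tau$, if $\operatorname{Re}v_l$ has parity $\alpha_l$ and $\operatorname{Im}v_l$ has parity $\beta_l$ for $l=1,2,3$. Let $e_1,e_2,e_3$ be the standard basis vectors and let $m(\cdot)$ denote reduction modulo $2$ in each entry. A (global, complex-valued) strong solution of the Navier–Stokes equations $$\partial_t u-\Delta u+u\cdot\nabla u-\nabla p=0,\qquad \nabla\cdot u=0,\qquad u(0,\cdot)=u_0\qquad\text{on }[0,\infty)\times\mathbb R^3$$ is a divergence-free $u\in C([0,\infty);L^2)\cap L^\infty_{loc}([0,\infty);H^1)\cap L^2_{loc}([0,\infty);H^2)$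 with values in $\mathbb C^3$ such that $u(0)=u_0$ and, for every $t>0$, the momentum equation holds in $\mathcal S'(\mathbb R^3)^3$ with some $p(t)\in\mathcal S'(\mathbb R^3)$. Let $\mathbb P$ be the projection onto divergence-free fields. We say that $u_0$ satisfies the Beltrami-type condition if $$\mathbb P\,\nabla\cdot\big(e^{t\Delta}u_0\otimes e^{t\Delta}u_0\big)=0\ \text{ in }\mathcal S'(\mathbb R^3)^3\ \text{ for all }t>0,\qquad \nabla\cdot u_0=0\ \text{ in }\mathcal S'(\mathbb R^3).$$ **Theorem.** (a) Let $u$ be a strong solution with initial value $u_0$, such that $u_0$ has some symmetry type and none of the six real functions $\operatorname{Re}u_l,\operatorname{Im}u_l$ ($l=1,2,3$) is constant on $[0,\infty)\times\mathbb R^3$. Then $u(t,\cdot)$ has one and the same symmetry type for all $t\ge 0$ if and only if at least one of the following holds: (i) there is $\beta_0\in\{0,1\}^3$ with $T(u_0)_l=e_l+i\,m(e_l+\beta_0)$ for $l=1,2,3$; (ii) $u_0$ satisfies the Beltrami-type condition. (b) Call a symmetry type $\tau$ admissible if there is a strong solution $u$, with none of $\operatorname{Re}u_l,\operatorname{Im}u_l$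 constant and with $u_0$ not satisfying the Beltrami-type condition, such that $Tu(t,\cdot)=\tau$ for all $t\ge 0$. The admissible types are exactly the types $\big(e_l+i\,m(e_l+\beta_0)\big)_{l=1,2,3}$ with $\beta_0\in\{0,1\}^3$; there are exactly eight of them. -/

import Mathlib

open MeasureTheory Set Filter
open scoped ENNReal NNReal FourierTransform SchwartzMap LineDeriv Laplacian

namespace NSSymmetry

noncomputable section

/-! ### Function spaces on `ℝ³` -/

/-- Physical space `ℝ³`. -/
abbrev E3 := EuclideanSpace ℝ (Fin 3)

/-- `L²(ℝ³; ℂ)`. -/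
abbrev L2 := Lp ℂ 2 (volume : Measure E3)

/-- Complex vector fields on `ℝ³` with components in `L²`. -/
abbrev VField := Fin 3 → L2

/-- The `j`-th vector of the standard basis of `ℝ³`. -/
def basisVec (j : Fin 3) : E3 := EuclideanSpace.single j 1

/-- An `L²` function as a tempered distribution. -/
abbrev distr (f : L2) : 𝓢'(E3, ℂ) := Lp.toTemperedDistribution f

/-- The squared Sobolev norm `‖f‖²_{H^s} = ∫ (1 + |ξ|²)^s |f̂(ξ)|² dξ`, with value `∞` when `f` is
not in `H^s`. -/
def sobolevSq (s : ℕ) (f : L2) : ℝ≥0∞ :=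
  ∫⁻ ξ, ENNReal.ofReal ((1 + ‖ξ‖ ^ 2) ^ s) * ‖(𝓕 f : L2) ξ‖ₑ ^ 2

/-- The pointwise product of two `L²` functions, an `L¹` function. -/
def prodL1 (f g : L2) : Lp ℂ 1 (volume : Measure E3) :=
  ((Lp.memLp g).mul' (Lp.memLp f) : MemLp (fun x => f x * g x) 1 volume).toLp _

/-- The distributional divergence of a vector field. -/
def divergence (u : VField) : 𝓢'(E3, ℂ) :=
  ∑ l, ∂_{basisVec l} (distr (u l))

/-- The `l`-th component `∑ₘ ∂ₘ (uₘ vₗ)` of `∇ · (u ⊗ v)`, which is `(u · ∇) vₗ` when `div u = 0`,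
as a tempered distribution. -/
def convection (u v : VField) (l : Fin 3) : 𝓢'(E3, ℂ) :=
  ∑ m, ∂_{basisVec m} (Lp.toTemperedDistribution (prodL1 (u m) (v l)))

/-! ### The heat semigroup and the Weyl–Helmholtz (Leray) projection -/

/-- The Fourier symbol `exp (-4π² t |ξ|²)` of `exp (t Δ)`
(for the transform with kernel `exp (-2πi x·ξ)`). -/
def heatSymbol (t : ℝ≥0) (ξ : E3) : ℂ :=
  ((Real.exp (-(4 * Real.pi ^ 2 * t * ‖ξ‖ ^ 2)) : ℝ) : ℂ)

theorem heatSymbol_memLp (t : ℝ≥0) : MemLp (heatSymbol t) ∞ (volume : Measure E3) := by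
  refine memLp_top_of_bound (C := 1) ?_ (Eventually.of_forall fun ξ => ?_)
  · unfold heatSymbol
    exact (by fun_prop : Continuous fun ξ : E3 =>
      ((Real.exp (-(4 * Real.pi ^ 2 * t * ‖ξ‖ ^ 2)) : ℝ) : ℂ)).aestronglyMeasurable
  · rw [heatSymbol, Complex.norm_real, Real.norm_eq_abs, Real.abs_exp, Real.exp_le_one_iff]
    have : 0 ≤ 4 * Real.pi ^ 2 * (t : ℝ) * ‖ξ‖ ^ 2 := by positivity
    linarith

/-- The heat semigroup `exp (t Δ)` on `L²`. -/
def heat (t : ℝ≥0) (f : L2) : L2 :=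
  𝓕⁻ (((Lp.memLp (𝓕 f : L2)).mul' (heatSymbol_memLp t) :
    MemLp (fun ξ => heatSymbol t ξ * (𝓕 f : L2) ξ) 2 volume).toLp _)

/-- The Fourier symbol `δₗₖ - ξₗ ξₖ / |ξ|²` of the projection `ℙ = I + (-Δ)⁻¹ ∇ div`
onto divergence free fields. -/
def leraySymbol (l k : Fin 3) (ξ : E3) : ℂ :=
  (((if l = k then 1 else 0) - ξ l * ξ k / ‖ξ‖ ^ 2 : ℝ) : ℂ)

theorem lerayHat_memLp (l k : Fin 3) (f : Lp ℂ 1 (volume : Measure E3)) :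
    MemLp (fun ξ => leraySymbol l k ξ * Real.Lp.fourierTransform f ξ) ∞ (volume : Measure E3) := by
  refine MemLp.mul' (p := ∞) (q := ∞) (Real.Lp.fourierTransform f).memLp_top ?_
  refine memLp_top_of_bound (C := 2) ?_ (Eventually.of_forall fun ξ => ?_)
  · unfold leraySymbol
    exact (by fun_prop : Measurable fun ξ : E3 =>
      (((if l = k then 1 else 0) - ξ l * ξ k / ‖ξ‖ ^ 2 : ℝ) : ℂ)).aestronglyMeasurable
  · rw [leraySymbol, Complex.norm_real]
    have h1 : ‖(if l = k then (1 : ℝ) else 0)‖ ≤ 1 := by split_ifs <;> simp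
    have h2 : ‖ξ l * ξ k / ‖ξ‖ ^ 2‖ ≤ 1 := by
      rw [norm_div, norm_mul, norm_pow, norm_norm]
      refine div_le_one_of_le₀ ?_ (by positivity)
      rw [sq]
      exact mul_le_mul (PiLp.norm_apply_le ξ l) (PiLp.norm_apply_le ξ k)
        (norm_nonneg _) (norm_nonneg _)
    calc _ ≤ _ := norm_sub_le _ _
      _ ≤ 2 := by linarith

/-- The entry `ℙₗₖ f` of the Weyl–Helmholtz projection applied to an `L¹` function. -/
def leray (l k : Fin 3) (f : Lp ℂ 1 (volume : Measure E3)) : 𝓢'(E3, ℂ) :=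
  𝓕⁻ (Lp.toTemperedDistribution ((lerayHat_memLp l k f).toLp _) : 𝓢'(E3, ℂ))

/-- The `l`-th component of `ℙ ∇ (u ⊗ v)`, that is of the projection of
`k ↦ ∑ₘ ∂ₘ (uₘ vₖ)` onto divergence free fields. -/
def lerayConvection (u v : VField) (l : Fin 3) : 𝓢'(E3, ℂ) :=
  ∑ k, ∑ m, ∂_{basisVec m} (leray l k (prodL1 (u m) (v k)))

/-- The Beltrami-type condition: `ℙ ∇ (exp (tΔ) u₀ ⊗ exp (tΔ) u₀) = 0` in `𝓢'` for all `t > 0`,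
and `div u₀ = 0` in `𝓢'`. -/
def IsBeltramiType (u₀ : VField) : Prop :=
  (∀ t : ℝ≥0, 0 < t → ∀ l,
    lerayConvection (fun j => heat t (u₀ j)) (fun j => heat t (u₀ j)) l = 0) ∧
  divergence u₀ = 0

/-! ### Strong solutions -/

/-- `u : [0, ∞) → L²(ℝ³; ℂ³)` is a (global, complex valued) strong solution of the incompressible
Navier–Stokes equations with initial value `u₀`: it is of class
`C([0, ∞); L²) ∩ L^∞_loc([0, ∞); H¹) ∩ L²_loc([0, ∞); H²)`, divergence free, and for every `t > 0`
there is a pressure `p` with `∂ₜ u - Δ u + (u · ∇) u - ∇ p = 0` at time `t`, as tempered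
distributions on `ℝ³`. The values of `u` at negative times play no role. -/
structure IsStrongSolution (u₀ : VField) (u : ℝ → VField) : Prop where
  initial : u 0 = u₀
  continuousOn : ContinuousOn u (Ici 0)
  bounded_H1 : ∀ T : ℝ, ∃ M : ℝ≥0, ∀ t ∈ Icc 0 T, ∀ l, sobolevSq 1 (u t l) ≤ M
  integrable_H2 : ∀ T : ℝ, ∀ l, ∫⁻ t in Icc 0 T, sobolevSq 2 (u t l) < ∞
  divergence_free : ∀ t, 0 ≤ t → divergence (u t) = 0
  momentum : ∀ t, 0 < t → ∃ p : 𝓢'(E3, ℂ), ∀ l, ∀ φ : 𝓢(E3, ℂ),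
    HasDerivAt (fun s => distr (u s l) φ)
      ((Δ (distr (u t l)) - convection (u t) (u t) l + ∂_{basisVec l} p) φ) t

/-! ### Symmetry types -/

/-- `{0,1}³` with addition modulo 2 in each entry. -/
abbrev Parity := Fin 3 → ZMod 2

/-- The map `x ↦ ((-1)^{γ₁} x₁, (-1)^{γ₂} x₂, (-1)^{γ₃} x₃)`. -/
def reflect (γ : Parity) (x : E3) : E3 :=
  WithLp.toLp 2 fun j => (-1) ^ (γ j).val * x j

/-- The real function `f` has the symmetry of the monomial `x^α`:
`f ((-1)^{γ₁} x₁, (-1)^{γ₂} x₂, (-1)^{γ₃} x₃) = (-1)^{γ·α} f(x)` for all `γ` (and a.e. `x`). -/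
def HasParity (f : E3 → ℝ) (α : Parity) : Prop :=
  ∀ γ : Parity, ∀ᵐ x, f (reflect γ x) = (-1) ^ (∑ j, (γ j).val * (α j).val) * f x

/-- A symmetry type of complex vector fields: for each component, the parity of the real part and
the parity of the imaginary part. -/
abbrev SymmetryType := Fin 3 → Parity × Parity

/-- `T u = τ`, i.e. `T uₗ = (τ l).1 + i (τ l).2` for `l = 1, 2, 3`. -/
def HasSymmetryType (u : VField) (τ : SymmetryType) : Prop :=
  ∀ l, HasParity (fun x => (u l x).re) (τ l).1 ∧ HasParity (fun x => (u l x).im) (τ l).2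

/-- `u` has one and the same symmetry type at all times `t ≥ 0`. -/
def KeepsSymmetryType (u : ℝ → VField) : Prop :=
  ∃ τ, ∀ t, 0 ≤ t → HasSymmetryType (u t) τ

/-- The symmetry type `(eₗ + i m(eₗ + β₀))ₗ`. -/
def matchedType (β₀ : Parity) : SymmetryType :=
  fun l => (Pi.single l 1, Pi.single l 1 + β₀)

/-- No real part `uₗ^re` and no imaginary part `uₗ^im` is a constant function
(on `[0, ∞) × ℝ³`). -/
def NonconstantComponents (u : ℝ → VField) : Prop :=
  ∀ l, (¬ ∃ c : ℝ, ∀ t, 0 ≤ t → ∀ᵐ x, (u t l x).re = c) ∧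
    (¬ ∃ c : ℝ, ∀ t, 0 ≤ t → ∀ᵐ x, (u t l x).im = c)

/-- The symmetry type `τ` is kept for all times by some strong solution with nonconstant components
whose initial value does not satisfy the Beltrami-type condition. -/
def IsAdmissible (τ : SymmetryType) : Prop :=
  ∃ (u₀ : VField) (u : ℝ → VField), IsStrongSolution u₀ u ∧ NonconstantComponents u ∧
    ¬ IsBeltramiType u₀ ∧ ∀ t, 0 ≤ t → HasSymmetryType (u t) τ

end

end NSSymmetry

/-! On the Fourier side a strong solution satisfies ∂ₜû = -4π²|ξ|²û - N(û), where N is the quadratic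
term `nonlin`; the pressure has disappeared. Solutions of this reduced equation are unique
(`FourierSolution.unique`): for the difference of two solutions, `WeakHeat.energy` absorbs the
derivative in N into the heat flow, Young's inequality and the H² norm give a time-integrable
coefficient, and a Gronwall argument concludes.

The equation commutes with the coordinate reflections acting on vector fields and with complex
conjugation. By `hasSymmetryType_iff`, a field has type (e_l + a) + i(e_l + b) exactly when, for
each γ, a certain symmetry of the equation (the reflection γ, combined with conjugation when the
signs of a and b differ) multiplies û by (-1)^{γ·a}. If a = 0, these symmetries fix u₀, hence by
uniqueness the whole solution, and the type persists. If a ≠ 0 and the type persists, some symmetry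
sends u to -u, so u and -u both solve the equation; since N is even, N(û) = 0 and u is the heat flow
of u₀, which is the Beltrami-type condition. Conversely, under that condition the heat flow is the
solution, and it preserves every type because its symbol is real and radial.

That a persistent type must have the form above comes from the divergence: ξ_l times the transform
of Re u_l has parity e_l + α_l, and these three functions sum to zero. If their parities are not all
equal, one of the three stands alone and must vanish, against nonconstancy (`re_eq_zero_of_parity`).
The imaginary parts are treated alike.

For the existence of the eight admissible types, small data bounded by the weight `wt` give global
solutions by Picard iteration (`exists_isStrongSolution`). The initial value `datum` is a
divergence-free polynomial field with parities e_l, times a radial weight, times a factor whose two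
terms produce the real and the imaginary part. If the Beltrami-type condition held for all
parameters μ, δ, two convolution squares would agree at frequency zero (`conv_zero_eq_of_nonlin`),
and varying μ and δ would contradict the positivity of an integral (`exists_not_beltrami`). -/

open scoped Topology ContDiff

namespace NSSymmetry

noncomputable section

/-! ### Convolutions and the Fourier transform of products -/

/-- The convolution of two functions on `ℝ³`. -/
def conv (f g : E3 → ℂ) (ξ : E3) : ℂ := ∫ η, f (ξ - η) * g η

theorem measurePreserving_sub_left (ξ : E3) :
    MeasurePreserving (fun η : E3 => ξ - η) volume volume :=
  Measure.measurePreserving_sub_left volume ξ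

theorem conv_congr {f f' g g' : E3 → ℂ} (hf : f =ᵐ[volume] f') (hg : g =ᵐ[volume] g') (ξ : E3) :
    conv f g ξ = conv f' g' ξ := by
  refine integral_congr_ae ?_
  have := (measurePreserving_sub_left ξ).quasiMeasurePreserving.ae_eq_comp hf
  filter_upwards [this, hg] with η h1 h2
  simp only [Function.comp_apply] at h1
  rw [h1, h2]

theorem integrable_mul_L2 (f g : L2) : Integrable (fun x => f x * g x) :=
  memLp_one_iff_integrable.1 ((Lp.memLp g).mul' (Lp.memLp f))

/-- The reflected translate `η ↦ f (ξ - η)` of an `L²` function. -/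
def flipTranslate (ξ : E3) : L2 →ₗᵢ[ℂ] L2 :=
  Lp.compMeasurePreservingₗᵢ ℂ (fun η : E3 => ξ - η) (measurePreserving_sub_left ξ)

theorem coeFn_flipTranslate (ξ : E3) (f : L2) :
    flipTranslate ξ f =ᵐ[volume] fun η => f (ξ - η) :=
  Lp.coeFn_compMeasurePreserving f (measurePreserving_sub_left ξ)

/-- As a continuous bilinear pairing, the convolution at a fixed point is continuous in both `L²`
arguments; this allows the density argument in `fourier_prodL1`. -/
theorem conv_eq_lpPairing (f g : L2) (ξ : E3) :
    conv f g ξ = (ContinuousLinearMap.mul ℂ ℂ).lpPairing volume 2 2 (flipTranslate ξ f) g := by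
  rw [ContinuousLinearMap.lpPairing_eq_integral]
  refine integral_congr_ae ?_
  filter_upwards [coeFn_flipTranslate ξ f] with η h
  simp [h]

theorem integrable_conv_L2 (f g : L2) (ξ : E3) : Integrable (fun η => f (ξ - η) * g η) := by
  refine (integrable_mul_L2 (flipTranslate ξ f) g).congr ?_
  filter_upwards [coeFn_flipTranslate ξ f] with η h
  simp [h]

theorem prodL1_eq_holder (f g : L2) :
    prodL1 f g = (ContinuousLinearMap.mul ℂ ℂ).holder 1 f g := rfl

theorem continuous_prodL1 : Continuous fun p : L2 × L2 => prodL1 p.1 p.2 := by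
  have h := ((ContinuousLinearMap.mul ℂ ℂ).holderL (volume : Measure E3) 2 2 1).continuous₂
  exact h.congr fun p => ContinuousLinearMap.holderL_apply_apply ..

theorem continuous_conv_L2 (ξ : E3) : Continuous fun p : L2 × L2 => conv p.1 p.2 ξ := by
  obtain ⟨B, hB⟩ : ∃ B : L2 →L[ℂ] L2 →L[ℂ] ℂ, ∀ f g : L2, conv f g ξ = B (flipTranslate ξ f) g :=
    ⟨(ContinuousLinearMap.mul ℂ ℂ).lpPairing volume 2 2, fun f g => conv_eq_lpPairing f g ξ⟩
  simp_rw [hB]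
  exact B.continuous₂.comp
    (((flipTranslate ξ).continuous.comp continuous_fst).prodMk continuous_snd)

theorem continuous_fourierTransform_apply (ξ : E3) :
    Continuous fun f : Lp ℂ 1 (volume : Measure E3) => Real.Lp.fourierTransform f ξ := by
  have h := (Real.Lp.fourierTransformCLM E3 ℂ).continuous
  exact (BoundedContinuousFunction.evalCLM ℂ ξ).continuous.comp h

/-- The convolution of Schwartz functions is built from the Fourier transform, so that of `𝓕⁻ f` and
`𝓕⁻ g` is `𝓕⁻` of the product; evaluation at -ξ turns inverse transforms into transforms. -/
theorem fourier_mul_schwartz (f g : 𝓢(E3, ℂ)) (ξ : E3) :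
    𝓕 (fun x => f x * g x) ξ = conv (𝓕 f : 𝓢(E3, ℂ)) (𝓕 g : 𝓢(E3, ℂ)) ξ := by
  have h := SchwartzMap.convolution_apply (ContinuousLinearMap.mul ℂ ℂ)
    (𝓕⁻ f : 𝓢(E3, ℂ)) (𝓕⁻ g : 𝓢(E3, ℂ)) (-ξ)
  have h2 : SchwartzMap.convolution (ContinuousLinearMap.mul ℂ ℂ)
    (𝓕⁻ f : 𝓢(E3, ℂ)) (𝓕⁻ g : 𝓢(E3, ℂ)) =
      𝓕⁻ (SchwartzMap.pairing (ContinuousLinearMap.mul ℂ ℂ) f g) := by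
    simp [SchwartzMap.convolution]
  have h3 : ∀ (u : 𝓢(E3, ℂ)) (x : E3), (𝓕⁻ u : 𝓢(E3, ℂ)) x = (𝓕 u : 𝓢(E3, ℂ)) (-x) := by
    intro u x
    rw [SchwartzMap.fourierInv_coe, SchwartzMap.fourier_coe, Real.fourierInv_eq_fourier_neg]
  rw [h2, h3, neg_neg] at h
  rw [SchwartzMap.fourier_coe] at h
  have h4 : (⇑(SchwartzMap.pairing (ContinuousLinearMap.mul ℂ ℂ) f g)) = fun x => f x * g x := rfl
  rw [h4] at h
  rw [h, ← MeasureTheory.convolution_flip]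
  unfold MeasureTheory.convolution conv
  rw [← integral_neg_eq_self]
  refine integral_congr_ae (Eventually.of_forall fun η => ?_)
  simp only [ContinuousLinearMap.flip_apply, ContinuousLinearMap.mul_apply', h3]
  congr 2
  · abel
  · simp

/-- The Fourier transform of the product of two `L²` functions is the convolution of their
Fourier transforms, at every point. -/
theorem fourier_prodL1 (f g : L2) (ξ : E3) :
    Real.Lp.fourierTransform (prodL1 f g) ξ = conv (𝓕 f : L2) (𝓕 g : L2) ξ := by
  refine DenseRange.induction_on₂
    (p := fun f g : L2 => Real.Lp.fourierTransform (prodL1 f g) ξ = conv (𝓕 f : L2) (𝓕 g : L2) ξ)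
    (SchwartzMap.denseRange_toLpCLM (E := E3) (F := ℂ) (p := 2) (μ := volume)
      ENNReal.ofNat_ne_top) ?_ ?_ f g
  · refine isClosed_eq ((continuous_fourierTransform_apply ξ).comp continuous_prodL1) ?_
    have hF : Continuous fun f : L2 => (𝓕 f : L2) :=
      (Lp.fourierTransformₗᵢ E3 ℂ).continuous
    exact (continuous_conv_L2 ξ).comp
      ((hF.comp continuous_fst).prodMk (hF.comp continuous_snd))
  · intro f g
    simp only [SchwartzMap.toLpCLM_apply, SchwartzMap.toLp_fourier_eq]
    rw [conv_congr ((𝓕 f : 𝓢(E3, ℂ)).coeFn_toLp 2 volume) ((𝓕 g : 𝓢(E3, ℂ)).coeFn_toLp 2 volume),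
      ← fourier_mul_schwartz, Real.Lp.fourierTransform_apply]
    refine Real.fourier_congr_ae ?_ ξ
    filter_upwards [((Lp.memLp (g.toLp 2 volume)).mul' (Lp.memLp (f.toLp 2 volume)) :
      MemLp (fun x => f.toLp 2 volume x * g.toLp 2 volume x) 1 volume).coeFn_toLp,
      f.coeFn_toLp 2 volume, g.coeFn_toLp 2 volume] with x h1 h2 h3
    unfold prodL1
    rw [h1, h2, h3]

/-! ### Distributions tested against Fourier transforms -/

/-- The Fourier symbol `2πi ξₘ` of `∂ₘ`. -/
def derivSymbol (m : Fin 3) (ξ : E3) : ℂ := 2 * Real.pi * Complex.I * (ξ m : ℂ)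

theorem hasTemperateGrowth_coord (m : Fin 3) :
    (fun ξ : E3 => ((ξ m : ℝ) : ℂ)).HasTemperateGrowth :=
  (Complex.ofRealCLM.comp (EuclideanSpace.proj (𝕜 := ℝ) m)).hasTemperateGrowth

theorem hasTemperateGrowth_derivSymbol (m : Fin 3) : (derivSymbol m).HasTemperateGrowth := by
  have := hasTemperateGrowth_coord m
  unfold derivSymbol
  fun_prop

theorem hasTemperateGrowth_normSq :
    (fun ξ : E3 => ((‖ξ‖ ^ 2 : ℝ) : ℂ)).HasTemperateGrowth := by
  fun_prop

/-- Distributions are tested against `𝓕 φ` throughout: derivatives then become multipliers acting on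
`φ`, and every identity turns into one between integrals over frequencies. -/
theorem lineDeriv_fourier_test (T : 𝓢'(E3, ℂ)) (m : Fin 3) (φ : 𝓢(E3, ℂ)) :
    (∂_{basisVec m} T) (𝓕 φ) = (𝓕 T) (SchwartzMap.smulLeftCLM ℂ (derivSymbol m) φ) := by
  rw [TemperedDistribution.lineDerivOp_apply_apply, TemperedDistribution.fourier_apply,
    SchwartzMap.lineDerivOp_fourier_eq, ← FourierTransform.fourier_neg]
  congr 2
  ext ξ
  have h : (fun x : E3 => inner ℝ x (basisVec m)).HasTemperateGrowth := by fun_prop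
  rw [SchwartzMap.smulLeftCLM_apply_apply (hasTemperateGrowth_derivSymbol m)]
  have h' := SchwartzMap.smulLeftCLM_apply_apply h φ ξ
  simp only [basisVec] at h'
  have h2 : inner ℝ ξ (EuclideanSpace.single m (1 : ℝ)) = ξ m := by
    simp [EuclideanSpace.inner_single_right]
  simp [h', h2, derivSymbol, basisVec, mul_assoc]

theorem laplacian_fourier_test (T : 𝓢'(E3, ℂ)) (φ : 𝓢(E3, ℂ)) :
    (Δ T) (𝓕 φ) = (𝓕 T) (SchwartzMap.smulLeftCLM ℂ
      (fun ξ : E3 => ((-(4 * Real.pi ^ 2 * ‖ξ‖ ^ 2) : ℝ) : ℂ)) φ) := by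
  have h1 : (fun ξ : E3 => ((-(4 * Real.pi ^ 2 * ‖ξ‖ ^ 2) : ℝ) : ℂ)).HasTemperateGrowth := by
    fun_prop
  have hsum : Δ T = ∑ i, ∂_{basisVec i} (∂_{basisVec i} T) := by
    have := TemperedDistribution.laplacian_eq_sum (EuclideanSpace.basisFun (Fin 3) ℝ) T
    simpa [basisVec] using this
  rw [hsum]
  have key : ∀ i, (∂_{basisVec i} (∂_{basisVec i} T)) (𝓕 φ) = (𝓕 T)
      (SchwartzMap.smulLeftCLM ℂ (derivSymbol i) (SchwartzMap.smulLeftCLM ℂ (derivSymbol i) φ)) := by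
    intro i
    rw [lineDeriv_fourier_test, TemperedDistribution.fourier_apply, lineDeriv_fourier_test]
  have : (∑ i, ∂_{basisVec i} (∂_{basisVec i} T)) (𝓕 φ) =
      ∑ i, (∂_{basisVec i} (∂_{basisVec i} T)) (𝓕 φ) := by
    rw [FunLike.coe_sum, Finset.sum_apply]
  rw [this]
  simp_rw [key]
  rw [← map_sum]
  congr 1
  ext ξ
  rw [SchwartzMap.smulLeftCLM_apply_apply h1]
  simp only [FunLike.coe_sum, Finset.sum_apply]
  simp only [Fin.sum_univ_three,
    SchwartzMap.smulLeftCLM_apply_apply (hasTemperateGrowth_derivSymbol _), derivSymbol,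
    EuclideanSpace.norm_sq_eq, smul_eq_mul, Real.norm_eq_abs, sq_abs]
  push_cast
  linear_combination (-4 * Real.pi ^ 2 * (((ξ 0 : ℝ) : ℂ) ^ 2 + ((ξ 1 : ℝ) : ℂ) ^ 2 + ((ξ 2 : ℝ) : ℂ) ^ 2)
    * φ ξ) * (- Complex.I_sq)

theorem fourier_distr_apply (f : L2) (φ : 𝓢(E3, ℂ)) :
    (𝓕 (distr f)) φ = ∫ ξ, φ ξ * (𝓕 f : L2) ξ := by
  unfold distr
  rw [Lp.fourier_toTemperedDistribution_eq, Lp.toTemperedDistribution_apply]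
  rfl

theorem distr_fourier_apply (f : L2) (φ : 𝓢(E3, ℂ)) :
    (distr f) (𝓕 φ) = ∫ ξ, φ ξ * (𝓕 f : L2) ξ := by
  rw [← fourier_distr_apply]; rfl

theorem fourier_L1_apply (f : Lp ℂ 1 (volume : Measure E3)) (φ : 𝓢(E3, ℂ)) :
    (𝓕 (Lp.toTemperedDistribution f : 𝓢'(E3, ℂ))) φ =
      ∫ ξ, φ ξ * Real.Lp.fourierTransform f ξ := by
  rw [TemperedDistribution.fourier_apply, Lp.toTemperedDistribution_apply]
  have := VectorFourier.integral_fourierIntegral_smul_eq_flip (μ := volume) (ν := volume)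
    (L := innerₗ E3) (f := (φ : E3 → ℂ)) (g := (f : E3 → ℂ)) Real.continuous_fourierChar
    (by exact continuous_inner) φ.integrable (L1.integrable_coeFn f)
  rw [flip_innerₗ] at this
  exact this

/-- The bilinear term of the Navier–Stokes equations on the Fourier side, the transform of
`ℙ ∇ (u ⊗ v)`. -/
def nonlin (a b : Fin 3 → E3 → ℂ) (l : Fin 3) (ξ : E3) : ℂ :=
  ∑ k, ∑ m, derivSymbol m ξ * (leraySymbol l k ξ * conv (a m) (b k) ξ)

theorem fourier_leray_apply (l k : Fin 3) (f : Lp ℂ 1 (volume : Measure E3)) (φ : 𝓢(E3, ℂ)) :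
    (𝓕 (leray l k f)) φ =
      ∫ ξ, φ ξ * (leraySymbol l k ξ * Real.Lp.fourierTransform f ξ) := by
  unfold leray
  rw [FourierTransform.fourier_fourierInv_eq, Lp.toTemperedDistribution_apply]
  refine integral_congr_ae ?_
  filter_upwards [(lerayHat_memLp l k f).coeFn_toLp] with ξ h
  rw [h]; rfl

theorem integrable_schwartz_mul_of_memLp_top (φ : 𝓢(E3, ℂ)) {g : E3 → ℂ}
    (hg : MemLp g ∞ volume) : Integrable fun ξ => φ ξ * g ξ :=
  memLp_one_iff_integrable.1 (hg.mul' (memLp_one_iff_integrable.2 φ.integrable))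

theorem lerayConvection_fourier_test (u v : VField) (l : Fin 3) (φ : 𝓢(E3, ℂ)) :
    lerayConvection u v l (𝓕 φ) = ∫ ξ, φ ξ *
      nonlin (fun m => (𝓕 (u m) : L2)) (fun k => (𝓕 (v k) : L2)) l ξ := by
  have h : ∀ k m, (∂_{basisVec m} (leray l k (prodL1 (u m) (v k)))) (𝓕 φ) =
      ∫ ξ, φ ξ * (derivSymbol m ξ * (leraySymbol l k ξ *
        conv (𝓕 (u m) : L2) (𝓕 (v k) : L2) ξ)) := by
    intro k m
    rw [lineDeriv_fourier_test, fourier_leray_apply]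
    refine integral_congr_ae (Eventually.of_forall fun ξ => ?_)
    simp only [SchwartzMap.smulLeftCLM_apply_apply (hasTemperateGrowth_derivSymbol m),
      fourier_prodL1, smul_eq_mul]
    ring
  have hi : ∀ k m, Integrable fun ξ => φ ξ * (derivSymbol m ξ * (leraySymbol l k ξ *
      conv (𝓕 (u m) : L2) (𝓕 (v k) : L2) ξ)) := by
    intro k m
    refine (integrable_schwartz_mul_of_memLp_top
      (SchwartzMap.smulLeftCLM ℂ (derivSymbol m) φ) (lerayHat_memLp l k (prodL1 (u m) (v k)))).congr
      (Eventually.of_forall fun ξ => ?_)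
    simp only [SchwartzMap.smulLeftCLM_apply_apply (hasTemperateGrowth_derivSymbol m),
      fourier_prodL1, smul_eq_mul]
    ring
  have e1 : lerayConvection u v l (𝓕 φ) =
      ∑ k, ∑ m, (∂_{basisVec m} (leray l k (prodL1 (u m) (v k)))) (𝓕 φ) := by
    simp only [lerayConvection, FunLike.coe_sum, Finset.sum_apply]
  rw [e1]
  simp_rw [h]
  unfold nonlin
  simp_rw [Finset.mul_sum]
  rw [integral_finsetSum _ fun k _ => integrable_finsetSum _ fun m _ => hi k m]
  simp_rw [integral_finsetSum _ fun m _ => hi _ m]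

/-- Both factors are transforms of `L²` functions, so the convolution is the transform of an `L¹`
function. Its value at each single frequency is thus meaningful, which matters at the origin in
`conv_zero_eq_of_nonlin`. -/
theorem continuous_conv (f g : L2) : Continuous (conv f g) := by
  have h : conv f g = Real.Lp.fourierTransform (prodL1 (𝓕⁻ f : L2) (𝓕⁻ g : L2)) := by
    ext ξ
    rw [fourier_prodL1, FourierTransform.fourier_fourierInv_eq,
      FourierTransform.fourier_fourierInv_eq]
  rw [h]
  exact (Real.Lp.fourierTransform _).continuous

theorem distribution_eq_zero_of_fourier_test {T : 𝓢'(E3, ℂ)} (h : ∀ φ : 𝓢(E3, ℂ), T (𝓕 φ) = 0) :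
    T = 0 := by
  ext φ
  have := h (𝓕⁻ φ)
  rw [FourierTransform.fourier_fourierInv_eq] at this
  simpa using this

theorem measurable_leraySymbol (l k : Fin 3) : Measurable (leraySymbol l k) := by
  unfold leraySymbol
  exact (by fun_prop : Measurable fun ξ : E3 =>
      (((if l = k then 1 else 0) - ξ l * ξ k / ‖ξ‖ ^ 2 : ℝ) : ℂ))

theorem measurable_nonlin (a b : Fin 3 → L2) (l : Fin 3) :
    Measurable (nonlin (fun m => a m) (fun k => b k) l) := by
  unfold nonlin
  refine Finset.measurable_sum _ fun k _ => Finset.measurable_sum _ fun m _ => ?_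
  refine Measurable.mul ?_ ((measurable_leraySymbol l k).mul (continuous_conv _ _).measurable)
  unfold derivSymbol
  fun_prop

theorem norm_conv_le_L2 (f g : L2) (ξ : E3) : ‖conv f g ξ‖ ≤ ‖f‖ * ‖g‖ := by
  have h : conv f g ξ = Real.Lp.fourierTransform (prodL1 (𝓕⁻ f : L2) (𝓕⁻ g : L2)) ξ := by
    rw [fourier_prodL1, FourierTransform.fourier_fourierInv_eq,
      FourierTransform.fourier_fourierInv_eq]
  have hn : ∀ f : L2, ‖(𝓕⁻ f : L2)‖ = ‖f‖ := fun f =>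
    (Lp.fourierTransformₗᵢ E3 ℂ).symm.norm_map f
  rw [h]
  calc _ ≤ ‖Real.Lp.fourierTransformCLM E3 ℂ (prodL1 (𝓕⁻ f : L2) (𝓕⁻ g : L2))‖ :=
        (Real.Lp.fourierTransform _).norm_coe_le_norm ξ
    _ ≤ 1 * ‖prodL1 (𝓕⁻ f : L2) (𝓕⁻ g : L2)‖ := by
        refine ContinuousLinearMap.le_of_opNorm_le _ ?_ _
        exact LinearMap.mkContinuous_norm_le _ zero_le_one _
    _ ≤ ‖f‖ * ‖g‖ := by
        rw [one_mul, prodL1_eq_holder, ← hn f, ← hn g]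
        refine (ContinuousLinearMap.norm_holder_apply_apply_le _ _ _).trans ?_
        have : ‖ContinuousLinearMap.mul ℂ ℂ‖ ≤ 1 := ContinuousLinearMap.opNorm_mul_le ℂ ℂ
        have h2 : 0 ≤ ‖(𝓕⁻ f : L2)‖ * ‖(𝓕⁻ g : L2)‖ := by positivity
        nlinarith

theorem norm_leraySymbol_le (l k : Fin 3) (ξ : E3) : ‖leraySymbol l k ξ‖ ≤ 2 := by
  rw [leraySymbol, Complex.norm_real]
  have h1 : ‖(if l = k then (1 : ℝ) else 0)‖ ≤ 1 := by split_ifs <;> simp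
  have h2 : ‖ξ l * ξ k / ‖ξ‖ ^ 2‖ ≤ 1 := by
    rw [norm_div, norm_mul, norm_pow, norm_norm]
    refine div_le_one_of_le₀ ?_ (by positivity)
    rw [sq]
    exact mul_le_mul (PiLp.norm_apply_le ξ l) (PiLp.norm_apply_le ξ k)
      (norm_nonneg _) (norm_nonneg _)
  calc _ ≤ _ := norm_sub_le _ _
    _ ≤ 2 := by linarith

theorem norm_derivSymbol_le (m : Fin 3) (ξ : E3) : ‖derivSymbol m ξ‖ ≤ 2 * Real.pi * ‖ξ‖ := by
  have := PiLp.norm_apply_le ξ m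
  have hp := Real.pi_pos
  simp only [derivSymbol, norm_mul, Complex.norm_ofNat, Complex.norm_real, Complex.norm_I, mul_one,
    Real.norm_eq_abs, abs_of_pos hp] at this ⊢
  gcongr

theorem norm_nonlin_le (a b : Fin 3 → E3 → ℂ) (l : Fin 3) (ξ : E3) :
    ‖nonlin a b l ξ‖ ≤ 2 * Real.pi * ‖ξ‖ * (2 * ∑ k, ∑ m, ‖conv (a m) (b k) ξ‖) := by
  unfold nonlin
  rw [Finset.mul_sum, Finset.mul_sum]
  refine norm_sum_le_of_le _ fun k _ => ?_
  rw [Finset.mul_sum, Finset.mul_sum]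
  refine norm_sum_le_of_le _ fun m _ => ?_
  rw [norm_mul, norm_mul]
  have h1 := norm_derivSymbol_le m ξ
  have h2 := norm_leraySymbol_le l k ξ
  gcongr

theorem locallyIntegrable_nonlin (a b : Fin 3 → L2) (l : Fin 3) :
    LocallyIntegrable (nonlin (fun m => a m) (fun k => b k) l) := by
  set C : ℝ := 2 * ∑ k, ∑ m, ‖a m‖ * ‖b k‖
  have hc : Continuous fun ξ : E3 => 2 * Real.pi * ‖ξ‖ * C := by fun_prop
  refine hc.locallyIntegrable.mono (measurable_nonlin a b l).aestronglyMeasurable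
    (Eventually.of_forall fun ξ => ?_)
  refine (norm_nonlin_le _ _ _ _).trans (le_trans ?_ (Real.le_norm_self _))
  have : ∀ k m, ‖conv (a m) (b k) ξ‖ ≤ ‖a m‖ * ‖b k‖ := fun k m => norm_conv_le_L2 _ _ _
  have hp := Real.pi_pos
  simp only [C]
  gcongr
  exact this _ _

theorem ae_eq_zero_of_forall_schwartz {f : E3 → ℂ} (hf : LocallyIntegrable f)
    (h : ∀ χ : E3 → ℂ, ContDiff ℝ ∞ χ → HasCompactSupport χ → ∫ ξ, χ ξ * f ξ = 0) :
    f =ᵐ[volume] 0 := by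
  refine ae_eq_zero_of_integral_contDiff_smul_eq_zero hf fun g hg hs => ?_
  have := h (fun ξ => (g ξ : ℂ)) (Complex.ofRealCLM.contDiff.comp hg)
    (hs.comp_left (g := fun x : ℝ => (x : ℂ)) rfl)
  simpa using this

theorem lerayConvection_eq_zero_iff (u v : VField) (l : Fin 3) :
    lerayConvection u v l = 0 ↔
      nonlin (fun m => (𝓕 (u m) : L2)) (fun k => (𝓕 (v k) : L2)) l =ᵐ[volume] 0 := by
  constructor
  · intro h
    refine ae_eq_zero_of_forall_schwartz (locallyIntegrable_nonlin _ _ l) fun χ hχ hs => ?_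
    have := lerayConvection_fourier_test u v l (hs.toSchwartzMap hχ)
    rw [h] at this
    simpa using this.symm
  · intro h
    refine distribution_eq_zero_of_fourier_test fun φ => ?_
    rw [lerayConvection_fourier_test, integral_eq_zero_of_ae]
    filter_upwards [h] with ξ hξ
    rw [hξ]; simp

theorem integrable_schwartz_mul_L2 (φ : 𝓢(E3, ℂ)) (f : L2) : Integrable fun ξ => φ ξ * f ξ :=
  memLp_one_iff_integrable.1 ((Lp.memLp f).mul' (φ.memLp 2 volume))

theorem locallyIntegrable_L2 (f : L2) : LocallyIntegrable f :=
  (Lp.memLp f).locallyIntegrable (by norm_num)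

theorem divergence_eq_zero_iff (u : VField) :
    divergence u = 0 ↔ ∀ᵐ ξ : E3, ∑ l, (ξ l : ℂ) * (𝓕 (u l) : L2) ξ = 0 := by
  have hi : ∀ (φ : 𝓢(E3, ℂ)) l, Integrable fun ξ => φ ξ * (derivSymbol l ξ * (𝓕 (u l) : L2) ξ) := by
    intro φ l
    refine (integrable_schwartz_mul_L2 (SchwartzMap.smulLeftCLM ℂ (derivSymbol l) φ)
      (𝓕 (u l) : L2)).congr
      (Eventually.of_forall fun ξ => ?_)
    simp only [SchwartzMap.smulLeftCLM_apply_apply (hasTemperateGrowth_derivSymbol l), smul_eq_mul]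
    ring
  have key : ∀ φ : 𝓢(E3, ℂ), divergence u (𝓕 φ) =
      ∫ ξ, φ ξ * ∑ l, derivSymbol l ξ * (𝓕 (u l) : L2) ξ := by
    intro φ
    simp only [divergence, FunLike.coe_sum, Finset.sum_apply]
    simp_rw [Finset.mul_sum]
    rw [integral_finsetSum _ fun l _ => hi φ l]
    refine Finset.sum_congr rfl fun l _ => ?_
    rw [lineDeriv_fourier_test, fourier_distr_apply]
    refine integral_congr_ae (Eventually.of_forall fun ξ => ?_)
    simp only [SchwartzMap.smulLeftCLM_apply_apply (hasTemperateGrowth_derivSymbol l), smul_eq_mul]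
    ring
  have hsum : ∀ ξ : E3, ∑ l, derivSymbol l ξ * (𝓕 (u l) : L2) ξ =
      2 * Real.pi * Complex.I * ∑ l, (ξ l : ℂ) * (𝓕 (u l) : L2) ξ := by
    intro ξ
    rw [Finset.mul_sum]
    refine Finset.sum_congr rfl fun l _ => ?_
    unfold derivSymbol; ring
  constructor
  · intro h
    have h0 : (fun ξ => ∑ l, derivSymbol l ξ * (𝓕 (u l) : L2) ξ) =ᵐ[volume] 0 := by
      refine ae_eq_zero_of_forall_schwartz ?_ fun χ hχ hs => ?_
      · refine locallyIntegrable_finsetSum _ fun l _ => ?_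
        rw [← locallyIntegrableOn_univ]
        refine LocallyIntegrableOn.continuousOn_mul
          ((locallyIntegrable_L2 _).locallyIntegrableOn _) ?_ isOpen_univ.isLocallyClosed
        unfold derivSymbol
        fun_prop
      · have := key (hs.toSchwartzMap hχ)
        rw [h] at this
        simpa using this.symm
    filter_upwards [h0] with ξ hξ
    rw [hsum] at hξ
    simpa [Real.pi_ne_zero] using hξ
  · intro h
    refine distribution_eq_zero_of_fourier_test fun φ => ?_
    rw [key, integral_eq_zero_of_ae]
    filter_upwards [h] with ξ hξ
    rw [hsum, hξ]; simp

/-! ### The weak heat equation on the Fourier side -/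

/-- `∂ₜ w = -4π² |ξ|² w - Φ` for `t > 0`, tested against `|ξ|² χ` with `χ` smooth of compact
support. -/
def WeakHeat (w : ℝ → L2) (Φ : ℝ → E3 → ℂ) : Prop :=
  ∀ t, 0 < t → ∀ χ : E3 → ℂ, ContDiff ℝ ∞ χ → HasCompactSupport χ →
    HasDerivAt (fun s => ∫ ξ, ((‖ξ‖ ^ 2 : ℝ) : ℂ) * χ ξ * w s ξ)
      (∫ ξ, ((‖ξ‖ ^ 2 : ℝ) : ℂ) * χ ξ * (((-(4 * Real.pi ^ 2 * ‖ξ‖ ^ 2) : ℝ) : ℂ) * w t ξ - Φ t ξ)) t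

/-- The Fourier transform of a vector field. -/
def hat (u : VField) : VField := fun l => (𝓕 (u l) : L2)

/-- The Fourier symbol of `|ξ|² ℙ`. -/
def projSymbol (l k : Fin 3) (ξ : E3) : ℂ :=
  ((((if l = k then 1 else 0) * ‖ξ‖ ^ 2 - ξ l * ξ k : ℝ)) : ℂ)

theorem hasTemperateGrowth_projSymbol (l k : Fin 3) : (projSymbol l k).HasTemperateGrowth := by
  have h1 := hasTemperateGrowth_coord l
  have h2 := hasTemperateGrowth_coord k
  have h3 := hasTemperateGrowth_normSq
  have : projSymbol l k = fun ξ => (if l = k then 1 else 0) * ((‖ξ‖ ^ 2 : ℝ) : ℂ)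
      - ((ξ l : ℝ) : ℂ) * ((ξ k : ℝ) : ℂ) := by
    ext ξ; unfold projSymbol; split_ifs <;> push_cast <;> rfl
  rw [this]
  fun_prop

theorem projSymbol_eq (l k : Fin 3) (ξ : E3) :
    projSymbol l k ξ = ((‖ξ‖ ^ 2 : ℝ) : ℂ) * leraySymbol k l ξ := by
  unfold projSymbol leraySymbol
  rw [← Complex.ofReal_mul]
  congr 1
  by_cases h : ξ = 0
  · simp [h]
  · have : ‖ξ‖ ^ 2 ≠ 0 := by positivity
    field_simp
    simp only [eq_comm (a := l)]
    ring

/-- The projection annihilates gradients; this is what eliminates the pressure. -/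
theorem sum_derivSymbol_mul_projSymbol (k : Fin 3) (ξ : E3) :
    ∑ l, derivSymbol l ξ * projSymbol l k ξ = 0 := by
  have : ∀ l, derivSymbol l ξ * projSymbol l k ξ = 2 * Real.pi * Complex.I *
      ((ξ l * ((if l = k then 1 else 0) * ‖ξ‖ ^ 2 - ξ l * ξ k) : ℝ) : ℂ) := by
    intro l; unfold derivSymbol projSymbol; push_cast; ring
  simp_rw [this]
  rw [← Finset.mul_sum, ← Complex.ofReal_sum]
  have h2 : ∑ l, (ξ l * ((if l = k then 1 else 0) * ‖ξ‖ ^ 2 - ξ l * ξ k)) = 0 := by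
    rw [EuclideanSpace.norm_sq_eq]
    fin_cases k <;> simp [Fin.sum_univ_three] <;> ring
  rw [h2]; simp

theorem sum_projSymbol_mul {a : Fin 3 → ℂ} {ξ : E3} (h : ∑ l, (ξ l : ℂ) * a l = 0) (k : Fin 3) :
    ∑ l, projSymbol l k ξ * a l = ((‖ξ‖ ^ 2 : ℝ) : ℂ) * a k := by
  have : ∀ l, projSymbol l k ξ * a l = (if l = k then ((‖ξ‖ ^ 2 : ℝ) : ℂ) * a k else 0)
      - ξ k * ((ξ l : ℂ) * a l) := by
    intro l; unfold projSymbol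
    split_ifs with hlk
    · subst hlk; push_cast; ring
    · push_cast; ring
  simp_rw [this, Finset.sum_sub_distrib, ← Finset.mul_sum, h]
  simp

theorem convection_fourier_test (u v : VField) (l : Fin 3) (φ : 𝓢(E3, ℂ)) :
    convection u v l (𝓕 φ) = ∫ ξ, φ ξ * ∑ m, derivSymbol m ξ * conv (hat u m) (hat v l) ξ := by
  have hi : ∀ m, Integrable fun ξ => φ ξ * (derivSymbol m ξ * conv (hat u m) (hat v l) ξ) := by
    intro m
    have h2 : MemLp (conv (hat u m) (hat v l)) ∞ volume := by
      refine memLp_top_of_bound (continuous_conv _ _).aestronglyMeasurable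
        (‖hat u m‖ * ‖hat v l‖) (Eventually.of_forall fun ξ => norm_conv_le_L2 _ _ ξ)
    refine (integrable_schwartz_mul_of_memLp_top
      (SchwartzMap.smulLeftCLM ℂ (derivSymbol m) φ) h2).congr (Eventually.of_forall fun ξ => ?_)
    simp only [SchwartzMap.smulLeftCLM_apply_apply (hasTemperateGrowth_derivSymbol m), smul_eq_mul]
    ring
  simp only [convection, FunLike.coe_sum, Finset.sum_apply]
  simp_rw [Finset.mul_sum]
  rw [integral_finsetSum _ fun m _ => hi m]
  refine Finset.sum_congr rfl fun m _ => ?_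
  rw [lineDeriv_fourier_test, fourier_L1_apply]
  refine integral_congr_ae (Eventually.of_forall fun ξ => ?_)
  simp only [SchwartzMap.smulLeftCLM_apply_apply (hasTemperateGrowth_derivSymbol m), smul_eq_mul,
    fourier_prodL1, hat]
  ring

theorem nonlin_projSymbol (a b : Fin 3 → E3 → ℂ) (k : Fin 3) (ξ : E3) :
    ∑ l, projSymbol l k ξ * ∑ m, derivSymbol m ξ * conv (a m) (b l) ξ =
      ((‖ξ‖ ^ 2 : ℝ) : ℂ) * nonlin a b k ξ := by
  unfold nonlin
  rw [Finset.mul_sum]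
  refine Finset.sum_congr rfl fun l _ => ?_
  rw [Finset.mul_sum, Finset.mul_sum]
  refine Finset.sum_congr rfl fun m _ => ?_
  rw [projSymbol_eq]; ring

theorem integrable_schwartz_mul_conv (φ : 𝓢(E3, ℂ)) (f g : L2) (m : Fin 3) :
    Integrable fun ξ => φ ξ * (derivSymbol m ξ * conv f g ξ) := by
  have h2 : MemLp (conv f g) ∞ volume :=
    memLp_top_of_bound (continuous_conv _ _).aestronglyMeasurable
      (‖f‖ * ‖g‖) (Eventually.of_forall fun ξ => norm_conv_le_L2 _ _ ξ)
  refine (integrable_schwartz_mul_of_memLp_top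
    (SchwartzMap.smulLeftCLM ℂ (derivSymbol m) φ) h2).congr (Eventually.of_forall fun ξ => ?_)
  simp only [SchwartzMap.smulLeftCLM_apply_apply (hasTemperateGrowth_derivSymbol m), smul_eq_mul]
  ring

/-- The momentum equation is tested against `𝓕 (ψ l)` with ψ_l = `projSymbol l k` χ and summed over
l. The pressure drops out, and since u is divergence free the velocity terms collapse to |ξ|²χ û_k.
The factor |ξ|² clears the denominator of the Leray symbol, which is not smooth at 0, so that the
ψ_l are Schwartz functions. -/
theorem IsStrongSolution.weakHeat {u₀ : VField} {u : ℝ → VField} (hu : IsStrongSolution u₀ u)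
    (k : Fin 3) : WeakHeat (fun t => hat (u t) k)
      (fun t => nonlin (fun m => hat (u t) m) (fun m => hat (u t) m) k) := by
  intro t ht χ hχ hs
  set X : 𝓢(E3, ℂ) := hs.toSchwartzMap hχ with hX
  have hXa : ∀ ξ, X ξ = χ ξ := fun ξ => rfl
  set ψ : Fin 3 → 𝓢(E3, ℂ) := fun l => SchwartzMap.smulLeftCLM ℂ (projSymbol l k) X with hψ
  have hψa : ∀ l ξ, ψ l ξ = projSymbol l k ξ * χ ξ := by
    intro l ξ
    simp only [hψ, SchwartzMap.smulLeftCLM_apply_apply (hasTemperateGrowth_projSymbol l k), hXa,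
      smul_eq_mul]
  obtain ⟨p, hp⟩ := hu.momentum t ht
  have hsum := HasDerivAt.fun_sum (u := Finset.univ) fun l _ => hp l (𝓕 (ψ l))
  have hval : ∀ s, 0 ≤ s → ∑ l, (distr (u s l)) (𝓕 (ψ l)) =
      ∫ ξ, ((‖ξ‖ ^ 2 : ℝ) : ℂ) * χ ξ * hat (u s) k ξ := by
    intro s hs0
    simp_rw [distr_fourier_apply]
    rw [← integral_finsetSum _ fun l _ => integrable_schwartz_mul_L2 (ψ l) (𝓕 (u s l) : L2)]
    refine integral_congr_ae ?_
    filter_upwards [(divergence_eq_zero_iff (u s)).1 (hu.divergence_free s hs0)] with ξ hξ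
    have := sum_projSymbol_mul hξ k
    simp only [hψa, hat]
    calc _ = χ ξ * ∑ l, projSymbol l k ξ * (𝓕 (u s l) : L2) ξ := by
          rw [Finset.mul_sum]; exact Finset.sum_congr rfl fun l _ => by ring
      _ = _ := by rw [this]; ring
  refine (hsum.congr_of_eventuallyEq ?_).congr_deriv ?_
  · filter_upwards [lt_mem_nhds ht] with s hs0
    rw [hval s hs0.le]
  · have e1 : ∑ l, (Δ (distr (u t l))) (𝓕 (ψ l)) = ∫ ξ, ((‖ξ‖ ^ 2 : ℝ) : ℂ) * χ ξ *
        (((-(4 * Real.pi ^ 2 * ‖ξ‖ ^ 2) : ℝ) : ℂ) * hat (u t) k ξ) := by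
      have hg : (fun ξ : E3 => ((-(4 * Real.pi ^ 2 * ‖ξ‖ ^ 2) : ℝ) : ℂ)).HasTemperateGrowth := by
        fun_prop
      simp_rw [laplacian_fourier_test, fourier_distr_apply]
      rw [← integral_finsetSum _ fun l _ => integrable_schwartz_mul_L2 _ (𝓕 (u t l) : L2)]
      refine integral_congr_ae ?_
      filter_upwards [(divergence_eq_zero_iff (u t)).1 (hu.divergence_free t ht.le)] with ξ hξ
      have := sum_projSymbol_mul hξ k
      simp only [SchwartzMap.smulLeftCLM_apply_apply hg, hψa, hat, smul_eq_mul]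
      generalize ((-(4 * Real.pi ^ 2 * ‖ξ‖ ^ 2) : ℝ) : ℂ) = c
      calc _ = c * χ ξ * ∑ l, projSymbol l k ξ * (𝓕 (u t l) : L2) ξ := by
            rw [Finset.mul_sum]; exact Finset.sum_congr rfl fun l _ => by ring
        _ = _ := by rw [this]; ring
    have i2 : ∀ l, Integrable fun ξ =>
        ψ l ξ * ∑ m, derivSymbol m ξ * conv (hat (u t) m) (hat (u t) l) ξ := by
      intro l
      simp_rw [Finset.mul_sum]
      exact integrable_finsetSum _ fun m _ => integrable_schwartz_mul_conv _ _ _ _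
    have e2' : ∀ ξ, ∑ l, ψ l ξ * ∑ m, derivSymbol m ξ * conv (hat (u t) m) (hat (u t) l) ξ =
        ((‖ξ‖ ^ 2 : ℝ) : ℂ) * χ ξ *
          nonlin (fun m => hat (u t) m) (fun m => hat (u t) m) k ξ := by
      intro ξ
      have := nonlin_projSymbol (fun m => hat (u t) m) (fun m => hat (u t) m) k ξ
      simp only [hψa]
      calc _ = χ ξ * ∑ l, projSymbol l k ξ *
            ∑ m, derivSymbol m ξ * conv (hat (u t) m) (hat (u t) l) ξ := by
            rw [Finset.mul_sum]; exact Finset.sum_congr rfl fun l _ => by ring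
        _ = _ := by rw [this]; ring
    have e2 : ∑ l, (convection (u t) (u t) l) (𝓕 (ψ l)) = ∫ ξ, ((‖ξ‖ ^ 2 : ℝ) : ℂ) * χ ξ *
        nonlin (fun m => hat (u t) m) (fun m => hat (u t) m) k ξ := by
      simp_rw [convection_fourier_test]
      rw [← integral_finsetSum _ fun l _ => i2 l]
      simp_rw [e2']
    have e3 : ∑ l, (∂_{basisVec l} p) (𝓕 (ψ l)) = 0 := by
      simp_rw [lineDeriv_fourier_test]
      rw [← map_sum]
      have : ∑ l, SchwartzMap.smulLeftCLM ℂ (derivSymbol l) (ψ l) = 0 := by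
        ext ξ
        simp only [FunLike.coe_sum, Finset.sum_apply, hψa,
          SchwartzMap.smulLeftCLM_apply_apply (hasTemperateGrowth_derivSymbol _), smul_eq_mul]
        simp_rw [← mul_assoc, ← Finset.sum_mul, sum_derivSymbol_mul_projSymbol]
        simp
      rw [this, map_zero]
    have i1 : Integrable fun ξ => ((‖ξ‖ ^ 2 : ℝ) : ℂ) * χ ξ *
        (((-(4 * Real.pi ^ 2 * ‖ξ‖ ^ 2) : ℝ) : ℂ) * hat (u t) k ξ) := by
      have hg : (fun ξ : E3 => ((‖ξ‖ ^ 2 : ℝ) : ℂ) *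
          ((-(4 * Real.pi ^ 2 * ‖ξ‖ ^ 2) : ℝ) : ℂ)).HasTemperateGrowth := by fun_prop
      refine (integrable_schwartz_mul_L2 (SchwartzMap.smulLeftCLM ℂ (fun ξ : E3 =>
        ((‖ξ‖ ^ 2 : ℝ) : ℂ) * ((-(4 * Real.pi ^ 2 * ‖ξ‖ ^ 2) : ℝ) : ℂ)) X) (hat (u t) k)).congr
        (Eventually.of_forall fun ξ => ?_)
      simp only [SchwartzMap.smulLeftCLM_apply_apply hg, hXa, smul_eq_mul]
      ring
    have i2s : Integrable fun ξ => ((‖ξ‖ ^ 2 : ℝ) : ℂ) * χ ξ *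
        nonlin (fun m => hat (u t) m) (fun m => hat (u t) m) k ξ := by
      simp_rw [← e2']
      exact integrable_finsetSum _ fun l _ => i2 l
    simp_rw [mul_sub]
    rw [integral_sub i1 i2s, ← e1, ← e2]
    have hpt : ∀ l, (Δ (distr (u t l)) - convection (u t) (u t) l + ∂_{basisVec l} p) (𝓕 (ψ l)) =
        (Δ (distr (u t l))) (𝓕 (ψ l)) - (convection (u t) (u t) l) (𝓕 (ψ l)) +
          (∂_{basisVec l} p) (𝓕 (ψ l)) := fun l => rfl
    simp_rw [hpt]
    rw [Finset.sum_add_distrib, Finset.sum_sub_distrib, e3, add_zero]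

/-! ### Tools in `L²` -/

theorem enorm_sq_L2 (f : L2) : ‖f‖ₑ ^ 2 = ∫⁻ ξ, ‖f ξ‖ₑ ^ 2 := by
  rw [Lp.enorm_def, eLpNorm_eq_lintegral_rpow_enorm_toReal (by norm_num) (by norm_num),
    ← ENNReal.rpow_natCast, ← ENNReal.rpow_mul]
  simp

theorem enorm_sq_L2_congr {f : L2} {a : E3 → ℂ} (h : f =ᵐ[volume] a) :
    ‖f‖ₑ ^ 2 = ∫⁻ ξ, ‖a ξ‖ₑ ^ 2 := by
  rw [enorm_sq_L2]
  exact lintegral_congr_ae (by filter_upwards [h] with ξ hξ; rw [hξ])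

theorem norm_sq_L2 (f : L2) : ‖f‖ ^ 2 = ∫ ξ, ‖f ξ‖ ^ 2 := by
  have h : (inner ℂ f f : ℂ) = ((‖f‖ ^ 2 : ℝ) : ℂ) := by
    rw [inner_self_eq_norm_sq_to_K]; simp
  rw [MeasureTheory.L2.inner_def] at h
  have h2 : ∀ ξ, inner ℂ (f ξ) (f ξ) = ((‖f ξ‖ ^ 2 : ℝ) : ℂ) := by
    intro ξ
    rw [inner_self_eq_norm_sq_to_K]; simp
  simp_rw [h2] at h
  rw [integral_complex_ofReal] at h
  exact_mod_cast h.symm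

/-- Dominated convergence in `L²`. -/
theorem tendsto_L2_of_dominated {ι : Type*} {l : Filter ι} [l.IsCountablyGenerated]
    {F : ι → L2} {f : L2} {a : ι → E3 → ℂ} {b : E3 → ℂ} {G : E3 → ℝ} (hG : MemLp G 2 volume)
    (hF : ∀ᶠ n in l, F n =ᵐ[volume] a n) (hf : f =ᵐ[volume] b)
    (hbd : ∀ᶠ n in l, ∀ ξ, ‖a n ξ‖ ≤ G ξ) (hb : ∀ ξ, ‖b ξ‖ ≤ G ξ)
    (hlim : ∀ ξ, Tendsto (fun n => a n ξ) l (𝓝 (b ξ))) : Tendsto F l (𝓝 f) := by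
  have h2 : Tendsto (fun n => ∫ ξ, ‖a n ξ - b ξ‖ ^ 2) l (𝓝 (∫ _ : E3, 0)) := by
    refine tendsto_integral_filter_of_dominated_convergence (fun ξ => (2 * G ξ) ^ 2) ?_ ?_ ?_ ?_
    · filter_upwards [hF] with n hn
      exact ((((Lp.aestronglyMeasurable (F n)).congr hn).sub
        ((Lp.aestronglyMeasurable f).congr hf)).norm.pow 2)
    · filter_upwards [hbd] with n hn
      refine Eventually.of_forall fun ξ => ?_
      rw [Real.norm_eq_abs, abs_of_nonneg (by positivity)]
      gcongr
      linarith [norm_sub_le (a n ξ) (b ξ), hn ξ, hb ξ]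
    · exact (hG.const_mul 2).integrable_sq
    · refine Eventually.of_forall fun ξ => ?_
      have h3 : Tendsto (fun n => a n ξ - b ξ) l (𝓝 0) := by
        simpa using (hlim ξ).sub_const (b ξ)
      simpa using h3.norm.pow 2
  rw [integral_zero] at h2
  have h3 : Tendsto (fun n => ‖F n - f‖ ^ 2) l (𝓝 0) := by
    refine h2.congr' ?_
    filter_upwards [hF] with n hn
    rw [norm_sq_L2]
    refine integral_congr_ae ?_
    filter_upwards [hn, hf, Lp.coeFn_sub (F n) f] with ξ e1 e2 e3
    rw [e3, Pi.sub_apply, e1, e2]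
  rw [tendsto_iff_norm_sub_tendsto_zero]
  have := (Real.continuous_sqrt.tendsto 0).comp h3
  simpa [Function.comp_def, Real.sqrt_sq (norm_nonneg _)] using this

/-! ### The bilinear pairing on `L²` and a product rule -/

/-- The bilinear pairing `∫ f g` on `L²`. -/
@[irreducible] def pairL2 : L2 →L[ℂ] L2 →L[ℂ] ℂ := (ContinuousLinearMap.mul ℂ ℂ).lpPairing volume 2 2

theorem pairL2_apply (f g : L2) : pairL2 f g = ∫ ξ, f ξ * g ξ := by
  unfold pairL2
  exact (ContinuousLinearMap.mul ℂ ℂ).lpPairing_eq_integral f g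

theorem pairL2_eq_of_ae {f : L2} {a : E3 → ℂ} (h : f =ᵐ[volume] a) (g : L2) :
    pairL2 f g = ∫ ξ, a ξ * g ξ := by
  rw [pairL2_apply]
  exact integral_congr_ae (by filter_upwards [h] with ξ hξ; rw [hξ])

theorem pairL2_conj_self {f g : L2} (h : g =ᵐ[volume] fun ξ => (starRingEnd ℂ) (f ξ)) :
    pairL2 g f = ((‖f‖ ^ 2 : ℝ) : ℂ) := by
  rw [pairL2_eq_of_ae h, norm_sq_L2, ← integral_complex_ofReal]
  refine integral_congr_ae (Eventually.of_forall fun ξ => ?_)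
  simp only [mul_comm, Complex.mul_conj, Complex.normSq_eq_norm_sq]

/-- A product rule in which `w` is merely continuous: only its pairing with the frozen value `P s`
has to be differentiable. The slope splits into `B` of the slope of `P` against `w r`, plus the
slope of the frozen pairing. -/
theorem hasDerivAt_bilin {E F G : Type*} [NormedAddCommGroup E] [NormedSpace ℂ E]
    [NormedAddCommGroup F] [NormedSpace ℂ F] [NormedAddCommGroup G] [NormedSpace ℂ G]
    (B : E →L[ℂ] F →L[ℂ] G) {P : ℝ → E} {w : ℝ → F} {P' : E} {D : G} {s : ℝ}
    (hP : HasDerivAt P P' s) (hw : ContinuousAt w s)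
    (hD : HasDerivAt (fun r => B (P s) (w r)) D s) :
    HasDerivAt (fun r => B (P r) (w r)) (B P' (w s) + D) s := by
  rw [hasDerivAt_iff_tendsto_slope] at *
  have h1 : Tendsto (fun r => B (slope P s r) (w r)) (𝓝[≠] s) (𝓝 (B P' (w s))) :=
    (B.continuous₂.tendsto (P', w s)).comp
      (hP.prodMk_nhds (hw.tendsto.mono_left nhdsWithin_le_nhds))
  refine (h1.add hD).congr fun r => ?_
  simp only [slope_def_module]
  rw [B.map_smul_of_tower, FunLike.coe_smul, Pi.smul_apply, ← smul_add, map_sub, sub_apply]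
  congr 1
  abel

theorem continuousOn_bilin {E F G : Type*} [NormedAddCommGroup E] [NormedSpace ℂ E]
    [NormedAddCommGroup F] [NormedSpace ℂ F] [NormedAddCommGroup G] [NormedSpace ℂ G]
    (B : E →L[ℂ] F →L[ℂ] G) {P : ℝ → E} {w : ℝ → F} {S : Set ℝ}
    (hP : ContinuousOn P S) (hw : ContinuousOn w S) :
    ContinuousOn (fun r => B (P r) (w r)) S :=
  B.continuous₂.comp_continuousOn (hP.prodMk hw)

/-! ### Test functions `|ξ|² χ` are dense in `L²` -/

/-- The functions `|ξ|² χ` with `χ` smooth of compact support, as a subspace of `L²`. -/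
def testSpace : Submodule ℂ L2 where
  carrier := {ψ | ∃ χ : E3 → ℂ, ContDiff ℝ ∞ χ ∧ HasCompactSupport χ ∧
    ψ =ᵐ[volume] fun ξ => ((‖ξ‖ ^ 2 : ℝ) : ℂ) * χ ξ}
  add_mem' := by
    rintro f g ⟨χ, h1, h2, h3⟩ ⟨χ', h1', h2', h3'⟩
    refine ⟨χ + χ', h1.add h1', h2.add h2', ?_⟩
    filter_upwards [h3, h3', Lp.coeFn_add f g] with ξ e1 e2 e3
    rw [e3, Pi.add_apply, e1, e2, Pi.add_apply, mul_add]
  zero_mem' := by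
    refine ⟨0, contDiff_const, HasCompactSupport.zero, ?_⟩
    filter_upwards [Lp.coeFn_zero ℂ 2 (volume : Measure E3)] with ξ e
    rw [e]; simp
  smul_mem' := by
    rintro c f ⟨χ, h1, h2, h3⟩
    refine ⟨fun ξ => c * χ ξ, contDiff_const.mul h1, h2.mul_left, ?_⟩
    filter_upwards [h3, Lp.coeFn_smul c f] with ξ e1 e2
    rw [e2, Pi.smul_apply, e1, smul_eq_mul]; ring

theorem memLp_of_smooth_compact {χ : E3 → ℂ} (h1 : Continuous χ) (h2 : HasCompactSupport χ) :
    MemLp χ 2 volume := h1.memLp_of_hasCompactSupport h2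

theorem ae_ne_zero : ∀ᵐ ξ : E3, ξ ≠ 0 := by
  have : ({0} : Set E3)ᶜ ∈ ae (volume : Measure E3) := by
    rw [mem_ae_iff, compl_compl]; exact measure_singleton 0
  exact this

/-- If v is orthogonal to all |ξ|²χ, then |ξ|²v vanishes as a distribution, so v = 0 away from the
origin, a null set. -/
theorem dense_testSpace : Dense (testSpace : Set L2) := by
  rw [Submodule.dense_iff_topologicalClosure_eq_top, Submodule.topologicalClosure_eq_top_iff,
    Submodule.eq_bot_iff]
  intro v hv
  rw [Submodule.mem_orthogonal] at hv
  have hz : (fun ξ : E3 => ((‖ξ‖ ^ 2 : ℝ) : ℂ) * v ξ) =ᵐ[volume] 0 := by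
    refine ae_eq_zero_of_integral_contDiff_smul_eq_zero ?_ fun g hg hs => ?_
    · rw [← locallyIntegrableOn_univ]
      exact LocallyIntegrableOn.continuousOn_mul ((locallyIntegrable_L2 _).locallyIntegrableOn _)
        (by fun_prop) isOpen_univ.isLocallyClosed
    · have hgc : ContDiff ℝ ∞ fun ξ => (g ξ : ℂ) := Complex.ofRealCLM.contDiff.comp hg
      have hgs : HasCompactSupport fun ξ => (g ξ : ℂ) :=
        hs.comp_left (g := fun x : ℝ => (x : ℂ)) rfl
      have hm : MemLp (fun ξ : E3 => ((‖ξ‖ ^ 2 : ℝ) : ℂ) * (g ξ : ℂ)) 2 volume :=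
        memLp_of_smooth_compact (Continuous.mul (by fun_prop) hgc.continuous) hgs.mul_left
      have := hv (hm.toLp _) ⟨_, hgc, hgs, hm.coeFn_toLp⟩
      rw [MeasureTheory.L2.inner_def] at this
      rw [← this]
      refine integral_congr_ae ?_
      filter_upwards [hm.coeFn_toLp] with ξ e
      rw [e, RCLike.inner_apply, map_mul, Complex.conj_ofReal, Complex.conj_ofReal,
        Complex.real_smul]
      ring
  rw [Lp.eq_zero_iff_ae_eq_zero]
  filter_upwards [hz, ae_ne_zero] with ξ e h0
  simpa [h0] using e

/-! ### The Gaussian symbol -/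

/-- The real heat symbol. -/
def gauss (r : ℝ) (ξ : E3) : ℝ := Real.exp (-(4 * Real.pi ^ 2 * r * ‖ξ‖ ^ 2))

theorem gauss_pos (r : ℝ) (ξ : E3) : 0 < gauss r ξ := Real.exp_pos _

theorem gauss_le_one {r : ℝ} (hr : 0 ≤ r) (ξ : E3) : gauss r ξ ≤ 1 := by
  unfold gauss
  rw [Real.exp_le_one_iff]
  have : 0 ≤ 4 * Real.pi ^ 2 * r * ‖ξ‖ ^ 2 := by positivity
  linarith

theorem gauss_zero (ξ : E3) : gauss 0 ξ = 1 := by simp [gauss]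

theorem gauss_add (r s : ℝ) (ξ : E3) : gauss (r + s) ξ = gauss r ξ * gauss s ξ := by
  unfold gauss; rw [← Real.exp_add]; congr 1; ring

theorem contDiff_gauss (r : ℝ) : ContDiff ℝ ∞ (gauss r) := by
  unfold gauss
  have : ContDiff ℝ ∞ fun ξ : E3 => ‖ξ‖ ^ 2 := contDiff_norm_sq ℝ
  fun_prop

theorem continuous_gauss (r : ℝ) : Continuous (gauss r) := (contDiff_gauss r).continuous

theorem continuous_gauss_time (ξ : E3) : Continuous fun r => gauss r ξ := by
  unfold gauss; fun_prop

theorem hasDerivAt_gauss (r : ℝ) (ξ : E3) :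
    HasDerivAt (fun s => gauss s ξ) (-(4 * Real.pi ^ 2 * ‖ξ‖ ^ 2) * gauss r ξ) r := by
  unfold gauss
  have h : HasDerivAt (fun s : ℝ => -(4 * Real.pi ^ 2 * s * ‖ξ‖ ^ 2))
      (-(4 * Real.pi ^ 2 * ‖ξ‖ ^ 2)) r := by
    have := ((hasDerivAt_id r).const_mul (4 * Real.pi ^ 2)).mul_const (‖ξ‖ ^ 2) |>.fun_neg
    simpa using this
  convert h.exp using 1
  ring

theorem abs_exp_neg_sub_le {x y : ℝ} (hx : 0 ≤ x) (hy : 0 ≤ y) :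
    |Real.exp (-x) - Real.exp (-y)| ≤ |x - y| := by
  wlog h : x ≤ y generalizing x y
  · rw [abs_sub_comm, abs_sub_comm x]
    exact this hy hx (le_of_not_ge h)
  have h1 : Real.exp (-y) ≤ Real.exp (-x) := Real.exp_le_exp.2 (by linarith)
  rw [abs_of_nonneg (by linarith), abs_sub_comm, abs_of_nonneg (by linarith)]
  have h2 : Real.exp (-y) = Real.exp (-x) * Real.exp (-(y - x)) := by
    rw [← Real.exp_add]; congr 1; ring
  have h3 : 1 - (y - x) ≤ Real.exp (-(y - x)) := by
    linarith [Real.add_one_le_exp (-(y - x))]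
  have h4 : Real.exp (-x) ≤ 1 := Real.exp_le_one_iff.2 (by linarith)
  have h5 := Real.exp_pos (-x)
  rw [h2]
  nlinarith

theorem abs_gauss_sub_le {r s : ℝ} (hr : 0 ≤ r) (hs : 0 ≤ s) (ξ : E3) :
    |gauss r ξ - gauss s ξ| ≤ 4 * Real.pi ^ 2 * ‖ξ‖ ^ 2 * |r - s| := by
  have h := abs_exp_neg_sub_le (x := 4 * Real.pi ^ 2 * r * ‖ξ‖ ^ 2)
    (y := 4 * Real.pi ^ 2 * s * ‖ξ‖ ^ 2) (by positivity) (by positivity)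
  refine h.trans (le_of_eq ?_)
  have : 4 * Real.pi ^ 2 * r * ‖ξ‖ ^ 2 - 4 * Real.pi ^ 2 * s * ‖ξ‖ ^ 2 =
    4 * Real.pi ^ 2 * ‖ξ‖ ^ 2 * (r - s) := by ring
  rw [this, abs_mul, abs_of_nonneg (by positivity : 0 ≤ 4 * Real.pi ^ 2 * ‖ξ‖ ^ 2)]

/-! ### The energy estimate, by duality -/

theorem lintegral_exp_le {c t : ℝ} (hc : 0 ≤ c) (ht : 0 ≤ t) :
    ∫⁻ s in Icc 0 t, ENNReal.ofReal (c * Real.exp (-(c * (t - s)))) ≤ 1 := by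
  have hcont : Continuous fun s => c * Real.exp (-(c * (t - s))) := by fun_prop
  have hint : IntegrableOn (fun s => c * Real.exp (-(c * (t - s)))) (Icc 0 t) :=
    hcont.continuousOn.integrableOn_compact isCompact_Icc
  rw [← ofReal_integral_eq_lintegral_ofReal hint (Eventually.of_forall fun s => by positivity),
    integral_Icc_eq_integral_Ioc, ← intervalIntegral.integral_of_le ht,
    intervalIntegral.integral_eq_sub_of_hasDerivAt (f := fun s => Real.exp (-(c * (t - s))))
      (fun s _ => ?_) (hcont.intervalIntegrable _ _)]
  · rw [ENNReal.ofReal_le_one]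
    have := Real.exp_pos (-(c * (t - 0)))
    simp only [sub_self, mul_zero, neg_zero, Real.exp_zero]
    linarith
  · have h : HasDerivAt (fun s : ℝ => -(c * (t - s))) c s := by
      have := (((hasDerivAt_id s).const_sub t).const_mul c).fun_neg
      simpa using this
    exact h.exp.congr_deriv (mul_comm _ _)

/-- Parabolic smoothing: the integral of 4π²|ξ|² exp(-8π²|ξ|²(t-s)) over s is at most 1/2, uniformly
in ξ. It pays for the one derivative in the forcing term. -/
theorem lintegral_gauss_sq_le {t : ℝ} (ht : 0 ≤ t) (ξ : E3) :
    ∫⁻ s in Icc 0 t, (ENNReal.ofReal (2 * Real.pi * ‖ξ‖) * ENNReal.ofReal (gauss (t - s) ξ)) ^ 2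
      ≤ 2⁻¹ := by
  have h := lintegral_exp_le (c := 2 * (4 * Real.pi ^ 2 * ‖ξ‖ ^ 2)) (by positivity) ht
  have e : ∀ s, (ENNReal.ofReal (2 * Real.pi * ‖ξ‖) * ENNReal.ofReal (gauss (t - s) ξ)) ^ 2 =
      2⁻¹ * ENNReal.ofReal (2 * (4 * Real.pi ^ 2 * ‖ξ‖ ^ 2) *
        Real.exp (-(2 * (4 * Real.pi ^ 2 * ‖ξ‖ ^ 2) * (t - s)))) := by
    intro s
    have hp : 0 ≤ 2 * Real.pi * ‖ξ‖ := by positivity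
    have h2 : (2⁻¹ : ℝ≥0∞) = ENNReal.ofReal (2⁻¹) := by
      rw [ENNReal.ofReal_inv_of_pos (by norm_num)]; simp
    rw [← ENNReal.ofReal_mul hp, ← ENNReal.ofReal_pow (by have := gauss_pos (t - s) ξ; positivity),
      h2, ← ENNReal.ofReal_mul (by norm_num)]
    congr 1
    have h3 : gauss (t - s) ξ ^ 2 = Real.exp (-(2 * (4 * Real.pi ^ 2 * ‖ξ‖ ^ 2) * (t - s))) := by
      unfold gauss
      rw [← Real.exp_nat_mul]; congr 1; push_cast; ring
    rw [mul_pow, h3]; ring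
  simp_rw [e]
  rw [lintegral_const_mul' _ _ (by simp)]
  calc _ ≤ (2⁻¹ : ℝ≥0∞) * 1 := by gcongr
    _ = _ := mul_one _

theorem mul_le_sq_add_sq (a b : ℝ≥0∞) : a * b ≤ a ^ 2 + b ^ 2 := by
  rcases le_total a b with h | h
  · calc a * b ≤ b * b := by gcongr
      _ = b ^ 2 := (sq b).symm
      _ ≤ _ := le_add_self
  · calc a * b ≤ a * a := by gcongr
      _ = a ^ 2 := (sq a).symm
      _ ≤ _ := le_self_add

/-- `P` is the backward heat flow ending in ψ at time t. Its difference quotients converge in `L²`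
by domination with 4π²|ξ|²|ψ|, which is square integrable because ψ has compact support. -/
theorem hasDerivAt_gaussCurve {ψ : E3 → ℂ} (h1 : Continuous ψ) (h2 : HasCompactSupport ψ) {t : ℝ}
    {P : ℝ → L2} (hP : ∀ s, P s =ᵐ[volume] fun ξ => (gauss (t - s) ξ : ℂ) * ψ ξ) {s : ℝ} (hs : s < t)
    {P' : L2} (hP' : P' =ᵐ[volume] fun ξ =>
      ((4 * Real.pi ^ 2 * ‖ξ‖ ^ 2 * gauss (t - s) ξ : ℝ) : ℂ) * ψ ξ) : HasDerivAt P P' s := by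
  rw [hasDerivAt_iff_tendsto_slope]
  have hG : MemLp (fun ξ => ‖((4 * Real.pi ^ 2 * ‖ξ‖ ^ 2 : ℝ) : ℂ) * ψ ξ‖) 2 volume :=
    (memLp_of_smooth_compact (by fun_prop) h2.mul_left).norm
  refine tendsto_L2_of_dominated hG (a := fun r ξ => ((slope (fun r => gauss (t - r) ξ) s r : ℝ) : ℂ) *
    ψ ξ) ?_ hP' ?_ ?_ ?_
  · refine Eventually.of_forall fun r => ?_
    rw [slope_def_module]
    filter_upwards [hP r, hP s, Lp.coeFn_sub (P r) (P s),
      Lp.coeFn_smul (r - s)⁻¹ (P r - P s)] with ξ e1 e2 e3 e4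
    rw [e4, Pi.smul_apply, e3, Pi.sub_apply, e1, e2, slope_def_module, Complex.real_smul,
      smul_eq_mul]
    push_cast; ring
  · have : ∀ᶠ r in 𝓝[≠] s, r < t := nhdsWithin_le_nhds (gt_mem_nhds hs)
    filter_upwards [this, self_mem_nhdsWithin] with r hr hne ξ
    rw [norm_mul, norm_mul]
    refine mul_le_mul_of_nonneg_right ?_ (norm_nonneg _)
    rw [Complex.norm_real, Complex.norm_real, slope_def_field, norm_div, Real.norm_eq_abs,
      Real.norm_eq_abs, Real.norm_eq_abs, abs_of_nonneg (by positivity : 0 ≤ 4 * Real.pi ^ 2 * ‖ξ‖ ^ 2)]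
    have := abs_gauss_sub_le (r := t - r) (s := t - s) (by linarith) (by linarith) ξ
    have h3 : |t - r - (t - s)| = |r - s| := by rw [← abs_neg]; congr 1; ring
    rw [h3] at this
    exact div_le_of_le_mul₀ (abs_nonneg _) (by positivity) this
  · intro ξ
    rw [norm_mul, norm_mul]
    refine mul_le_mul_of_nonneg_right ?_ (norm_nonneg _)
    rw [Complex.norm_real, Complex.norm_real, Real.norm_eq_abs, Real.norm_eq_abs,
      abs_mul]
    have h3 := gauss_le_one (r := t - s) (by linarith) ξ
    have h4 := gauss_pos (t - s) ξ
    rw [abs_of_pos h4]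
    exact mul_le_of_le_one_right (abs_nonneg _) h3
  · intro ξ
    have hd : HasDerivAt (fun r => gauss (t - r) ξ) (4 * Real.pi ^ 2 * ‖ξ‖ ^ 2 * gauss (t - s) ξ) s := by
      have := (hasDerivAt_gauss (t - s) ξ).comp s ((hasDerivAt_id s).const_sub t)
      exact this.congr_deriv (by simp)
    exact ((Complex.continuous_ofReal.tendsto _).comp hd.tendsto_slope).mul_const _

theorem continuousOn_gaussCurve {ψ : E3 → ℂ} (h1 : Continuous ψ) (h2 : HasCompactSupport ψ) {t : ℝ}
    {P : ℝ → L2} (hP : ∀ s, P s =ᵐ[volume] fun ξ => (gauss (t - s) ξ : ℂ) * ψ ξ) :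
    ContinuousOn P (Iic t) := by
  intro s hs
  have hb : ∀ r ∈ Iic t, ∀ ξ, ‖(gauss (t - r) ξ : ℂ) * ψ ξ‖ ≤ ‖ψ ξ‖ := by
    intro r hr ξ
    rw [norm_mul, Complex.norm_real, Real.norm_eq_abs, abs_of_pos (gauss_pos _ _)]
    exact mul_le_of_le_one_left (norm_nonneg _) (gauss_le_one (by simpa using hr) ξ)
  refine tendsto_L2_of_dominated (memLp_of_smooth_compact h1 h2).norm (Eventually.of_forall hP)
    (hP s) ?_ (hb s hs) ?_
  · filter_upwards [self_mem_nhdsWithin] with r hr using hb r hr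
  · intro ξ
    have : Continuous fun r => (gauss (t - r) ξ : ℂ) * ψ ξ := by
      have := continuous_gauss_time ξ
      fun_prop
    exact this.continuousAt.continuousWithinAt

theorem integrable_compact_mul {ψ Φ : E3 → ℂ} (h1 : Continuous ψ) (h2 : HasCompactSupport ψ)
    (hΦ : LocallyIntegrable Φ) : Integrable fun ξ => ψ ξ * Φ ξ :=
  hΦ.integrable_smul_left_of_hasCompactSupport h1 h2

-- Duality: pair `w s` with the heat flow of ψ over the remaining time t - s. In the derivative of
-- this pairing the Laplacian terms cancel and only the forcing survives, so integration from `w 0 =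
-- 0` to t expresses the pairing at time t through Φ. The factor 2π|ξ| in the bound for Φ is grouped
-- with the Gaussian and split off by xy ≤ x² + y²; `lintegral_gauss_sq_le` then gives the
-- coefficient 1/2.
set_option maxHeartbeats 1000000 in
theorem WeakHeat.pair_le {w : ℝ → L2} {Φ : ℝ → E3 → ℂ} (hw : WeakHeat w Φ)
    (hc : ContinuousOn w (Ici 0)) (h0 : w 0 = 0) (hΦ : ∀ s, 0 < s → LocallyIntegrable (Φ s))
    {g : ℝ → E3 → ℝ≥0∞} {A : ℝ → ℝ≥0∞}
    (hb : ∀ s, 0 < s → ∀ ξ, ‖Φ s ξ‖ₑ ≤ ENNReal.ofReal (2 * Real.pi * ‖ξ‖) * g s ξ)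
    (hg : ∀ s, 0 < s → ∫⁻ ξ, g s ξ ^ 2 ≤ A s) {t : ℝ} (ht : 0 ≤ t)
    (hA : ∫⁻ s in Icc 0 t, A s < ⊤) {ψ : L2} (hψ : ψ ∈ testSpace) :
    ‖pairL2 ψ (w t)‖ₑ ≤ (∫⁻ s in Icc 0 t, A s) + 2⁻¹ * ‖ψ‖ₑ ^ 2 := by
  obtain ⟨χ, hχ, hs, hψχ⟩ := hψ
  obtain ⟨ψ', hψ'', c1, c2⟩ : ∃ ψ' : E3 → ℂ, (ψ' = fun ξ => ((‖ξ‖ ^ 2 : ℝ) : ℂ) * χ ξ) ∧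
      Continuous ψ' ∧ HasCompactSupport ψ' :=
    ⟨_, rfl, Continuous.mul (by fun_prop) hχ.continuous, hs.mul_left⟩
  have hψ' : ∀ ξ, ψ' ξ = ((‖ξ‖ ^ 2 : ℝ) : ℂ) * χ ξ := fun ξ => congrFun hψ'' ξ
  rw [← hψ''] at hψχ
  have cg : ∀ s, Continuous fun ξ => (gauss (t - s) ξ : ℂ) := fun s =>
    Complex.continuous_ofReal.comp (continuous_gauss _)
  have hm : ∀ s, MemLp (fun ξ => (gauss (t - s) ξ : ℂ) * ψ' ξ) 2 volume := fun s =>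
    memLp_of_smooth_compact ((cg s).mul c1) c2.mul_left
  have hm' : ∀ s, MemLp (fun ξ => ((4 * Real.pi ^ 2 * ‖ξ‖ ^ 2 * gauss (t - s) ξ : ℝ) : ℂ) * ψ' ξ)
      2 volume := fun s => by
    refine memLp_of_smooth_compact (Continuous.mul ?_ c1) c2.mul_left
    have := continuous_gauss (t - s)
    fun_prop
  set P : ℝ → L2 := fun s => (hm s).toLp _ with hP
  have hPa : ∀ s, P s =ᵐ[volume] fun ξ => (gauss (t - s) ξ : ℂ) * ψ' ξ := fun s => (hm s).coeFn_toLp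
  set f : ℝ → ℂ := fun s => pairL2 (P s) (w s) with hf
  set D : ℝ → ℂ := fun s => -∫ ξ, ((gauss (t - s) ξ : ℂ) * ψ' ξ) * Φ s ξ with hD
  have hfc : ContinuousOn f (Icc 0 t) := by
    have k1 : ContinuousOn P (Icc 0 t) :=
      (continuousOn_gaussCurve c1 c2 hPa).mono fun s hs => hs.2
    have k2 : ContinuousOn w (Icc 0 t) := hc.mono fun s hs => hs.1
    exact continuousOn_bilin pairL2 k1 k2
  have hfd : ∀ s ∈ Ioo 0 t, HasDerivAt f (D s) s := by
    intro s hst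
    have d1 := hasDerivAt_gaussCurve c1 c2 hPa hst.2 (hm' s).coeFn_toLp
    have d2 := hw s hst.1 (fun ξ => (gauss (t - s) ξ : ℂ) * χ ξ)
      ((Complex.ofRealCLM.contDiff.comp (contDiff_gauss _)).mul hχ) hs.mul_left
    have d3 : HasDerivAt (fun r => pairL2 (P s) (w r)) (∫ ξ, ((‖ξ‖ ^ 2 : ℝ) : ℂ) *
        ((gauss (t - s) ξ : ℂ) * χ ξ) * (((-(4 * Real.pi ^ 2 * ‖ξ‖ ^ 2) : ℝ) : ℂ) * w s ξ - Φ s ξ)) s := by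
      refine d2.congr_of_eventuallyEq (Eventually.of_forall fun r => ?_)
      simp only
      rw [pairL2_eq_of_ae (hPa s)]
      refine integral_congr_ae (Eventually.of_forall fun ξ => ?_)
      simp only [hψ']; ring
    have d4 := hasDerivAt_bilin pairL2 d1 (hc.continuousAt (Ici_mem_nhds hst.1)) d3
    refine d4.congr_deriv ?_
    simp only [hD]
    rw [pairL2_eq_of_ae (hm' s).coeFn_toLp, ← integral_neg, ← integral_add]
    · refine integral_congr_ae (Eventually.of_forall fun ξ => ?_)
      simp only [hψ']; push_cast; ring
    · refine integrable_compact_mul (Continuous.mul ?_ c1) c2.mul_left (locallyIntegrable_L2 _)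
      have := continuous_gauss (t - s)
      fun_prop
    · have i1 : Integrable fun ξ => ((-(4 * Real.pi ^ 2 * ‖ξ‖ ^ 2) : ℝ) : ℂ) *
          ((gauss (t - s) ξ : ℂ) * ψ' ξ) * w s ξ := by
        refine integrable_compact_mul (Continuous.mul (by fun_prop) ((cg s).mul c1))
          c2.mul_left.mul_left (locallyIntegrable_L2 _)
      have i2 : Integrable fun ξ => ((gauss (t - s) ξ : ℂ) * ψ' ξ) * Φ s ξ :=
        integrable_compact_mul ((cg s).mul c1) c2.mul_left (hΦ s hst.1)
      refine (i1.sub i2).congr (Eventually.of_forall fun ξ => ?_)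
      simp only [hψ', Pi.sub_apply]; ring
  set B : ℝ → E3 → ℝ≥0∞ := fun s ξ => (ENNReal.ofReal (2 * Real.pi * ‖ξ‖) *
    ENNReal.ofReal (gauss (t - s) ξ)) ^ 2 * ‖ψ' ξ‖ₑ ^ 2 with hB
  have hBm : Measurable (Function.uncurry B) := by
    have : Measurable fun p : ℝ × E3 => gauss (t - p.1) p.2 := by
      unfold gauss; fun_prop
    have k2 : Measurable fun p : ℝ × E3 => ‖ψ' p.2‖ₑ :=
      (c1.measurable.comp measurable_snd).enorm
    simp only [hB, Function.uncurry_def]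
    refine Measurable.mul ?_ (k2.pow_const 2)
    exact (Measurable.mul (by fun_prop) this.ennreal_ofReal).pow_const 2
  have hBt : ∫⁻ s in Icc 0 t, ∫⁻ ξ, B s ξ ≤ 2⁻¹ * ‖ψ‖ₑ ^ 2 := by
    rw [lintegral_lintegral_swap hBm.aemeasurable, enorm_sq_L2_congr hψχ]
    rw [← lintegral_const_mul' (2⁻¹ : ℝ≥0∞) _ (by simp)]
    refine lintegral_mono fun ξ => ?_
    simp only [hB]
    rw [lintegral_mul_const' (‖ψ' ξ‖ₑ ^ 2) _ (ENNReal.pow_ne_top enorm_ne_top)]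
    gcongr
    exact lintegral_gauss_sq_le ht ξ
  have hDb : ∀ s ∈ Ioo 0 t, ‖D s‖ₑ ≤ A s + ∫⁻ ξ, B s ξ := by
    intro s hst
    have hBs : Measurable (B s) := hBm.of_uncurry_left
    simp only [hD, enorm_neg]
    calc _ ≤ ∫⁻ ξ, ‖((gauss (t - s) ξ : ℂ) * ψ' ξ) * Φ s ξ‖ₑ := enorm_integral_le_lintegral_enorm _
      _ ≤ ∫⁻ ξ, (g s ξ ^ 2 + B s ξ) := by
          refine lintegral_mono fun ξ => ?_
          have hgn : ‖(gauss (t - s) ξ : ℂ)‖ₑ = ENNReal.ofReal (gauss (t - s) ξ) := by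
            rw [← ofReal_norm, Complex.norm_real, Real.norm_eq_abs,
              abs_of_pos (gauss_pos _ _)]
          rw [enorm_mul, enorm_mul, hgn]
          calc _ ≤ ENNReal.ofReal (gauss (t - s) ξ) * ‖ψ' ξ‖ₑ *
                (ENNReal.ofReal (2 * Real.pi * ‖ξ‖) * g s ξ) := by
                gcongr; exact hb s hst.1 ξ
            _ = g s ξ * (ENNReal.ofReal (2 * Real.pi * ‖ξ‖) * ENNReal.ofReal (gauss (t - s) ξ) *
                  ‖ψ' ξ‖ₑ) := by ring
            _ ≤ _ := mul_le_sq_add_sq _ _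
            _ = _ := by simp only [hB]; ring
      _ = (∫⁻ ξ, g s ξ ^ 2) + ∫⁻ ξ, B s ξ := lintegral_add_right _ hBs
      _ ≤ _ := by gcongr; exact hg s hst.1
  have hBs2 : Measurable fun s => ∫⁻ ξ, B s ξ := hBm.lintegral_prod_right
  have hDt : ∫⁻ s in Ioo 0 t, ‖D s‖ₑ ≤ (∫⁻ s in Icc 0 t, A s) + 2⁻¹ * ‖ψ‖ₑ ^ 2 := by
    calc _ ≤ ∫⁻ s in Ioo 0 t, (A s + ∫⁻ ξ, B s ξ) := setLIntegral_mono' measurableSet_Ioo hDb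
      _ ≤ ∫⁻ s in Icc 0 t, (A s + ∫⁻ ξ, B s ξ) := lintegral_mono_set Ioo_subset_Icc_self
      _ = (∫⁻ s in Icc 0 t, A s) + ∫⁻ s in Icc 0 t, ∫⁻ ξ, B s ξ := lintegral_add_right _ hBs2
      _ ≤ _ := by gcongr
  have hDt' : ∫⁻ s in Ioo 0 t, ‖D s‖ₑ < ⊤ :=
    hDt.trans_lt (ENNReal.add_lt_top.2 ⟨hA,
      ENNReal.mul_lt_top (by simp) (ENNReal.pow_lt_top enorm_lt_top)⟩)
  have hint : IntegrableOn D (Ioo 0 t) := by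
    refine ⟨?_, hDt'⟩
    -- `D` is measurable in time because it is a derivative; no joint measurability of Φ is
    -- required.
    refine (measurable_deriv f).aestronglyMeasurable.congr ?_
    filter_upwards [ae_restrict_mem measurableSet_Ioo] with s hst
    exact (hfd s hst).deriv
  have hftc := intervalIntegral.integral_eq_sub_of_hasDerivAt_of_le ht hfc hfd
    ((intervalIntegrable_iff_integrableOn_Ioo_of_le ht).2 hint)
  have hf0 : f 0 = 0 := by simp [hf, h0]
  have hft : f t = pairL2 ψ (w t) := by
    have : P t = ψ := by
      refine Lp.ext ?_
      filter_upwards [hPa t, hψχ] with ξ e1 e2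
      rw [e1, e2]; simp [gauss_zero, hψ']
    simp [hf, this]
  rw [hf0, sub_zero, hft] at hftc
  rw [← hftc, intervalIntegral.integral_of_le ht, ← integral_Icc_eq_integral_Ioc,
    integral_Icc_eq_integral_Ioo]
  exact (enorm_integral_le_lintegral_enorm _).trans hDt

/-- Complex conjugation on `L²`. -/
def conjL2 (f : L2) : L2 := (Complex.conjCLE : ℂ →L[ℝ] ℂ).compLp f

theorem coeFn_conjL2 (f : L2) : conjL2 f =ᵐ[volume] fun ξ => (starRingEnd ℂ) (f ξ) :=
  (Complex.conjCLE : ℂ →L[ℝ] ℂ).coeFn_compLp f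

theorem norm_conjL2 (f : L2) : ‖conjL2 f‖ = ‖f‖ := by
  rw [Lp.norm_def, Lp.norm_def]
  congr 1
  refine eLpNorm_congr_norm_ae ?_
  filter_upwards [coeFn_conjL2 f] with ξ e
  rw [e, RCLike.norm_conj]

/-- By density the bound of `WeakHeat.pair_le` extends to all ψ in `L²`. The choice of ψ as the
conjugate of `w t` gives ‖w‖² ≤ I + ‖w‖²/2, and the coefficient 1/2 permits absorption. -/
theorem WeakHeat.energy {w : ℝ → L2} {Φ : ℝ → E3 → ℂ} (hw : WeakHeat w Φ)
    (hc : ContinuousOn w (Ici 0)) (h0 : w 0 = 0) (hΦ : ∀ s, 0 < s → LocallyIntegrable (Φ s))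
    {g : ℝ → E3 → ℝ≥0∞} {A : ℝ → ℝ≥0∞}
    (hb : ∀ s, 0 < s → ∀ ξ, ‖Φ s ξ‖ₑ ≤ ENNReal.ofReal (2 * Real.pi * ‖ξ‖) * g s ξ)
    (hg : ∀ s, 0 < s → ∫⁻ ξ, g s ξ ^ 2 ≤ A s) {t : ℝ} (ht : 0 ≤ t)
    (hA : ∫⁻ s in Icc 0 t, A s < ⊤) :
    ‖w t‖ₑ ^ 2 ≤ 2 * ∫⁻ s in Icc 0 t, A s := by
  set I : ℝ := (∫⁻ s in Icc 0 t, A s).toReal with hI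
  have hIe : ∫⁻ s in Icc 0 t, A s = ENNReal.ofReal I := (ENNReal.ofReal_toReal hA.ne).symm
  have hI0 : 0 ≤ I := ENNReal.toReal_nonneg
  have hsq : ∀ x : L2, ‖x‖ₑ ^ 2 = ENNReal.ofReal (‖x‖ ^ 2) := fun x => by
    rw [← ofReal_norm, ENNReal.ofReal_pow (norm_nonneg _)]
  have h1 : ∀ ψ ∈ testSpace, ‖pairL2 ψ (w t)‖ ≤ I + 2⁻¹ * ‖ψ‖ ^ 2 := by
    intro ψ hψ
    have h := hw.pair_le hc h0 hΦ hb hg ht hA hψ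
    have h2 : (2⁻¹ : ℝ≥0∞) = ENNReal.ofReal (2⁻¹) := by
      rw [ENNReal.ofReal_inv_of_pos (by norm_num)]; simp
    rw [hIe, hsq, h2, ← ENNReal.ofReal_mul (by norm_num), ← ENNReal.ofReal_add hI0 (by positivity),
      ← ofReal_norm] at h
    exact (ENNReal.ofReal_le_ofReal_iff (by positivity)).1 h
  have h2 : ∀ ψ : L2, ‖pairL2 ψ (w t)‖ ≤ I + 2⁻¹ * ‖ψ‖ ^ 2 := by
    intro ψ
    refine dense_testSpace.induction (P := fun ψ => ‖pairL2 ψ (w t)‖ ≤ I + 2⁻¹ * ‖ψ‖ ^ 2)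
      h1 ?_ ψ
    have k1 : Continuous fun ψ : L2 => pairL2 ψ (w t) := (pairL2.flip (w t)).continuous
    exact isClosed_le k1.norm (by fun_prop)
  have h3 := h2 (conjL2 (w t))
  rw [pairL2_conj_self (coeFn_conjL2 _), norm_conjL2, Complex.norm_real, Real.norm_eq_abs,
    abs_of_nonneg (by positivity)] at h3
  have h4 : 2 * ENNReal.ofReal I = ENNReal.ofReal (2 * I) := by
    rw [ENNReal.ofReal_mul (by norm_num)]; simp
  rw [hIe, hsq, h4]
  exact ENNReal.ofReal_le_ofReal (by linarith)

/-! ### Convolution estimates -/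

theorem sq_lintegral_mul_le {α : Type*} [MeasurableSpace α] {μ : Measure α} {a b : α → ℝ≥0∞}
    (ha : AEMeasurable a μ) (hb : AEMeasurable b μ) :
    (∫⁻ x, a x * b x ∂μ) ^ 2 ≤ (∫⁻ x, a x ^ 2 ∂μ) * ∫⁻ x, b x ^ 2 ∂μ := by
  have h := ENNReal.lintegral_mul_le_Lp_mul_Lq μ (p := 2) (q := 2)
    (by rw [Real.holderConjugate_iff]; norm_num) ha hb
  calc _ ≤ ((∫⁻ x, a x ^ (2 : ℝ) ∂μ) ^ (1 / (2 : ℝ)) * (∫⁻ x, b x ^ (2 : ℝ) ∂μ) ^ (1 / (2 : ℝ))) ^ 2 := by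
        gcongr; exact h
    _ = _ := by
        rw [mul_pow, ← ENNReal.rpow_natCast, ← ENNReal.rpow_natCast, ← ENNReal.rpow_mul,
          ← ENNReal.rpow_mul]
        norm_num

/-- Cauchy–Schwarz for the factors a√b and √b. -/
theorem sq_lintegral_mul_le' {α : Type*} [MeasurableSpace α] {μ : Measure α} {a b : α → ℝ≥0∞}
    (ha : AEMeasurable a μ) (hb : AEMeasurable b μ) :
    (∫⁻ x, a x * b x ∂μ) ^ 2 ≤ (∫⁻ x, a x ^ 2 * b x ∂μ) * ∫⁻ x, b x ∂μ := by
  have hs : ∀ x : ℝ≥0∞, (x ^ (1 / 2 : ℝ)) ^ 2 = x := fun x => by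
    rw [← ENNReal.rpow_natCast, ← ENNReal.rpow_mul]; norm_num
  have h := sq_lintegral_mul_le (μ := μ) (a := fun x => a x * b x ^ (1 / 2 : ℝ))
    (b := fun x => b x ^ (1 / 2 : ℝ)) (ha.mul (hb.pow_const _)) (hb.pow_const _)
  simp_rw [mul_pow, hs, mul_assoc, ← sq, hs] at h
  exact h

/-- The convolution of nonnegative functions. -/
def lconv (f g : E3 → ℝ≥0∞) (ξ : E3) : ℝ≥0∞ := ∫⁻ η, f (ξ - η) * g η

theorem lconv_comm (f g : E3 → ℝ≥0∞) (ξ : E3) : lconv f g ξ = lconv g f ξ := by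
  unfold lconv
  rw [← lintegral_sub_left_eq_self (μ := volume) _ ξ]
  simp only [sub_sub_cancel, mul_comm]

/-- Young's inequality L² * L¹ → L², from Cauchy–Schwarz with respect to the measure g dη and
Tonelli. -/
theorem lintegral_lconv_sq_le {f g : E3 → ℝ≥0∞} (hf : Measurable f) (hg : Measurable g) :
    ∫⁻ ξ, lconv f g ξ ^ 2 ≤ (∫⁻ ξ, f ξ ^ 2) * (∫⁻ ξ, g ξ) ^ 2 := by
  have hm : Measurable fun p : E3 × E3 => f (p.1 - p.2) ^ 2 * g p.2 := by fun_prop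
  calc _ ≤ ∫⁻ ξ, (∫⁻ η, f (ξ - η) ^ 2 * g η) * ∫⁻ η, g η := by
        refine lintegral_mono fun ξ => sq_lintegral_mul_le' ?_ hg.aemeasurable
        exact (hf.comp (measurable_const.sub measurable_id)).aemeasurable
    _ = (∫⁻ ξ, ∫⁻ η, f (ξ - η) ^ 2 * g η) * ∫⁻ η, g η :=
        lintegral_mul_const _ hm.lintegral_prod_right
    _ = (∫⁻ η, ∫⁻ ξ, f (ξ - η) ^ 2 * g η) * ∫⁻ η, g η := by
        rw [lintegral_lintegral_swap hm.aemeasurable]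
    _ = (∫⁻ η, (∫⁻ x, f x ^ 2) * g η) * ∫⁻ η, g η := by
        congr 1
        refine lintegral_congr fun η => ?_
        rw [lintegral_mul_const _ (by fun_prop)]
        congr 1
        exact lintegral_sub_right_eq_self (μ := volume) (fun ξ => f ξ ^ 2) η
    _ = _ := by rw [lintegral_const_mul _ hg]; ring

theorem enorm_conv_le (f g : E3 → ℂ) (ξ : E3) :
    ‖conv f g ξ‖ₑ ≤ lconv (fun x => ‖f x‖ₑ) (fun x => ‖g x‖ₑ) ξ := by
  refine (enorm_integral_le_lintegral_enorm _).trans (le_of_eq ?_)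
  simp_rw [enorm_mul]; rfl

theorem lconv_sum_left {ι : Type*} (s : Finset ι) {f : ι → E3 → ℝ≥0∞} {g : E3 → ℝ≥0∞}
    (hf : ∀ i, Measurable (f i)) (hg : Measurable g) (ξ : E3) :
    lconv (fun x => ∑ i ∈ s, f i x) g ξ = ∑ i ∈ s, lconv (f i) g ξ := by
  unfold lconv
  simp_rw [Finset.sum_mul]
  exact lintegral_finsetSum s fun i _ => ((hf i).comp (measurable_const.sub measurable_id)).mul hg

theorem lconv_sum_right {ι : Type*} (s : Finset ι) {f : ι → E3 → ℝ≥0∞} {g : E3 → ℝ≥0∞}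
    (hf : ∀ i, Measurable (f i)) (hg : Measurable g) (ξ : E3) :
    lconv g (fun x => ∑ i ∈ s, f i x) ξ = ∑ i ∈ s, lconv g (f i) ξ := by
  simp_rw [lconv_comm g]
  exact lconv_sum_left s hf hg ξ

theorem lconv_mono {f f' g g' : E3 → ℝ≥0∞} (hf : ∀ x, f x ≤ f' x) (hg : ∀ x, g x ≤ g' x) (ξ : E3) :
    lconv f g ξ ≤ lconv f' g' ξ :=
  lintegral_mono fun _ => mul_le_mul' (hf _) (hg _)

/-! ### The `H²` norm on the Fourier side -/

/-- The weighted norm `∫ (1 + |ξ|²)² |f|²`. -/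
def h2sq (f : L2) : ℝ≥0∞ := ∫⁻ ξ, ENNReal.ofReal ((1 + ‖ξ‖ ^ 2) ^ 2) * ‖f ξ‖ₑ ^ 2

/-- The constant of the embedding of `H²` into the functions with integrable Fourier transform. -/
def embConst : ℝ≥0∞ := ∫⁻ ξ : E3, ENNReal.ofReal ((1 + ‖ξ‖ ^ 2)⁻¹) ^ 2

theorem embConst_lt_top : embConst < ⊤ := by
  have h := integrable_rpow_neg_one_add_norm_sq (E := E3) (μ := volume) (r := 4) (by simp; norm_num)
  have h2 : ∀ ξ : E3, (1 + ‖ξ‖ ^ 2) ^ (-(4 : ℝ) / 2) = ((1 + ‖ξ‖ ^ 2)⁻¹) ^ 2 := by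
    intro ξ
    have : (0 : ℝ) ≤ 1 + ‖ξ‖ ^ 2 := by positivity
    rw [show (-(4 : ℝ) / 2) = -((2 : ℕ) : ℝ) by norm_num, Real.rpow_neg this, Real.rpow_natCast,
      inv_pow]
  simp_rw [h2] at h
  have h3 := h.lintegral_lt_top
  unfold embConst
  convert h3 using 3 with ξ
  rw [ENNReal.ofReal_pow (by positivity)]

/-- Cauchy–Schwarz after inserting 1 + |ξ|² and its inverse; the inverse is square integrable in
dimension 3. -/
theorem sq_lintegral_le_h2sq (f : L2) : (∫⁻ ξ, ‖f ξ‖ₑ) ^ 2 ≤ embConst * h2sq f := by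
  have hm : Measurable fun ξ => ‖f ξ‖ₑ := (Lp.stronglyMeasurable f).measurable.enorm
  have h := sq_lintegral_mul_le (μ := (volume : Measure E3))
    (a := fun ξ => ENNReal.ofReal ((1 + ‖ξ‖ ^ 2)⁻¹))
    (b := fun ξ => ENNReal.ofReal (1 + ‖ξ‖ ^ 2) * ‖f ξ‖ₑ) (by fun_prop) (by fun_prop)
  have e1 : ∀ ξ : E3, ENNReal.ofReal ((1 + ‖ξ‖ ^ 2)⁻¹) * (ENNReal.ofReal (1 + ‖ξ‖ ^ 2) * ‖f ξ‖ₑ) =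
      ‖f ξ‖ₑ := by
    intro ξ
    have : (0 : ℝ) < 1 + ‖ξ‖ ^ 2 := by positivity
    rw [← mul_assoc, ← ENNReal.ofReal_mul (by positivity), inv_mul_cancel₀ this.ne']
    simp
  have e2 : ∀ ξ : E3, (ENNReal.ofReal (1 + ‖ξ‖ ^ 2) * ‖f ξ‖ₑ) ^ 2 =
      ENNReal.ofReal ((1 + ‖ξ‖ ^ 2) ^ 2) * ‖f ξ‖ₑ ^ 2 := by
    intro ξ
    rw [mul_pow, ENNReal.ofReal_pow (by positivity)]
  simp_rw [e1, e2] at h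
  exact h

/-! ### Measurability of the `H²` norm along a continuous path -/

/-- The weight `1 + |ξ|²` cut off to the ball of radius `n`. -/
def truncWeight (n : ℕ) : E3 → ℂ :=
  (Metric.closedBall (0 : E3) n).indicator fun ξ => ((1 + ‖ξ‖ ^ 2 : ℝ) : ℂ)

theorem truncWeight_memLp (n : ℕ) : MemLp (truncWeight n) ⊤ (volume : Measure E3) := by
  refine memLp_top_of_bound (C := 1 + (n : ℝ) ^ 2) ?_ (Eventually.of_forall fun ξ => ?_)
  · exact ((by fun_prop : Measurable fun ξ : E3 => ((1 + ‖ξ‖ ^ 2 : ℝ) : ℂ)).indicator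
      Metric.isClosed_closedBall.measurableSet).aestronglyMeasurable
  · unfold truncWeight
    by_cases h : ξ ∈ Metric.closedBall (0 : E3) n
    · rw [indicator_of_mem h, Complex.norm_real, Real.norm_eq_abs, abs_of_nonneg (by positivity)]
      have : ‖ξ‖ ≤ n := by simpa using h
      gcongr
    · rw [indicator_of_notMem h, norm_zero]; positivity

/-- Multiplication by the truncated weight. -/
def truncMul (n : ℕ) : L2 →L[ℂ] L2 :=
  (ContinuousLinearMap.mul ℂ ℂ).holderL volume ⊤ 2 2 ((truncWeight_memLp n).toLp _)

theorem coeFn_truncMul (n : ℕ) (f : L2) :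
    truncMul n f =ᵐ[volume] fun ξ => truncWeight n ξ * f ξ := by
  unfold truncMul
  rw [ContinuousLinearMap.holderL_apply_apply]
  filter_upwards [(ContinuousLinearMap.mul ℂ ℂ).coeFn_holder (r := 2)
    ((truncWeight_memLp n).toLp _) f, (truncWeight_memLp n).coeFn_toLp] with ξ e1 e2
  rw [e1, e2]; rfl

/-- Along an `L²`-continuous path the H² norm need not be continuous; as a countable supremum of
continuous functions of time it is still measurable. -/
theorem h2sq_eq_iSup (f : L2) : h2sq f = ⨆ n : ℕ, ‖truncMul n f‖ₑ ^ 2 := by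
  have hm : Measurable fun ξ => ‖f ξ‖ₑ := (Lp.stronglyMeasurable f).measurable.enorm
  set F : ℕ → E3 → ℝ≥0∞ := fun n => (Metric.closedBall (0 : E3) n).indicator
    fun ξ => ENNReal.ofReal ((1 + ‖ξ‖ ^ 2) ^ 2) * ‖f ξ‖ₑ ^ 2 with hF
  have hFn : ∀ n, ‖truncMul n f‖ₑ ^ 2 = ∫⁻ ξ, F n ξ := by
    intro n
    rw [enorm_sq_L2_congr (coeFn_truncMul n f)]
    refine lintegral_congr fun ξ => ?_
    simp only [hF, truncWeight]
    by_cases h : ξ ∈ Metric.closedBall (0 : E3) n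
    · rw [indicator_of_mem h, indicator_of_mem h, enorm_mul, mul_pow, ← ofReal_norm,
        Complex.norm_real, Real.norm_eq_abs, abs_of_nonneg (by positivity),
        ENNReal.ofReal_pow (by positivity)]
    · rw [indicator_of_notMem h, indicator_of_notMem h]; simp
  simp_rw [hFn]
  rw [← lintegral_iSup]
  · refine lintegral_congr fun ξ => ?_
    refine le_antisymm ?_ (iSup_le fun n => indicator_le_self _ _ _)
    obtain ⟨n, hn⟩ := exists_nat_ge ‖ξ‖
    refine le_iSup_of_le n ?_
    simp only [hF]
    rw [indicator_of_mem (by simpa using hn)]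
  · intro n
    exact Measurable.indicator (by fun_prop) Metric.isClosed_closedBall.measurableSet
  · intro n m hnm ξ
    refine indicator_le_indicator_of_subset (Metric.closedBall_subset_closedBall ?_)
      (fun _ => zero_le) ξ
    exact_mod_cast hnm

theorem aemeasurable_h2sq {w : ℝ → L2} (hc : ContinuousOn w (Ici 0)) (T : ℝ) :
    AEMeasurable (fun t => h2sq (w t)) (volume.restrict (Icc 0 T)) := by
  simp_rw [h2sq_eq_iSup]
  refine AEMeasurable.iSup fun n => ?_
  have h : ContinuousOn (fun t => ‖truncMul n (w t)‖ₑ ^ 2) (Icc 0 T) := by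
    have h1 : ContinuousOn (fun t => truncMul n (w t)) (Icc 0 T) :=
      (truncMul n).continuous.comp_continuousOn (hc.mono fun s hs => hs.1)
    exact (ENNReal.continuous_pow 2).comp_continuousOn h1.enorm
  exact h.aemeasurable measurableSet_Icc

/-! ### A Gronwall lemma -/

/-- Since `K` is only integrable, absolute continuity supplies a step d such that `K` has mass below
1/2 on intervals of length d. If y vanishes up to nd, its maximum y(m) on the next step satisfies
y(m) ≤ y(m)/2 and so is zero. -/
theorem gronwall_zero {y : ℝ → ℝ} {K : ℝ → ℝ≥0∞} {T : ℝ} (hy : ContinuousOn y (Icc 0 T))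
    (hy0 : ∀ t, 0 ≤ y t) (hK : ∫⁻ s in Icc 0 T, K s < ⊤)
    (h : ∀ t ∈ Icc 0 T, ENNReal.ofReal (y t) ≤ ∫⁻ s in Icc 0 t, K s * ENNReal.ofReal (y s)) :
    ∀ t ∈ Icc 0 T, y t = 0 := by
  obtain ⟨δ, hδ, hδK⟩ := exists_pos_setLIntegral_lt_of_measure_lt
    (μ := volume.restrict (Icc 0 T)) hK.ne (ε := 2⁻¹) (by simp)
  obtain ⟨d, hd0, hdδ⟩ : ∃ d : ℝ, 0 < d ∧ ENNReal.ofReal d < δ := by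
    obtain ⟨r, hr1, hr2⟩ := exists_between hδ
    refine ⟨r.toReal, ENNReal.toReal_pos hr1.ne' (hr2.trans_le le_top).ne, ?_⟩
    rwa [ENNReal.ofReal_toReal (hr2.trans_le le_top).ne]
  have hind : ∀ n : ℕ, ∀ t ∈ Icc 0 T, t ≤ n * d → y t = 0 := by
    intro n
    induction n with
    | zero =>
      intro t ht htn
      have ht0 : t = 0 := le_antisymm (by simpa using htn) ht.1
      have := h t ht
      rw [ht0, Icc_self, setLIntegral_measure_zero _ _ (by simp)] at this
      have h2 : y 0 ≤ 0 := by simpa using this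
      rw [ht0]; exact le_antisymm h2 (hy0 0)
    | succ n ih =>
      intro t ht htn
      by_cases hle : t ≤ n * d
      · exact ih t ht hle
      push Not at hle
      have ha0 : 0 ≤ n * d := by positivity
      have hsub : Icc (n * d) t ⊆ Icc 0 T := fun s hs => ⟨ha0.trans hs.1, hs.2.trans ht.2⟩
      obtain ⟨m, hm, hmax⟩ := isCompact_Icc.exists_isMaxOn (nonempty_Icc.2 hle.le) (hy.mono hsub)
      have hmb : ENNReal.ofReal (y m) ≤ 2⁻¹ * ENNReal.ofReal (y m) := by
        calc _ ≤ ∫⁻ s in Icc 0 m, K s * ENNReal.ofReal (y s) := h m (hsub hm)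
          _ ≤ ∫⁻ s in Icc 0 m, (Ioc (n * d) t).indicator (fun s => K s * ENNReal.ofReal (y m)) s := by
              refine setLIntegral_mono' measurableSet_Icc fun s hs => ?_
              by_cases hsn : s ≤ n * d
              · rw [ih s ⟨hs.1, (hs.2.trans hm.2).trans ht.2⟩ hsn]; simp
              · push Not at hsn
                rw [indicator_of_mem (show s ∈ Ioc (n * d) t from ⟨hsn, hs.2.trans hm.2⟩)]
                gcongr
                exact hmax (show s ∈ Icc (n * d) t from ⟨hsn.le, hs.2.trans hm.2⟩)
          _ ≤ ∫⁻ s in Icc 0 T, (Ioc (n * d) t).indicator (fun s => K s * ENNReal.ofReal (y m)) s :=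
              lintegral_mono_set (Icc_subset_Icc_right (hm.2.trans ht.2))
          _ = (∫⁻ s in Ioc (n * d) t, K s ∂(volume.restrict (Icc 0 T))) * ENNReal.ofReal (y m) := by
              rw [lintegral_indicator measurableSet_Ioc, lintegral_mul_const' _ _ ENNReal.ofReal_ne_top]
          _ ≤ 2⁻¹ * ENNReal.ofReal (y m) := by
              gcongr
              refine (hδK _ ?_).le
              refine (Measure.restrict_apply_le _ _).trans_lt ?_
              rw [Real.volume_Ioc]
              refine (ENNReal.ofReal_le_ofReal ?_).trans_lt hdδ
              push_cast at htn
              linarith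
      have hym : y m ≤ 0 := by
        have h2 : (2⁻¹ : ℝ≥0∞) = ENNReal.ofReal (2⁻¹) := by
          rw [ENNReal.ofReal_inv_of_pos (by norm_num)]; simp
        rw [h2, ← ENNReal.ofReal_mul (by norm_num)] at hmb
        have := (ENNReal.ofReal_le_ofReal_iff (mul_nonneg (by norm_num) (hy0 m))).1 hmb
        linarith
      exact le_antisymm ((hmax (show t ∈ Icc (n * d) t from ⟨hle.le, le_rfl⟩)).trans hym) (hy0 t)
  intro t ht
  obtain ⟨n, hn⟩ := exists_nat_ge (t / d)
  exact hind n t ht ((div_le_iff₀ hd0).1 hn)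

/-! ### Uniqueness of solutions on the Fourier side -/

/-- The components of a vector field as functions. -/
def fn (U : VField) : Fin 3 → E3 → ℂ := fun m => U m

/-- The solutions of the projected Navier–Stokes equations on the Fourier side. -/
structure FourierSolution (U : ℝ → VField) : Prop where
  continuousOn : ∀ l, ContinuousOn (fun t => U t l) (Ici 0)
  weak : ∀ l, WeakHeat (fun t => U t l) (fun t => nonlin (fn (U t)) (fn (U t)) l)
  h2 : ∀ T l, ∫⁻ t in Icc 0 T, h2sq (U t l) < ⊤

theorem integrable_weakHeat {χ : E3 → ℂ} (hχ : Continuous χ) (hs : HasCompactSupport χ) (w : L2)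
    {Φ : E3 → ℂ} (hΦ : LocallyIntegrable Φ) :
    Integrable fun ξ => ((‖ξ‖ ^ 2 : ℝ) : ℂ) * χ ξ *
      (((-(4 * Real.pi ^ 2 * ‖ξ‖ ^ 2) : ℝ) : ℂ) * w ξ - Φ ξ) := by
  have i1 : Integrable fun ξ => (((-(4 * Real.pi ^ 2 * ‖ξ‖ ^ 2) : ℝ) : ℂ) *
      (((‖ξ‖ ^ 2 : ℝ) : ℂ) * χ ξ)) * w ξ :=
    integrable_compact_mul (Continuous.mul (by fun_prop) (Continuous.mul (by fun_prop) hχ))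
      hs.mul_left.mul_left (locallyIntegrable_L2 _)
  have i2 : Integrable fun ξ => (((‖ξ‖ ^ 2 : ℝ) : ℂ) * χ ξ) * Φ ξ :=
    integrable_compact_mul (Continuous.mul (by fun_prop) hχ) hs.mul_left hΦ
  refine (i1.sub i2).congr (Eventually.of_forall fun ξ => ?_)
  simp only [Pi.sub_apply]; ring

theorem WeakHeat.sub {w v : ℝ → L2} {Φ Ψ : ℝ → E3 → ℂ} (hw : WeakHeat w Φ) (hv : WeakHeat v Ψ)
    (hΦ : ∀ s, 0 < s → LocallyIntegrable (Φ s)) (hΨ : ∀ s, 0 < s → LocallyIntegrable (Ψ s)) :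
    WeakHeat (fun t => w t - v t) (fun t ξ => Φ t ξ - Ψ t ξ) := by
  intro t ht χ hχ hs
  have hc : Continuous fun ξ => ((‖ξ‖ ^ 2 : ℝ) : ℂ) * χ ξ := Continuous.mul (by fun_prop) hχ.continuous
  refine (((hw t ht χ hχ hs).sub (hv t ht χ hχ hs)).congr_of_eventuallyEq
    (Eventually.of_forall fun s => ?_)).congr_deriv ?_
  · simp only [Pi.sub_apply]
    rw [← integral_sub (integrable_compact_mul hc hs.mul_left (locallyIntegrable_L2 _))
      (integrable_compact_mul hc hs.mul_left (locallyIntegrable_L2 _))]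
    refine integral_congr_ae ?_
    filter_upwards [Lp.coeFn_sub (w s) (v s)] with ξ e
    rw [e, Pi.sub_apply]; ring
  · rw [← integral_sub (integrable_weakHeat hχ.continuous hs _ (hΦ t ht))
      (integrable_weakHeat hχ.continuous hs _ (hΨ t ht))]
    refine integral_congr_ae ?_
    filter_upwards [Lp.coeFn_sub (w t) (v t)] with ξ e
    rw [e, Pi.sub_apply]; ring

theorem conv_sub_left (f f' g : L2) (ξ : E3) : conv (f - f' : L2) g ξ = conv f g ξ - conv f' g ξ := by
  rw [conv_eq_lpPairing, conv_eq_lpPairing, conv_eq_lpPairing, map_sub, map_sub]; rfl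

theorem conv_sub_right (f g g' : L2) (ξ : E3) : conv f (g - g' : L2) ξ = conv f g ξ - conv f g' ξ := by
  rw [conv_eq_lpPairing, conv_eq_lpPairing, conv_eq_lpPairing, map_sub]

theorem measurable_enorm_L2 (f : L2) : Measurable fun ξ => ‖f ξ‖ₑ :=
  (Lp.stronglyMeasurable f).measurable.enorm

/-- Bilinearity: a⊗a - b⊗b = (a-b)⊗a + b⊗(a-b). The derivative stays outside as the factor 2π|ξ|,
the form required by `WeakHeat.energy`; the 4 is the Leray bound 2 times the two terms. -/
theorem enorm_nonlin_sub_le (a b : VField) (l : Fin 3) (ξ : E3) :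
    ‖nonlin (fn a) (fn a) l ξ - nonlin (fn b) (fn b) l ξ‖ₑ ≤ ENNReal.ofReal (2 * Real.pi * ‖ξ‖) *
      (4 * lconv (fun x => ∑ m, ‖(a m - b m) x‖ₑ) (fun x => ∑ k, (‖a k x‖ₑ + ‖b k x‖ₑ)) ξ) := by
  have h1 : nonlin (fn a) (fn a) l ξ - nonlin (fn b) (fn b) l ξ = ∑ k, ∑ m, derivSymbol m ξ *
      (leraySymbol l k ξ * (conv (a m - b m : L2) (a k) ξ + conv (b m) (a k - b k : L2) ξ)) := by
    unfold nonlin fn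
    rw [← Finset.sum_sub_distrib]
    refine Finset.sum_congr rfl fun k _ => ?_
    rw [← Finset.sum_sub_distrib]
    refine Finset.sum_congr rfl fun m _ => ?_
    rw [conv_sub_left, conv_sub_right]; ring
  have hM : ∀ f : L2, Measurable fun ξ => ‖f ξ‖ₑ := measurable_enorm_L2
  set W : E3 → ℝ≥0∞ := fun x => ∑ m, ‖(a m - b m) x‖ₑ with hW
  set S : E3 → ℝ≥0∞ := fun x => ∑ k, (‖a k x‖ₑ + ‖b k x‖ₑ) with hS
  have hWm : Measurable W := Finset.measurable_sum _ fun m _ => hM _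
  have hd : ∀ m, ‖derivSymbol m ξ‖ₑ ≤ ENNReal.ofReal (2 * Real.pi * ‖ξ‖) := fun m => by
    rw [← ofReal_norm]; exact ENNReal.ofReal_le_ofReal (norm_derivSymbol_le m ξ)
  have hl : ∀ k, ‖leraySymbol l k ξ‖ₑ ≤ 2 := fun k => by
    rw [← ofReal_norm]
    exact (ENNReal.ofReal_le_ofReal (norm_leraySymbol_le l k ξ)).trans (by simp)
  rw [h1]
  calc _ ≤ ∑ k, ∑ m, ‖derivSymbol m ξ * (leraySymbol l k ξ *
        (conv (a m - b m : L2) (a k) ξ + conv (b m) (a k - b k : L2) ξ))‖ₑ :=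
        (enorm_sum_le _ _).trans (Finset.sum_le_sum fun k _ => enorm_sum_le _ _)
    _ ≤ ∑ k, ∑ m, ENNReal.ofReal (2 * Real.pi * ‖ξ‖) * (2 *
        (lconv (fun x => ‖(a m - b m) x‖ₑ) (fun x => ‖a k x‖ₑ) ξ +
          lconv (fun x => ‖b m x‖ₑ) (fun x => ‖(a k - b k) x‖ₑ) ξ)) := by
        refine Finset.sum_le_sum fun k _ => Finset.sum_le_sum fun m _ => ?_
        rw [enorm_mul, enorm_mul]
        refine mul_le_mul' (hd m) (mul_le_mul' (hl k) ((enorm_add_le _ _).trans ?_))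
        exact add_le_add (enorm_conv_le _ _ _) (enorm_conv_le _ _ _)
    _ = ENNReal.ofReal (2 * Real.pi * ‖ξ‖) * (2 *
        (lconv W (fun x => ∑ k, ‖a k x‖ₑ) ξ + lconv (fun x => ∑ m, ‖b m x‖ₑ) W ξ)) := by
        rw [lconv_sum_right _ (fun k => hM (a k)) hWm, lconv_sum_left _ (fun k => hM (b k)) hWm]
        simp_rw [hW, lconv_sum_left _ (fun m => hM (a m - b m)) (hM _),
          lconv_sum_right _ (fun m => hM (a m - b m)) (hM _)]
        rw [Finset.sum_comm (f := fun i j => lconv (fun x => ‖b i x‖ₑ) (fun x => ‖(a j - b j) x‖ₑ) ξ)]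
        simp_rw [← Finset.mul_sum, Finset.sum_add_distrib]
    _ ≤ ENNReal.ofReal (2 * Real.pi * ‖ξ‖) * (2 * (lconv W S ξ + lconv W S ξ)) := by
        rw [lconv_comm (fun x => ∑ m, ‖b m x‖ₑ) W]
        gcongr
        · refine lconv_mono (fun _ => le_rfl) (fun x => ?_) ξ
          exact Finset.sum_le_sum fun k _ => le_self_add
        · refine lconv_mono (fun _ => le_rfl) (fun x => ?_) ξ
          exact Finset.sum_le_sum fun k _ => le_add_self
    _ = _ := by ring

theorem sq_add_le_four (a b : ℝ≥0∞) : (a + b) ^ 2 ≤ 4 * (a ^ 2 + b ^ 2) := by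
  rcases le_total a b with h | h
  · calc (a + b) ^ 2 ≤ (b + b) ^ 2 := by gcongr
      _ = 4 * b ^ 2 := by ring
      _ ≤ _ := by gcongr; exact le_add_self
  · calc (a + b) ^ 2 ≤ (a + a) ^ 2 := by gcongr
      _ = 4 * a ^ 2 := by ring
      _ ≤ _ := by gcongr; exact le_self_add

theorem sq_sum_three_le (x : Fin 3 → ℝ≥0∞) : (∑ i, x i) ^ 2 ≤ 16 * ∑ i, x i ^ 2 := by
  rw [Fin.sum_univ_three, Fin.sum_univ_three]
  calc _ ≤ 4 * ((x 0 + x 1) ^ 2 + x 2 ^ 2) := sq_add_le_four _ _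
    _ ≤ 4 * (4 * (x 0 ^ 2 + x 1 ^ 2) + 4 * x 2 ^ 2) := by
        gcongr
        · exact sq_add_le_four _ _
        · exact le_mul_of_one_le_left' (by norm_num)
    _ = _ := by ring

/-- Young's inequality puts the difference in L² and the sum in L¹, where the H² norm controls it.
The constant is 16 · 16 · 64: the square of the prefactor 4, the sum of three in the difference, and
16 · 4 from the sums over components and over a, b. -/
theorem lintegral_lconv_diff_le (a b : VField) :
    ∫⁻ ξ, (4 * lconv (fun x => ∑ m, ‖(a m - b m) x‖ₑ) (fun x => ∑ k, (‖a k x‖ₑ + ‖b k x‖ₑ)) ξ) ^ 2 ≤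
      (16384 * embConst * ∑ k, (h2sq (a k) + h2sq (b k))) * ∑ m, ‖a m - b m‖ₑ ^ 2 := by
  have hM : ∀ f : L2, Measurable fun ξ => ‖f ξ‖ₑ := measurable_enorm_L2
  set W : E3 → ℝ≥0∞ := fun x => ∑ m, ‖(a m - b m) x‖ₑ with hW
  set S : E3 → ℝ≥0∞ := fun x => ∑ k, (‖a k x‖ₑ + ‖b k x‖ₑ) with hS
  have hWm : Measurable W := Finset.measurable_sum _ fun m _ => hM _
  have hSm : Measurable S := Finset.measurable_sum _ fun m _ => (hM _).add (hM _)
  have h1 : ∫⁻ ξ, W ξ ^ 2 ≤ 16 * ∑ m, ‖a m - b m‖ₑ ^ 2 := by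
    calc _ ≤ ∫⁻ ξ, 16 * ∑ m, ‖(a m - b m) ξ‖ₑ ^ 2 := lintegral_mono fun ξ => sq_sum_three_le _
      _ = 16 * ∑ m, ∫⁻ ξ, ‖(a m - b m) ξ‖ₑ ^ 2 := by
          rw [lintegral_const_mul' _ _ (by simp), lintegral_finsetSum _ fun m _ => (hM _).pow_const 2]
      _ = _ := by simp_rw [enorm_sq_L2]
  have h2 : (∫⁻ ξ, S ξ) ^ 2 ≤ 64 * embConst * ∑ k, (h2sq (a k) + h2sq (b k)) := by
    have hab : ∀ m, Measurable fun x => ‖a m x‖ₑ + ‖b m x‖ₑ := fun m => (hM (a m)).add (hM (b m))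
    have e : ∫⁻ ξ, S ξ = ∑ k, ((∫⁻ ξ, ‖a k ξ‖ₑ) + ∫⁻ ξ, ‖b k ξ‖ₑ) := by
      rw [lintegral_finsetSum _ fun m _ => hab m]
      exact Finset.sum_congr rfl fun k _ => lintegral_add_left (hM _) _
    rw [e]
    calc _ ≤ 16 * ∑ k, ((∫⁻ ξ, ‖a k ξ‖ₑ) + ∫⁻ ξ, ‖b k ξ‖ₑ) ^ 2 := sq_sum_three_le _
      _ ≤ 16 * ∑ k, 4 * (embConst * h2sq (a k) + embConst * h2sq (b k)) := by
          gcongr with k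
          refine (sq_add_le_four _ _).trans ?_
          gcongr
          · exact sq_lintegral_le_h2sq _
          · exact sq_lintegral_le_h2sq _
      _ = _ := by
          simp_rw [← mul_add, ← Finset.mul_sum]; ring
  calc _ = 16 * ∫⁻ ξ, lconv W S ξ ^ 2 := by
        simp_rw [mul_pow]
        rw [lintegral_const_mul' _ _ (by simp)]; norm_num
    _ ≤ 16 * ((∫⁻ ξ, W ξ ^ 2) * (∫⁻ ξ, S ξ) ^ 2) := by
        gcongr; exact lintegral_lconv_sq_le hWm hSm
    _ ≤ 16 * ((16 * ∑ m, ‖a m - b m‖ₑ ^ 2) * (64 * embConst * ∑ k, (h2sq (a k) + h2sq (b k)))) := by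
        gcongr
    _ = _ := by ring

/-- The energy estimate for each component of U - V has a right-hand side linear in y, the squared
`L²` distance, with coefficient `K₀`. That coefficient is integrable in time because both solutions
are in L²_loc(H²), so `gronwall_zero` applies. -/
theorem FourierSolution.unique {U V : ℝ → VField} (hU : FourierSolution U) (hV : FourierSolution V)
    (h0 : U 0 = V 0) : ∀ t, 0 ≤ t → U t = V t := by
  set y : ℝ → ℝ := fun t => ∑ m, ‖U t m - V t m‖ ^ 2 with hy
  have hye : ∀ t, ENNReal.ofReal (y t) = ∑ m, ‖U t m - V t m‖ₑ ^ 2 := by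
    intro t
    simp only [hy]
    rw [ENNReal.ofReal_sum_of_nonneg fun m _ => by positivity]
    refine Finset.sum_congr rfl fun m _ => ?_
    rw [← ofReal_norm, ENNReal.ofReal_pow (norm_nonneg _)]
  have hyc : ContinuousOn y (Ici 0) := by
    refine continuousOn_finsetSum _ fun m _ => ?_
    exact ((hU.continuousOn m).sub (hV.continuousOn m)).norm.pow 2
  set K₀ : ℝ → ℝ≥0∞ := fun t => 16384 * embConst * ∑ k, (h2sq (U t k) + h2sq (V t k)) with hK₀
  have hK₀t : ∀ T, ∫⁻ t in Icc 0 T, K₀ t < ⊤ := by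
    intro T
    simp only [hK₀]
    rw [lintegral_const_mul' _ _ (ENNReal.mul_ne_top (by simp) embConst_lt_top.ne)]
    refine ENNReal.mul_lt_top (ENNReal.mul_lt_top (by simp) embConst_lt_top) ?_
    have hm : ∀ k, AEMeasurable (fun t => h2sq (U t k) + h2sq (V t k)) (volume.restrict (Icc 0 T)) :=
      fun k => (aemeasurable_h2sq (hU.continuousOn k) T).add (aemeasurable_h2sq (hV.continuousOn k) T)
    rw [lintegral_finsetSum' _ fun k _ => hm k]
    refine ENNReal.sum_lt_top.2 fun k _ => ?_
    rw [lintegral_add_left' (aemeasurable_h2sq (hU.continuousOn k) T)]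
    exact ENNReal.add_lt_top.2 ⟨hU.h2 T k, hV.h2 T k⟩
  have hKy : ∀ T, 0 ≤ T → ∫⁻ t in Icc 0 T, K₀ t * ENNReal.ofReal (y t) < ⊤ := by
    intro T hT
    obtain ⟨m, hm, hmax⟩ := isCompact_Icc.exists_isMaxOn (nonempty_Icc.2 hT)
      (hyc.mono fun s hs => hs.1 : ContinuousOn y (Icc 0 T))
    calc _ ≤ ∫⁻ t in Icc 0 T, K₀ t * ENNReal.ofReal (y m) := by
          refine setLIntegral_mono' measurableSet_Icc fun s hs => ?_
          gcongr
          exact hmax hs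
      _ = (∫⁻ t in Icc 0 T, K₀ t) * ENNReal.ofReal (y m) :=
          lintegral_mul_const' _ _ ENNReal.ofReal_ne_top
      _ < ⊤ := ENNReal.mul_lt_top (hK₀t T) ENNReal.ofReal_lt_top
  have key : ∀ t, 0 ≤ t → ∀ l, ‖U t l - V t l‖ₑ ^ 2 ≤
      2 * ∫⁻ s in Icc 0 t, K₀ s * ENNReal.ofReal (y s) := by
    intro t ht l
    have hli : ∀ (X : ℝ → VField) (s : ℝ), 0 < s → LocallyIntegrable (nonlin (fn (X s)) (fn (X s)) l) :=
      fun X s _ => locallyIntegrable_nonlin (X s) (X s) l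
    refine ((hU.weak l).sub (hV.weak l) (hli U) (hli V)).energy
      ((hU.continuousOn l).sub (hV.continuousOn l)) (by simp [h0])
      (fun s hs => (hli U s hs).sub (hli V s hs))
      (g := fun s => fun ξ => 4 * lconv (fun x => ∑ m, ‖(U s m - V s m) x‖ₑ)
        (fun x => ∑ k, (‖U s k x‖ₑ + ‖V s k x‖ₑ)) ξ)
      (fun s _ ξ => enorm_nonlin_sub_le (U s) (V s) l ξ) (fun s _ => ?_) ht (hKy t ht)
    rw [hye]
    exact lintegral_lconv_diff_le (U s) (V s)
  intro t ht
  -- The 6 is three components times the factor 2 of the energy estimate.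
  have hg := gronwall_zero (y := y) (K := fun s => 6 * K₀ s) (T := t)
    (hyc.mono fun s hs => hs.1) (fun s => Finset.sum_nonneg fun m _ => by positivity) ?_ ?_ t
    ⟨ht, le_rfl⟩
  · have h3 : ∀ m, U t m - V t m = 0 := by
      intro m
      have := (Finset.sum_eq_zero_iff_of_nonneg fun m _ => by positivity).1 hg m (Finset.mem_univ m)
      simpa using this
    ext1 m
    exact sub_eq_zero.1 (h3 m)
  · rw [lintegral_const_mul' _ _ (by simp)]
    exact ENNReal.mul_lt_top (by simp) (hK₀t t)
  · intro s hs
    simp_rw [mul_assoc]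
    rw [hye, lintegral_const_mul' _ _ (by simp)]
    calc _ ≤ ∑ _m : Fin 3, 2 * ∫⁻ r in Icc 0 s, K₀ r * ENNReal.ofReal (y r) :=
          Finset.sum_le_sum fun m _ => key s hs.1 m
      _ = _ := by simp only [Finset.sum_const, Finset.card_univ, Fintype.card_fin, nsmul_eq_mul]
                  push_cast; ring

/-! ### The heat flow on the Fourier side -/

theorem lintegral_exp_le' {c t : ℝ} (hc : 0 ≤ c) (ht : 0 ≤ t) :
    ∫⁻ s in Icc 0 t, ENNReal.ofReal (c * Real.exp (-(c * s))) ≤ 1 := by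
  have hcont : Continuous fun s => c * Real.exp (-(c * s)) := by fun_prop
  have hint : IntegrableOn (fun s => c * Real.exp (-(c * s))) (Icc 0 t) :=
    hcont.continuousOn.integrableOn_compact isCompact_Icc
  rw [← ofReal_integral_eq_lintegral_ofReal hint (Eventually.of_forall fun s => by positivity),
    integral_Icc_eq_integral_Ioc, ← intervalIntegral.integral_of_le ht,
    intervalIntegral.integral_eq_sub_of_hasDerivAt (f := fun s => -Real.exp (-(c * s)))
      (fun s _ => ?_) (hcont.intervalIntegrable _ _)]
  · rw [ENNReal.ofReal_le_one]
    have := Real.exp_pos (-(c * t))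
    simp only [mul_zero, neg_zero, Real.exp_zero]
    linarith
  · have h : HasDerivAt (fun s : ℝ => -(c * s)) (-c) s := by
      simpa using ((hasDerivAt_id s).const_mul c).fun_neg
    refine h.exp.fun_neg.congr_deriv ?_
    ring

theorem heatSymbol_eq_gauss {t : ℝ} (ht : 0 ≤ t) (ξ : E3) :
    heatSymbol t.toNNReal ξ = (gauss t ξ : ℂ) := by
  unfold heatSymbol gauss
  rw [Real.coe_toNNReal t ht]

/-- The solution of the heat equation on the Fourier side with initial value `g`. -/
def heatPath (g : L2) (t : ℝ) : L2 :=
  ((Lp.memLp g).mul' (heatSymbol_memLp t.toNNReal) :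
    MemLp (fun ξ => heatSymbol t.toNNReal ξ * g ξ) 2 volume).toLp _

theorem coeFn_heatPath (g : L2) {t : ℝ} (ht : 0 ≤ t) :
    heatPath g t =ᵐ[volume] fun ξ => (gauss t ξ : ℂ) * g ξ := by
  unfold heatPath
  refine (MemLp.coeFn_toLp _).trans (Eventually.of_forall fun ξ => ?_)
  simp only [heatSymbol_eq_gauss ht]

theorem fourier_heat (t : ℝ≥0) (f : L2) : (𝓕 (heat t f) : L2) = heatPath (𝓕 f) t := by
  unfold heat heatPath
  rw [FourierTransform.fourier_fourierInv_eq]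
  simp only [Real.toNNReal_coe]

theorem heatPath_zero (g : L2) : heatPath g 0 = g := by
  refine Lp.ext ?_
  filter_upwards [coeFn_heatPath g le_rfl] with ξ h
  rw [h, gauss_zero]; simp

theorem continuousOn_heatPath (g : L2) : ContinuousOn (heatPath g) (Ici 0) := by
  intro t ht
  refine tendsto_L2_of_dominated (G := fun ξ => ‖g ξ‖) (Lp.memLp g).norm
    (a := fun s ξ => (gauss s ξ : ℂ) * g ξ) (b := fun ξ => (gauss t ξ : ℂ) * g ξ)
    ?_ (coeFn_heatPath g ht) ?_ ?_ ?_
  · filter_upwards [self_mem_nhdsWithin] with s hs using coeFn_heatPath g hs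
  · filter_upwards [self_mem_nhdsWithin] with s hs ξ
    rw [norm_mul, Complex.norm_real, Real.norm_eq_abs, abs_of_pos (gauss_pos _ _)]
    exact mul_le_of_le_one_left (norm_nonneg _) (gauss_le_one hs ξ)
  · intro ξ
    rw [norm_mul, Complex.norm_real, Real.norm_eq_abs, abs_of_pos (gauss_pos _ _)]
    exact mul_le_of_le_one_left (norm_nonneg _) (gauss_le_one ht ξ)
  · intro ξ
    exact (((Complex.continuous_ofReal.comp (continuous_gauss_time ξ)).mul
      continuous_const).tendsto t).mono_left nhdsWithin_le_nhds

theorem weakHeat_heatPath (g : L2) : WeakHeat (heatPath g) 0 := by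
  intro t ht χ hχ hs
  have hc : Continuous fun ξ => ((‖ξ‖ ^ 2 : ℝ) : ℂ) * χ ξ := Continuous.mul (by fun_prop) hχ.continuous
  have hi : ∀ ψ : E3 → ℂ, Continuous ψ → Integrable fun ξ => (ψ ξ * (((‖ξ‖ ^ 2 : ℝ) : ℂ) * χ ξ)) * g ξ :=
    fun ψ hψ => integrable_compact_mul (hψ.mul hc) hs.mul_left.mul_left (locallyIntegrable_L2 g)
  have key := hasDerivAt_integral_of_dominated_loc_of_deriv_le (μ := volume) (𝕜 := ℝ)
    (F := fun s ξ => ((gauss s ξ : ℂ) * (((‖ξ‖ ^ 2 : ℝ) : ℂ) * χ ξ)) * g ξ)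
    (F' := fun s ξ => (((-(4 * Real.pi ^ 2 * ‖ξ‖ ^ 2) * gauss s ξ : ℝ) : ℂ) *
      (((‖ξ‖ ^ 2 : ℝ) : ℂ) * χ ξ)) * g ξ) (x₀ := t) (s := Ioi 0)
    (bound := fun ξ => ‖(((4 * Real.pi ^ 2 * ‖ξ‖ ^ 2 : ℝ) : ℂ) * (((‖ξ‖ ^ 2 : ℝ) : ℂ) * χ ξ)) * g ξ‖)
    (Ioi_mem_nhds ht) ?_ ?_ ?_ ?_ ?_ ?_
  · refine (key.2.congr_of_eventuallyEq ?_).congr_deriv ?_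
    · filter_upwards [Ioi_mem_nhds ht] with s hs'
      refine integral_congr_ae ?_
      filter_upwards [coeFn_heatPath g (le_of_lt hs')] with ξ e
      rw [e]; ring
    · refine integral_congr_ae ?_
      filter_upwards [coeFn_heatPath g ht.le] with ξ e
      rw [e]; push_cast; simp only [Pi.zero_apply]; ring
  · exact Eventually.of_forall fun s => (hi _ (Complex.continuous_ofReal.comp
      (continuous_gauss s))).aestronglyMeasurable
  · exact hi _ (Complex.continuous_ofReal.comp (continuous_gauss t))
  · exact (hi _ (by have := continuous_gauss t; fun_prop)).aestronglyMeasurable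
  · refine Eventually.of_forall fun ξ s hs' => ?_
    rw [norm_mul, norm_mul, norm_mul _ (g ξ), norm_mul (((4 * Real.pi ^ 2 * ‖ξ‖ ^ 2 : ℝ) : ℂ))]
    gcongr ?_ * _ * _
    rw [Complex.norm_real, Complex.norm_real, norm_mul, norm_neg]
    refine mul_le_of_le_one_right (norm_nonneg _) ?_
    rw [Real.norm_eq_abs, abs_of_pos (gauss_pos _ _)]
    exact gauss_le_one (le_of_lt hs') ξ
  · exact (hi _ (by fun_prop)).norm
  · refine Eventually.of_forall fun ξ s _ => ?_
    exact ((hasDerivAt_gauss s ξ).ofReal_comp.mul_const _).mul_const _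

theorem WeakHeat.congr {w : ℝ → L2} {Φ Ψ : ℝ → E3 → ℂ} (hw : WeakHeat w Φ)
    (h : ∀ t, 0 < t → Φ t =ᵐ[volume] Ψ t) : WeakHeat w Ψ := by
  intro t ht χ hχ hs
  refine (hw t ht χ hχ hs).congr_deriv (integral_congr_ae ?_)
  filter_upwards [h t ht] with ξ e
  rw [e]

theorem WeakHeat.eq_heatPath {w : ℝ → L2} (hw : WeakHeat w 0) (hc : ContinuousOn w (Ici 0)) {t : ℝ}
    (ht : 0 ≤ t) : w t = heatPath (w 0) t := by
  have h0 : LocallyIntegrable (0 : E3 → ℂ) := locallyIntegrable_zero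
  have h := ((hw.sub (weakHeat_heatPath (w 0)) (fun _ _ => h0) (fun _ _ => h0))).energy
    (hc.sub (continuousOn_heatPath _)) (by simp [heatPath_zero])
    (fun s _ => by simpa using locallyIntegrable_zero) (g := 0) (A := 0) (by simp) (by simp) ht (by simp)
  simp only [Pi.zero_apply, lintegral_zero, mul_zero, nonpos_iff_eq_zero, ne_eq,
    OfNat.ofNat_ne_zero, not_false_eq_true, pow_eq_zero_iff, enorm_eq_zero] at h
  exact sub_eq_zero.1 h

/-- Data in H¹ suffice: with c = 8π²|ξ|² ≥ |ξ|², one factor 1 + |ξ|² is bounded by 1 + c against the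
exponential, and c exp(-ct) has time integral at most 1. -/
theorem lintegral_h2sq_heatPath_lt_top {g : L2}
    (hg : ∫⁻ ξ, ENNReal.ofReal (1 + ‖ξ‖ ^ 2) * ‖g ξ‖ₑ ^ 2 < ⊤) (T : ℝ) :
    ∫⁻ t in Icc 0 T, h2sq (heatPath g t) < ⊤ := by
  rcases lt_or_ge T 0 with hT | hT
  · simp [Icc_eq_empty_of_lt hT]
  have hm : Measurable fun ξ => ‖g ξ‖ₑ := measurable_enorm_L2 g
  have e : ∀ t ∈ Icc 0 T, h2sq (heatPath g t) = ∫⁻ ξ, ENNReal.ofReal ((1 + ‖ξ‖ ^ 2) ^ 2 *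
      Real.exp (-(8 * Real.pi ^ 2 * ‖ξ‖ ^ 2 * t))) * ‖g ξ‖ₑ ^ 2 := by
    intro t ht
    unfold h2sq
    refine lintegral_congr_ae ?_
    filter_upwards [coeFn_heatPath g ht.1] with ξ e
    rw [e, enorm_mul, mul_pow, ← mul_assoc, ← ofReal_norm, Complex.norm_real, Real.norm_eq_abs,
      abs_of_pos (gauss_pos _ _), ← ENNReal.ofReal_pow (gauss_pos _ _).le,
      ← ENNReal.ofReal_mul (by positivity)]
    congr 3
    unfold gauss
    rw [← Real.exp_nat_mul]; congr 1; push_cast; ring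
  rw [setLIntegral_congr_fun measurableSet_Icc e, lintegral_lintegral_swap]
  · have hle : ∀ ξ : E3, ∫⁻ t in Icc 0 T, ENNReal.ofReal ((1 + ‖ξ‖ ^ 2) ^ 2 *
        Real.exp (-(8 * Real.pi ^ 2 * ‖ξ‖ ^ 2 * t))) * ‖g ξ‖ₑ ^ 2 ≤
        (ENNReal.ofReal T + 1) * (ENNReal.ofReal (1 + ‖ξ‖ ^ 2) * ‖g ξ‖ₑ ^ 2) := by
      intro ξ
      set c : ℝ := 8 * Real.pi ^ 2 * ‖ξ‖ ^ 2 with hcd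
      have hc : 0 ≤ c := by positivity
      have hcr : ‖ξ‖ ^ 2 ≤ c := by
        have := Real.pi_gt_three
        have : 1 ≤ 8 * Real.pi ^ 2 := by nlinarith
        exact le_mul_of_one_le_left (by positivity) this
      rw [lintegral_mul_const' _ _ (ENNReal.pow_ne_top enorm_ne_top), ← mul_assoc]
      gcongr
      calc _ ≤ ∫⁻ t in Icc 0 T, ENNReal.ofReal (1 + ‖ξ‖ ^ 2) *
            (1 + ENNReal.ofReal (c * Real.exp (-(c * t)))) := by
            refine setLIntegral_mono' measurableSet_Icc fun t ht => ?_
            rw [← ENNReal.ofReal_one, ← ENNReal.ofReal_add zero_le_one (by positivity),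
              ← ENNReal.ofReal_mul (by positivity), sq, mul_assoc]
            refine ENNReal.ofReal_le_ofReal ?_
            gcongr
            rw [add_mul, one_mul]
            gcongr
            rw [Real.exp_le_one_iff]
            have := mul_nonneg hc ht.1
            linarith
        _ = ENNReal.ofReal (1 + ‖ξ‖ ^ 2) * (ENNReal.ofReal T +
            ∫⁻ t in Icc 0 T, ENNReal.ofReal (c * Real.exp (-(c * t)))) := by
            rw [lintegral_const_mul' _ _ ENNReal.ofReal_ne_top, lintegral_add_left measurable_const]
            simp
        _ ≤ ENNReal.ofReal (1 + ‖ξ‖ ^ 2) * (ENNReal.ofReal T + 1) := by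
            gcongr; exact lintegral_exp_le' hc hT
        _ = _ := mul_comm _ _
    refine (lintegral_mono hle).trans_lt ?_
    rw [lintegral_const_mul' _ _ (by simp)]
    exact ENNReal.mul_lt_top (by simp) hg
  · have h1 : Measurable fun p : ℝ × E3 => ENNReal.ofReal ((1 + ‖p.2‖ ^ 2) ^ 2 *
        Real.exp (-(8 * Real.pi ^ 2 * ‖p.2‖ ^ 2 * p.1))) :=
      (by fun_prop : Continuous fun p : ℝ × E3 => (1 + ‖p.2‖ ^ 2) ^ 2 *
        Real.exp (-(8 * Real.pi ^ 2 * ‖p.2‖ ^ 2 * p.1))).measurable.ennreal_ofReal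
    exact (h1.mul ((hm.comp measurable_snd).pow_const 2)).aemeasurable

theorem hat_apply (u : VField) (l : Fin 3) : hat u l = (𝓕 (u l) : L2) := rfl

theorem IsStrongSolution.fourierSolution {u₀ : VField} {u : ℝ → VField} (hu : IsStrongSolution u₀ u) :
    FourierSolution fun t => hat (u t) where
  continuousOn l := by
    have h : ContinuousOn (fun t => u t l) (Ici 0) := (continuousOn_pi.1 hu.continuousOn) l
    exact (Lp.fourierTransformₗᵢ E3 ℂ).continuous.comp_continuousOn h
  weak l := hu.weakHeat l
  h2 T l := hu.integrable_H2 T l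

/-! ### Reflections -/

theorem reflect_apply (γ : Parity) (x : E3) (j : Fin 3) : reflect γ x j = (-1) ^ (γ j).val * x j := rfl

theorem neg_one_pow_mul_self_real (n : ℕ) : (-1 : ℝ) ^ n * (-1) ^ n = 1 := by
  rw [← mul_pow]; simp

theorem reflect_reflect (γ : Parity) (x : E3) : reflect γ (reflect γ x) = x := by
  ext j
  rw [reflect_apply, reflect_apply, ← mul_assoc, neg_one_pow_mul_self_real, one_mul]

theorem norm_reflect (γ : Parity) (x : E3) : ‖reflect γ x‖ = ‖x‖ := by
  rw [EuclideanSpace.norm_eq, EuclideanSpace.norm_eq]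
  congr 1
  refine Finset.sum_congr rfl fun j _ => ?_
  rw [reflect_apply, norm_mul, norm_pow]; simp

/-- The reflection as a linear map. -/
def reflectₗ (γ : Parity) : E3 →ₗ[ℝ] E3 where
  toFun := reflect γ
  map_add' x y := by ext j; simp only [reflect_apply, PiLp.add_apply]; ring
  map_smul' c x := by
    ext j; simp only [reflect_apply, PiLp.smul_apply, smul_eq_mul, RingHom.id_apply]; ring

/-- The reflection as a linear isometry. -/
def reflectₗᵢ (γ : Parity) : E3 ≃ₗᵢ[ℝ] E3 where
  __ := LinearEquiv.ofInvolutive (reflectₗ γ) (reflect_reflect γ)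
  norm_map' := norm_reflect γ

theorem measurePreserving_reflect (γ : Parity) : MeasurePreserving (reflect γ) volume volume :=
  (reflectₗᵢ γ).measurePreserving

theorem contDiff_reflect (γ : Parity) : ContDiff ℝ ∞ (reflect γ) :=
  (reflectₗᵢ γ).contDiff

theorem continuous_reflect (γ : Parity) : Continuous (reflect γ) := (reflectₗᵢ γ).continuous

theorem integral_comp_reflect (γ : Parity) (f : E3 → ℂ) : ∫ x, f (reflect γ x) = ∫ x, f x :=
  (measurePreserving_reflect γ).integral_comp (reflectₗᵢ γ).toHomeomorph.measurableEmbedding f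

theorem lintegral_comp_reflect (γ : Parity) (f : E3 → ℝ≥0∞) : ∫⁻ x, f (reflect γ x) = ∫⁻ x, f x :=
  (measurePreserving_reflect γ).lintegral_comp_emb (reflectₗᵢ γ).toHomeomorph.measurableEmbedding f

theorem reflect_sub (γ : Parity) (x y : E3) : reflect γ (x - y) = reflect γ x - reflect γ y :=
  (reflectₗᵢ γ).map_sub x y

theorem reflect_one (x : E3) : reflect 1 x = -x := by
  ext j
  rw [reflect_apply]
  simp [ZMod.val_one]

/-- The composition of an `L²` function with a reflection. -/
def reflL2 (γ : Parity) : L2 →ₗᵢ[ℂ] L2 :=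
  Lp.compMeasurePreservingₗᵢ ℂ (reflect γ) (measurePreserving_reflect γ)

theorem coeFn_reflL2 (γ : Parity) (f : L2) : reflL2 γ f =ᵐ[volume] fun x => f (reflect γ x) :=
  Lp.coeFn_compMeasurePreserving f (measurePreserving_reflect γ)

theorem ae_reflect {p : E3 → Prop} (γ : Parity) (h : ∀ᵐ x, p x) : ∀ᵐ x, p (reflect γ x) :=
  (measurePreserving_reflect γ).quasiMeasurePreserving.ae h

theorem conjL2_conjL2 (f : L2) : conjL2 (conjL2 f) = f := by
  refine Lp.ext ?_
  filter_upwards [coeFn_conjL2 (conjL2 f), coeFn_conjL2 f] with x e1 e2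
  rw [e1, e2, Complex.conj_conj]

theorem conjL2_reflL2 (γ : Parity) (f : L2) : conjL2 (reflL2 γ f) = reflL2 γ (conjL2 f) := by
  refine Lp.ext ?_
  filter_upwards [coeFn_conjL2 (reflL2 γ f), coeFn_reflL2 γ f, coeFn_reflL2 γ (conjL2 f),
    ae_reflect γ (coeFn_conjL2 f)] with x e1 e2 e3 e4
  rw [e1, e2, e3, e4]

theorem continuous_conjL2 : Continuous conjL2 :=
  ((Complex.conjCLE : ℂ →L[ℝ] ℂ).compLpL 2 volume).continuous

theorem conjL2_ofReal_smul (c : ℝ) (f : L2) : conjL2 ((c : ℂ) • f) = (c : ℂ) • conjL2 f := by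
  refine Lp.ext ?_
  filter_upwards [coeFn_conjL2 ((c : ℂ) • f), coeFn_conjL2 f, Lp.coeFn_smul (c : ℂ) f,
    Lp.coeFn_smul (c : ℂ) (conjL2 f)] with x e1 e2 e3 e4
  rw [e1, e3, e4, Pi.smul_apply, Pi.smul_apply, e2]; simp

theorem continuous_fourier_L2 : Continuous fun f : L2 => (𝓕 f : L2) :=
  (Lp.fourierTransformₗᵢ E3 ℂ).continuous

theorem fourier_reflL2 (γ : Parity) (f : L2) : (𝓕 (reflL2 γ f) : L2) = reflL2 γ (𝓕 f) := by
  refine congrFun ((SchwartzMap.denseRange_toLpCLM (E := E3) (F := ℂ) (p := 2) (μ := volume)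
    (by norm_num)).equalizer (continuous_fourier_L2.comp (reflL2 γ).continuous)
    ((reflL2 γ).continuous.comp continuous_fourier_L2) (funext fun φ => ?_)) f
  simp only [Function.comp_apply, SchwartzMap.toLpCLM_apply, SchwartzMap.toLp_fourier_eq]
  set ψ : 𝓢(E3, ℂ) := SchwartzMap.compCLMOfContinuousLinearEquiv ℂ
    (reflectₗᵢ γ).toContinuousLinearEquiv φ with hψ
  have h1 : reflL2 γ (φ.toLp 2) = ψ.toLp 2 := by
    refine Lp.ext ?_
    filter_upwards [coeFn_reflL2 γ (φ.toLp 2), ae_reflect γ (φ.coeFn_toLp 2 volume),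
      ψ.coeFn_toLp 2 volume] with x e1 e2 e3
    rw [e1, e2, e3]; rfl
  rw [h1, SchwartzMap.toLp_fourier_eq]
  refine Lp.ext ?_
  filter_upwards [coeFn_reflL2 γ ((𝓕 φ : 𝓢(E3, ℂ)).toLp 2),
    ae_reflect γ ((𝓕 φ : 𝓢(E3, ℂ)).coeFn_toLp 2 volume),
      (𝓕 ψ : 𝓢(E3, ℂ)).coeFn_toLp 2 volume] with x e1 e2 e3
  rw [e1, e2, e3, SchwartzMap.fourier_coe, SchwartzMap.fourier_coe]
  exact Real.fourier_comp_linearIsometry (reflectₗᵢ γ) φ x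

theorem fourier_conjL2 (f : L2) : (𝓕 (conjL2 f) : L2) = conjL2 (reflL2 1 (𝓕 f)) := by
  refine congrFun ((SchwartzMap.denseRange_toLpCLM (E := E3) (F := ℂ) (p := 2) (μ := volume)
    (by norm_num)).equalizer (continuous_fourier_L2.comp continuous_conjL2)
    (continuous_conjL2.comp ((reflL2 1).continuous.comp continuous_fourier_L2))
    (funext fun φ => ?_)) f
  simp only [Function.comp_apply, SchwartzMap.toLpCLM_apply, SchwartzMap.toLp_fourier_eq]
  set ψ : 𝓢(E3, ℂ) := SchwartzMap.postcompCLM (Complex.conjCLE : ℂ →L[ℝ] ℂ) φ with hψ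
  have hψa : ∀ x, ψ x = (starRingEnd ℂ) (φ x) := fun x => rfl
  have h1 : conjL2 (φ.toLp 2) = ψ.toLp 2 := by
    refine Lp.ext ?_
    filter_upwards [coeFn_conjL2 (φ.toLp 2), φ.coeFn_toLp 2 volume,
      ψ.coeFn_toLp 2 volume] with x e1 e2 e3
    rw [e1, e2, e3]; rfl
  rw [h1, SchwartzMap.toLp_fourier_eq]
  refine Lp.ext ?_
  filter_upwards [coeFn_conjL2 (reflL2 1 ((𝓕 φ : 𝓢(E3, ℂ)).toLp 2)),
    coeFn_reflL2 1 ((𝓕 φ : 𝓢(E3, ℂ)).toLp 2),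
    ae_reflect 1 ((𝓕 φ : 𝓢(E3, ℂ)).coeFn_toLp 2 volume),
      (𝓕 ψ : 𝓢(E3, ℂ)).coeFn_toLp 2 volume] with x e1 e2 e3 e4
  rw [e1, e2, e3, e4, SchwartzMap.fourier_coe, SchwartzMap.fourier_coe, reflect_one,
    Real.fourier_eq, Real.fourier_eq, ← integral_conj]
  refine integral_congr_ae (Eventually.of_forall fun y => ?_)
  simp only [hψa, Circle.smul_def, smul_eq_mul, map_mul, inner_neg_right, neg_neg]
  congr 1
  rw [← Circle.coe_inv_eq_conj, ← AddChar.map_neg_eq_inv]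

/-! ### Signs -/

/-- The sign `(-1)^{γ·α}`. -/
def sgn (γ α : Parity) : ℝ := (-1) ^ (∑ j, (γ j).val * (α j).val)

theorem sgn_mul_self (γ α : Parity) : sgn γ α * sgn γ α = 1 := neg_one_pow_mul_self_real _

theorem sgn_eq_or (γ α : Parity) : sgn γ α = 1 ∨ sgn γ α = -1 := neg_one_pow_eq_or ℝ _

theorem sgn_add (γ α β : Parity) : sgn γ (α + β) = sgn γ α * sgn γ β := by
  unfold sgn
  rw [← Finset.prod_pow_eq_pow_sum, ← Finset.prod_pow_eq_pow_sum, ← Finset.prod_pow_eq_pow_sum,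
    ← Finset.prod_mul_distrib]
  refine Finset.prod_congr rfl fun j _ => ?_
  rw [← pow_add, neg_one_pow_eq_pow_mod_two, neg_one_pow_eq_pow_mod_two (n := _ + _)]
  congr 1
  have : ∀ a b c : ZMod 2, a.val * (b + c).val % 2 = (a.val * b.val + a.val * c.val) % 2 := by decide
  exact this _ _ _

theorem sgn_single (γ : Parity) (l : Fin 3) : sgn γ (Pi.single l 1) = (-1) ^ (γ l).val := by
  unfold sgn
  congr 1
  rw [Finset.sum_eq_single l]
  · simp [ZMod.val_one]
  · intro j _ hj; simp [hj]
  · simp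

theorem exists_sgn_eq_neg_one {α : Parity} (h : α ≠ 0) : ∃ γ, sgn γ α = -1 := by
  obtain ⟨j, hj⟩ := Function.ne_iff.1 h
  refine ⟨Pi.single j 1, ?_⟩
  unfold sgn
  rw [Finset.sum_eq_single j]
  · have : ∀ a : ZMod 2, a ≠ 0 → a = 1 := by decide
    rw [this (α j) (by simpa using hj)]; simp [ZMod.val_one]
  · intro i _ hi; simp [hi]
  · simp

/-! ### Symmetries of the equation on the Fourier side -/

theorem WeakHeat.reflL2 {w : ℝ → L2} {Φ : ℝ → E3 → ℂ} (hw : WeakHeat w Φ) (γ : Parity) :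
    WeakHeat (fun t => reflL2 γ (w t)) (fun t ξ => Φ t (reflect γ ξ)) := by
  intro t ht χ hχ hs
  have h := hw t ht (fun ξ => χ (reflect γ ξ)) (hχ.comp (contDiff_reflect γ))
    (hs.comp_homeomorph (reflectₗᵢ γ).toHomeomorph)
  refine (h.congr_of_eventuallyEq (Eventually.of_forall fun s => ?_)).congr_deriv ?_
  · rw [← integral_comp_reflect γ]
    refine integral_congr_ae ?_
    filter_upwards [ae_reflect γ (coeFn_reflL2 γ (w s))] with ξ e
    rw [e, norm_reflect, reflect_reflect]
  · rw [← integral_comp_reflect γ]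
    refine integral_congr_ae ?_
    filter_upwards [coeFn_reflL2 γ (w t)] with ξ e
    rw [e, norm_reflect, reflect_reflect]

theorem WeakHeat.const_smul {w : ℝ → L2} {Φ : ℝ → E3 → ℂ} (hw : WeakHeat w Φ) (c : ℂ) :
    WeakHeat (fun t => c • w t) (fun t ξ => c * Φ t ξ) := by
  intro t ht χ hχ hs
  refine (((hw t ht χ hχ hs).const_mul c).congr_of_eventuallyEq
    (Eventually.of_forall fun s => ?_)).congr_deriv ?_
  · simp only []
    rw [← integral_const_mul]
    refine integral_congr_ae ?_
    filter_upwards [Lp.coeFn_smul c (w s)] with ξ e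
    rw [e, Pi.smul_apply, smul_eq_mul]; ring
  · rw [← integral_const_mul]
    refine integral_congr_ae ?_
    filter_upwards [Lp.coeFn_smul c (w t)] with ξ e
    rw [e, Pi.smul_apply, smul_eq_mul]; ring

theorem WeakHeat.conjL2 {w : ℝ → L2} {Φ : ℝ → E3 → ℂ} (hw : WeakHeat w Φ) :
    WeakHeat (fun t => conjL2 (w t)) (fun t ξ => (starRingEnd ℂ) (Φ t ξ)) := by
  intro t ht χ hχ hs
  have h := hw t ht (fun ξ => (starRingEnd ℂ) (χ ξ)) (Complex.conjCLE.contDiff.comp hχ)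
    (hs.comp_left (map_zero _))
  refine ((Complex.conjCLE : ℂ →L[ℝ] ℂ).hasFDerivAt.comp_hasDerivAt t h
    |>.congr_of_eventuallyEq (Eventually.of_forall fun s => ?_)).congr_deriv ?_
  · simp only [Function.comp_apply, ContinuousLinearEquiv.coe_coe, Complex.conjCLE_apply]
    rw [← integral_conj]
    refine integral_congr_ae ?_
    filter_upwards [coeFn_conjL2 (w s)] with ξ e
    rw [e]; simp only [map_mul, Complex.conj_conj, Complex.conj_ofReal]
  · simp only [ContinuousLinearEquiv.coe_coe, Complex.conjCLE_apply]
    rw [← integral_conj]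
    refine integral_congr_ae ?_
    filter_upwards [coeFn_conjL2 (w t)] with ξ e
    rw [e]; simp only [map_mul, map_sub, Complex.conj_conj, Complex.conj_ofReal]

theorem h2sq_congr {f g : L2} (h : ∀ᵐ ξ, ‖f ξ‖ₑ = ‖g ξ‖ₑ) : h2sq f = h2sq g := by
  refine lintegral_congr_ae ?_
  filter_upwards [h] with ξ e
  rw [e]

theorem h2sq_reflL2 (γ : Parity) (f : L2) : h2sq (reflL2 γ f) = h2sq f := by
  unfold h2sq
  rw [← lintegral_comp_reflect γ (fun ξ => ENNReal.ofReal ((1 + ‖ξ‖ ^ 2) ^ 2) * ‖f ξ‖ₑ ^ 2)]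
  refine lintegral_congr_ae ?_
  filter_upwards [coeFn_reflL2 γ f] with ξ e
  rw [e, norm_reflect]

/-- The action of a reflection on vector fields. -/
def actA (γ : Parity) (U : VField) : VField :=
  fun l => ((sgn γ (Pi.single l 1) : ℝ) : ℂ) • reflL2 γ (U l)

/-- The map `U ↦ -conj U`, which on the Fourier side corresponds to complex conjugation up to a
reflection. -/
def actD (U : VField) : VField := fun l => -conjL2 (U l)

theorem derivSymbol_reflect (m : Fin 3) (γ : Parity) (ξ : E3) :
    derivSymbol m (reflect γ ξ) = ((sgn γ (Pi.single m 1) : ℝ) : ℂ) * derivSymbol m ξ := by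
  unfold derivSymbol
  rw [reflect_apply, sgn_single]; push_cast; ring

theorem leraySymbol_reflect (l k : Fin 3) (γ : Parity) (ξ : E3) :
    leraySymbol l k (reflect γ ξ) = ((sgn γ (Pi.single l 1) : ℝ) : ℂ) *
      ((sgn γ (Pi.single k 1) : ℝ) : ℂ) * leraySymbol l k ξ := by
  unfold leraySymbol
  rw [reflect_apply, reflect_apply, norm_reflect, sgn_single, sgn_single]
  rw [← Complex.ofReal_mul, ← Complex.ofReal_mul]
  congr 1
  split_ifs with h
  · subst h
    have := neg_one_pow_mul_self_real (γ l).val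
    linear_combination -this
  · ring

theorem conv_reflect (f g : E3 → ℂ) (c d : ℂ) (γ : Parity) (ξ : E3) :
    conv (fun x => c * f (reflect γ x)) (fun x => d * g (reflect γ x)) ξ =
      c * d * conv f g (reflect γ ξ) := by
  unfold conv
  rw [← integral_comp_reflect γ (fun η => f (reflect γ ξ - η) * g η), ← integral_const_mul]
  refine integral_congr_ae (Eventually.of_forall fun η => ?_)
  simp only [reflect_sub]; ring

theorem coeFn_actA (γ : Parity) (U : VField) (l : Fin 3) :
    actA γ U l =ᵐ[volume] fun x => ((sgn γ (Pi.single l 1) : ℝ) : ℂ) * U l (reflect γ x) := by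
  filter_upwards [Lp.coeFn_smul ((sgn γ (Pi.single l 1) : ℝ) : ℂ) (reflL2 γ (U l)),
    coeFn_reflL2 γ (U l)] with x e1 e2
  unfold actA
  rw [e1, Pi.smul_apply, e2, smul_eq_mul]

theorem sgn_sq_complex (γ α : Parity) : ((sgn γ α : ℝ) : ℂ) * ((sgn γ α : ℝ) : ℂ) = 1 := by
  rw [← Complex.ofReal_mul, sgn_mul_self, Complex.ofReal_one]

/-- The signs of e_m and e_k from the two convolved components cancel those of the derivative and of
the Leray symbol; only the sign of e_l remains. -/
theorem nonlin_actA (γ : Parity) (U : VField) (l : Fin 3) (ξ : E3) :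
    nonlin (fn (actA γ U)) (fn (actA γ U)) l ξ =
      ((sgn γ (Pi.single l 1) : ℝ) : ℂ) * nonlin (fn U) (fn U) l (reflect γ ξ) := by
  unfold nonlin
  rw [Finset.mul_sum]
  refine Finset.sum_congr rfl fun k _ => ?_
  rw [Finset.mul_sum]
  refine Finset.sum_congr rfl fun m _ => ?_
  have : conv (fn (actA γ U) m) (fn (actA γ U) k) ξ = _ :=
    (conv_congr (coeFn_actA γ U m) (coeFn_actA γ U k) ξ).trans (conv_reflect _ _ _ _ γ ξ)
  rw [this, derivSymbol_reflect, leraySymbol_reflect]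
  have h := sgn_sq_complex γ (Pi.single l 1)
  unfold fn
  linear_combination (-(((sgn γ (Pi.single m 1) : ℝ) : ℂ) * derivSymbol m ξ *
    ((sgn γ (Pi.single k 1) : ℝ) : ℂ) * leraySymbol l k ξ *
    conv (U m) (U k) (reflect γ ξ))) * h

theorem coeFn_actD (U : VField) (l : Fin 3) :
    actD U l =ᵐ[volume] fun x => -(starRingEnd ℂ) (U l x) := by
  filter_upwards [Lp.coeFn_neg (conjL2 (U l)), coeFn_conjL2 (U l)] with x e1 e2
  unfold actD
  rw [e1, Pi.neg_apply, e2]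

/-- The convolution does not see the sign in -conj U, while the derivative symbol is purely
imaginary and changes sign under conjugation. This is why the minus sign belongs to the action. -/
theorem nonlin_actD (U : VField) (l : Fin 3) (ξ : E3) :
    nonlin (fn (actD U)) (fn (actD U)) l ξ = -(starRingEnd ℂ) (nonlin (fn U) (fn U) l ξ) := by
  unfold nonlin
  rw [map_sum, ← Finset.sum_neg_distrib]
  refine Finset.sum_congr rfl fun k _ => ?_
  rw [map_sum, ← Finset.sum_neg_distrib]
  refine Finset.sum_congr rfl fun m _ => ?_
  have h1 : conv (fn (actD U) m) (fn (actD U) k) ξ = (starRingEnd ℂ) (conv (fn U m) (fn U k) ξ) := by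
    refine (conv_congr (coeFn_actD U m) (coeFn_actD U k) ξ).trans ?_
    unfold conv
    rw [← integral_conj]
    refine integral_congr_ae (Eventually.of_forall fun η => ?_)
    simp [fn]
  rw [h1]
  simp only [map_mul]
  have h2 : (starRingEnd ℂ) (derivSymbol m ξ) = -derivSymbol m ξ := by
    simp only [derivSymbol, map_mul, Complex.conj_I, Complex.conj_ofReal, Complex.conj_ofNat]; ring
  have h3 : (starRingEnd ℂ) (leraySymbol l k ξ) = leraySymbol l k ξ := Complex.conj_ofReal _
  rw [h2, h3]; ring

theorem FourierSolution.actA {U : ℝ → VField} (hU : FourierSolution U) (γ : Parity) :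
    FourierSolution fun t => actA γ (U t) where
  continuousOn l :=
    (continuous_const_smul ((sgn γ (Pi.single l 1) : ℝ) : ℂ)).comp_continuousOn
      ((NSSymmetry.reflL2 γ).continuous.comp_continuousOn (hU.continuousOn l))
  weak l := (((hU.weak l).reflL2 γ).const_smul _).congr fun t _ =>
    Eventually.of_forall fun ξ => (nonlin_actA γ (U t) l ξ).symm
  h2 T l := by
    refine (le_of_eq ?_).trans_lt (hU.h2 T l)
    refine lintegral_congr fun t => ?_
    rw [← h2sq_reflL2 γ (U t l)]
    refine h2sq_congr ?_
    filter_upwards [Lp.coeFn_smul ((sgn γ (Pi.single l 1) : ℝ) : ℂ) (NSSymmetry.reflL2 γ (U t l))]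
      with x e
    have : ‖((sgn γ (Pi.single l 1) : ℝ) : ℂ)‖ₑ = 1 := by
      rcases sgn_eq_or γ (Pi.single l 1) with h | h <;> rw [h] <;> simp
    unfold NSSymmetry.actA
    rw [e, Pi.smul_apply, smul_eq_mul, enorm_mul, this, one_mul]

theorem FourierSolution.actD {U : ℝ → VField} (hU : FourierSolution U) :
    FourierSolution fun t => actD (U t) where
  continuousOn l := (continuous_conjL2.comp_continuousOn (hU.continuousOn l)).neg
  weak l := by
    have h := ((hU.weak l).conjL2.const_smul (-1)).congr fun t _ =>
      Eventually.of_forall fun ξ => ((neg_one_mul _).trans (nonlin_actD (U t) l ξ).symm)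
    simpa only [NSSymmetry.actD, neg_smul, one_smul] using h
  h2 T l := by
    refine (le_of_eq ?_).trans_lt (hU.h2 T l)
    refine lintegral_congr fun t => h2sq_congr ?_
    filter_upwards [coeFn_actD (U t) l] with x e
    rw [e, enorm_neg, ← ofReal_norm, ← ofReal_norm, RCLike.norm_conj]

/-! ### Symmetry types in terms of the action -/

theorem hasParity_iff (f : E3 → ℝ) (α : Parity) :
    HasParity f α ↔ ∀ γ, ∀ᵐ x, f (reflect γ x) = sgn γ α * f x := Iff.rfl

/-- When the signs of α and β at γ differ, the real and the imaginary part are multiplied by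
opposite signs, which is a sign times complex conjugation. -/
theorem hasParity_re_im_iff (f : L2) (α β : Parity) :
    HasParity (fun x => (f x).re) α ∧ HasParity (fun x => (f x).im) β ↔
      ∀ γ, reflL2 γ f = ((sgn γ α : ℝ) : ℂ) • (if sgn γ α = sgn γ β then f else conjL2 f) := by
  rw [hasParity_iff, hasParity_iff, ← forall_and]
  refine forall_congr' fun γ => ?_
  rw [← eventually_and, Lp.ext_iff]
  have h : ∀ᵐ x, (((f (reflect γ x)).re = sgn γ α * (f x).re ∧
      (f (reflect γ x)).im = sgn γ β * (f x).im) ↔ reflL2 γ f x =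
        (((sgn γ α : ℝ) : ℂ) • (if sgn γ α = sgn γ β then f else conjL2 f) : L2) x) := by
    filter_upwards [coeFn_reflL2 γ f, coeFn_conjL2 f,
      Lp.coeFn_smul ((sgn γ α : ℝ) : ℂ) (if sgn γ α = sgn γ β then f else conjL2 f)] with x e1 e2 e3
    rw [e1, e3, Pi.smul_apply, smul_eq_mul, Complex.ext_iff, Complex.re_ofReal_mul,
      Complex.im_ofReal_mul]
    by_cases h : sgn γ α = sgn γ β
    · simp [h]
    · have h' : sgn γ β = -sgn γ α := by
        rcases sgn_eq_or γ α with ha | ha <;> rcases sgn_eq_or γ β with hb | hb <;> simp_all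
      rw [if_neg h, e2, h']
      simp
  exact eventually_congr h

/-- The symmetry operation belonging to a reflection, with or without conjugation. -/
def actS (γ : Parity) (c : Prop) [Decidable c] (U : VField) : VField :=
  if c then actA γ U else actA γ (actD (actA 1 U))

theorem FourierSolution.actS {U : ℝ → VField} (hU : FourierSolution U) (γ : Parity) (c : Prop)
    [Decidable c] : FourierSolution fun t => actS γ c (U t) := by
  unfold NSSymmetry.actS
  split_ifs
  · exact hU.actA γ
  · exact (hU.actA 1).actD.actA γ

theorem sgn_one_single (l : Fin 3) : sgn 1 (Pi.single l 1) = -1 := by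
  rw [sgn_single]; simp [ZMod.val_one]

/-- The composite of `actD` and `actA 1` sends U to conj U(-ξ), the transform of the conjugate
field. So `actS` is the reflection of the vector field u or of its conjugate. -/
theorem actS_hat (γ : Parity) (c : Prop) [Decidable c] (u : VField) (l : Fin 3) :
    actS γ c (hat u) l = ((sgn γ (Pi.single l 1) : ℝ) : ℂ) •
      (𝓕 (reflL2 γ (if c then u l else conjL2 (u l))) : L2) := by
  unfold actS
  split_ifs with h
  · unfold actA
    rw [fourier_reflL2]; rfl
  · unfold actA actD
    rw [fourier_reflL2, fourier_conjL2]
    simp only [sgn_one_single, conjL2_ofReal_smul, hat_apply]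
    simp

theorem fourier_L2_injective : Function.Injective fun f : L2 => (𝓕 f : L2) :=
  (Lp.fourierTransformₗᵢ E3 ℂ).injective

theorem smul_sgn_eq_iff (γ α : Parity) (f g : L2) :
    ((sgn γ α : ℝ) : ℂ) • f = g ↔ f = ((sgn γ α : ℝ) : ℂ) • g := by
  constructor
  · rintro rfl; rw [smul_smul, sgn_sq_complex, one_smul]
  · rintro rfl; rw [smul_smul, sgn_sq_complex, one_smul]

/-- The vector action of γ carries the sign of e_l, so the type becomes an eigenvalue condition with
one eigenvalue for all components. Everything then depends on whether a = 0 (all eigenvalues 1) or a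
≠ 0 (some eigenvalue -1). -/
theorem hasSymmetryType_iff (u : VField) (a b : Parity) :
    HasSymmetryType u (fun l => (Pi.single l 1 + a, Pi.single l 1 + b)) ↔
      ∀ γ, actS γ (sgn γ a = sgn γ b) (hat u) = ((sgn γ a : ℝ) : ℂ) • hat u := by
  unfold HasSymmetryType
  simp_rw [hasParity_re_im_iff, funext_iff, Pi.smul_apply, actS_hat]
  rw [forall_comm]
  refine forall_congr' fun γ => forall_congr' fun l => ?_
  have hF : ∀ (c : ℂ) (f : L2), c • (𝓕 f : L2) = 𝓕 (c • f) := fun c f =>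
    ((Lp.fourierTransformₗᵢ E3 ℂ).map_smul c f).symm
  rw [hat_apply, hF, hF, fourier_L2_injective.eq_iff, smul_sgn_eq_iff, sgn_add, sgn_add]
  have h0 : sgn γ (Pi.single l 1) ≠ 0 := by
    intro h; have := sgn_mul_self γ (Pi.single l 1); rw [h] at this; simp at this
  simp only [mul_right_inj' h0]
  rw [Complex.ofReal_mul, mul_smul]
  split_ifs with h
  · rfl
  · constructor
    · intro e
      rw [← conjL2_reflL2, e, conjL2_ofReal_smul, conjL2_ofReal_smul, conjL2_conjL2]
    · intro e
      have := congrArg conjL2 e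
      rwa [conjL2_reflL2, conjL2_conjL2, conjL2_ofReal_smul, conjL2_ofReal_smul] at this

/-! ### The persistence of symmetry types -/

theorem sgn_zero (γ : Parity) : sgn γ 0 = 1 := by simp [sgn]

theorem sgn_eq_neg_one_iff (γ α : Parity) : sgn γ α = -1 ↔ ∑ j, γ j * α j = 1 := by
  have h : ((∑ j, (γ j).val * (α j).val : ℕ) : ZMod 2) = ∑ j, γ j * α j := by
    push_cast; simp
  unfold sgn
  rw [← h]
  generalize (∑ j, (γ j).val * (α j).val : ℕ) = n
  rcases Nat.even_or_odd n with hn | hn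
  · rw [hn.neg_one_pow, (ZMod.natCast_eq_zero_iff_even).2 hn]; norm_num
  · rw [hn.neg_one_pow, (ZMod.natCast_eq_one_iff_odd).2 hn]; simp

theorem exists_sgn_neg_one_pair {α β : Parity} (h1 : α ≠ 0) (h2 : β ≠ 0) :
    ∃ γ, sgn γ α = -1 ∧ sgn γ β = -1 := by
  simp_rw [sgn_eq_neg_one_iff]
  revert α β
  decide

theorem exists_isolated {c : Fin 3 → Parity} (h : ∃ l, c l ≠ c 0) : ∃ l, ∀ k, k ≠ l → c k ≠ c l := by
  by_cases h1 : c 1 = c 0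
  · refine ⟨2, fun k hk => ?_⟩
    obtain ⟨l, hl⟩ := h
    have h2 : c 2 ≠ c 0 := by
      fin_cases l
      · exact absurd rfl hl
      · exact absurd h1 hl
      · exact hl
    fin_cases k
    · exact h2.symm
    · simpa [h1] using h2.symm
    · exact absurd rfl hk
  · by_cases h2 : c 2 = c 0
    · refine ⟨1, fun k hk => ?_⟩
      fin_cases k
      · exact Ne.symm h1
      · exact absurd rfl hk
      · simpa [h2] using Ne.symm h1
    · refine ⟨0, fun k hk => ?_⟩
      fin_cases k
      · exact absurd rfl hk
      · exact h1
      · exact h2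

theorem ae_coord_ne_zero (l : Fin 3) : ∀ᵐ ξ : E3, ξ l ≠ 0 := by
  set p : E3 →ₗ[ℝ] ℝ := (EuclideanSpace.proj (𝕜 := ℝ) l : StrongDual ℝ E3).toLinearMap
  have h : (LinearMap.ker p) ≠ ⊤ := by
    intro h
    have : basisVec l ∈ LinearMap.ker p := h ▸ Submodule.mem_top
    have h1 : basisVec l l = 0 := this
    simp [basisVec] at h1
  have := Measure.addHaar_submodule (volume : Measure E3) _ h
  rw [ae_iff]
  convert this using 2
  ext ξ
  simp [p]

/-! ### Parities forced by the divergence constraint -/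

/-- The real part of `c f` as an element of `L²`. -/
def reMul (c : ℂ) (f : L2) : L2 := (c / 2) • f + ((starRingEnd ℂ) c / 2) • conjL2 f

theorem coeFn_reMul (c : ℂ) (f : L2) : reMul c f =ᵐ[volume] fun x => (((c * f x).re : ℝ) : ℂ) := by
  unfold reMul
  filter_upwards [Lp.coeFn_add ((c / 2) • f) (((starRingEnd ℂ) c / 2) • conjL2 f),
    Lp.coeFn_smul (c / 2) f, Lp.coeFn_smul ((starRingEnd ℂ) c / 2) (conjL2 f), coeFn_conjL2 f]
    with x e1 e2 e3 e4
  rw [e1, Pi.add_apply, e2, e3, Pi.smul_apply, Pi.smul_apply, e4, Complex.re_eq_add_conj, map_mul]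
  simp only [smul_eq_mul]; ring

theorem fourier_reMul (c : ℂ) (f : L2) : (𝓕 (reMul c f) : L2) =ᵐ[volume] fun ξ =>
    c / 2 * (𝓕 f : L2) ξ + (starRingEnd ℂ) c / 2 * (starRingEnd ℂ) ((𝓕 f : L2) (-ξ)) := by
  have h : (𝓕 (reMul c f) : L2) =
      (c / 2) • (𝓕 f : L2) + ((starRingEnd ℂ) c / 2) • conjL2 (reflL2 1 (𝓕 f)) := by
    unfold reMul
    rw [← fourier_conjL2]
    exact ((Lp.fourierTransformₗᵢ E3 ℂ).map_add _ _).trans (congrArg₂ (· + ·)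
      ((Lp.fourierTransformₗᵢ E3 ℂ).map_smul _ _) ((Lp.fourierTransformₗᵢ E3 ℂ).map_smul _ _))
  rw [h]
  set g : L2 := 𝓕 f
  filter_upwards [Lp.coeFn_add ((c / 2) • g) (((starRingEnd ℂ) c / 2) • conjL2 (reflL2 1 g)),
    Lp.coeFn_smul (c / 2) g, Lp.coeFn_smul ((starRingEnd ℂ) c / 2) (conjL2 (reflL2 1 g)),
    coeFn_conjL2 (reflL2 1 g), coeFn_reflL2 1 g] with x e1 e2 e3 e4 e5
  rw [e1, Pi.add_apply, e2, e3, Pi.smul_apply, Pi.smul_apply, e4, e5, reflect_one]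
  rfl

/-- The terms ξ_k v̂_k sum to zero and have parity e_k + α_k. As the parity for l differs from the
two others, some reflection changes the sign of both others relative to l; adding the reflected
equation leaves 2ξ_l v̂_l = 0. The values c = 1 and c = -i select the real and the imaginary parts.
-/
theorem re_eq_zero_of_parity {u : VField} (hu : divergence u = 0) (c : ℂ) {α : Fin 3 → Parity}
    (hα : ∀ l, HasParity (fun x => (c * u l x).re) (α l)) {l : Fin 3}
    (hl : ∀ k, k ≠ l → Pi.single k 1 + α k ≠ Pi.single l 1 + α l) : ∀ᵐ x, (c * u l x).re = 0 := by
  set v : VField := fun k => reMul c (u k) with hv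
  have hR : ∀ γ k, reflL2 γ (v k) = ((sgn γ (α k) : ℝ) : ℂ) • v k := by
    intro γ k
    refine Lp.ext ?_
    filter_upwards [coeFn_reflL2 γ (v k), ae_reflect γ (coeFn_reMul c (u k)), coeFn_reMul c (u k),
      hα k γ, Lp.coeFn_smul ((sgn γ (α k) : ℝ) : ℂ) (v k)] with x e1 e2 e3 e4 e5
    rw [e1, e5, Pi.smul_apply, e2, e3, smul_eq_mul, ← Complex.ofReal_mul, e4]; rfl
  have hR' : ∀ γ, ∀ᵐ ξ, ∀ k, (𝓕 (v k) : L2) (reflect γ ξ) = ((sgn γ (α k) : ℝ) : ℂ) * (𝓕 (v k) : L2) ξ := by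
    intro γ
    rw [ae_all_iff]
    intro k
    have h : reflL2 γ (𝓕 (v k) : L2) = ((sgn γ (α k) : ℝ) : ℂ) • (𝓕 (v k) : L2) := by
      rw [← fourier_reflL2, hR]
      exact (Lp.fourierTransformₗᵢ E3 ℂ).map_smul _ _
    filter_upwards [coeFn_reflL2 γ (𝓕 (v k) : L2),
      Lp.coeFn_smul ((sgn γ (α k) : ℝ) : ℂ) (𝓕 (v k) : L2)] with ξ e1 e2
    rw [← e1, h, e2]; rfl
  have hdiv : ∀ᵐ ξ : E3, ∑ k, (ξ k : ℂ) * (𝓕 (v k) : L2) ξ = 0 := by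
    have h0 := (divergence_eq_zero_iff u).1 hu
    filter_upwards [h0, ae_reflect 1 h0, ae_all_iff.2 fun k => fourier_reMul c (u k)] with ξ e1 e2 e3
    rw [reflect_one] at e2
    have e2' := congrArg (starRingEnd ℂ) e2
    simp only [map_sum, map_mul, Complex.conj_ofReal, map_zero, PiLp.neg_apply] at e2'
    simp only [hv]
    simp_rw [e3]
    have : ∑ k, (ξ k : ℂ) * (c / 2 * (𝓕 (u k) : L2) ξ +
        (starRingEnd ℂ) c / 2 * (starRingEnd ℂ) ((𝓕 (u k) : L2) (-ξ))) =
        c / 2 * ∑ k, (ξ k : ℂ) * (𝓕 (u k) : L2) ξ - (starRingEnd ℂ) c / 2 *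
          ∑ k, ((-ξ k : ℝ) : ℂ) * (starRingEnd ℂ) ((𝓕 (u k) : L2) (-ξ)) := by
      rw [Finset.mul_sum, Finset.mul_sum, ← Finset.sum_sub_distrib]
      refine Finset.sum_congr rfl fun k _ => ?_
      push_cast; ring
    rw [this, e1, e2']; simp
  set e : Fin 3 → Parity := fun k => Pi.single k 1 + α k with he
  obtain ⟨γ, hγ⟩ : ∃ γ, ∀ k, k ≠ l → sgn γ (e k + e l) = -1 := by
    have hne : ∀ k, k ≠ l → e k + e l ≠ 0 := by
      intro k hk h
      have : ∀ a b : Parity, a + b = 0 → a = b := by decide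
      exact hl k hk (this _ _ h)
    obtain ⟨γ, h1, h2⟩ := exists_sgn_neg_one_pair (hne (l + 1) (by fin_cases l <;> decide))
      (hne (l + 2) (by fin_cases l <;> decide))
    refine ⟨γ, fun k hk => ?_⟩
    have h3 : ∀ k l : Fin 3, k ≠ l → k = l + 1 ∨ k = l + 2 := by decide
    rcases h3 k l hk with rfl | rfl
    · exact h1
    · exact h2
  have hγ' : ∀ k, sgn γ (e k) = (if k = l then 1 else -1) * sgn γ (e l) := by
    intro k
    split_ifs with h
    · rw [h, one_mul]
    · have := hγ k h
      rw [sgn_add] at this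
      have h2 := sgn_mul_self γ (e l)
      linear_combination (-sgn γ (e k)) * h2 + sgn γ (e l) * this
  have hzero : ∀ᵐ ξ, (𝓕 (v l) : L2) ξ = 0 := by
    filter_upwards [hdiv, ae_reflect γ hdiv, hR' γ, ae_coord_ne_zero l] with ξ e1 e2 e3 e4
    have h3 : ∑ k, (reflect γ ξ k : ℂ) * (𝓕 (v k) : L2) (reflect γ ξ) =
        ((sgn γ (e l) : ℝ) : ℂ) * (2 * ((ξ l : ℂ) * (𝓕 (v l) : L2) ξ) -
          ∑ k, (ξ k : ℂ) * (𝓕 (v k) : L2) ξ) := by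
      have h4 : (2 * ((ξ l : ℂ) * (𝓕 (v l) : L2) ξ)) =
          ∑ k, if k = l then 2 * ((ξ k : ℂ) * (𝓕 (v k) : L2) ξ) else 0 := by simp
      rw [h4, ← Finset.sum_sub_distrib, Finset.mul_sum]
      refine Finset.sum_congr rfl fun k _ => ?_
      have h5 := hγ' k
      rw [he] at h5
      simp only [sgn_add] at h5
      rw [e3, reflect_apply, ← sgn_single, he]
      simp only [sgn_add]
      push_cast
      have h6 : ((sgn γ (Pi.single k 1) : ℝ) : ℂ) * ((sgn γ (α k) : ℝ) : ℂ) =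
          (if k = l then 1 else -1) * (((sgn γ (Pi.single l 1) : ℝ) : ℂ) * ((sgn γ (α l) : ℝ) : ℂ)) := by
        split_ifs with h
        · rw [if_pos h] at h5; exact_mod_cast h5
        · rw [if_neg h] at h5; exact_mod_cast h5
      split_ifs with h
      · rw [if_pos h] at h6
        linear_combination ((ξ k : ℂ) * (𝓕 (v k) : L2) ξ) * h6
      · rw [if_neg h] at h6
        linear_combination ((ξ k : ℂ) * (𝓕 (v k) : L2) ξ) * h6
    rw [h3, e1, sub_zero] at e2
    have h0 : ((sgn γ (e l) : ℝ) : ℂ) ≠ 0 := by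
      rcases sgn_eq_or γ (e l) with h | h <;> rw [h] <;> simp
    simpa [h0, e4] using e2
  have hv0 : v l = 0 := by
    have : (𝓕 (v l) : L2) = 0 := (Lp.eq_zero_iff_ae_eq_zero).2 hzero
    exact (map_eq_zero_iff (Lp.fourierTransformₗᵢ E3 ℂ) (Lp.fourierTransformₗᵢ E3 ℂ).injective).1 this
  filter_upwards [coeFn_reMul c (u l), (Lp.eq_zero_iff_ae_eq_zero).1 hv0] with x e1 e2
  have : (((c * u l x).re : ℝ) : ℂ) = 0 := by rw [← e1]; exact e2
  exact_mod_cast this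

/-- Three parities that are not all equal contain an isolated one. Because the type is the same at
all times, the isolated component would vanish at all times and be constant. Hence e_l + α_l does
not depend on l. -/
theorem exists_type_of_keeps {u₀ : VField} {u : ℝ → VField} (hu : IsStrongSolution u₀ u)
    (hn : NonconstantComponents u) {τ : SymmetryType} (hτ : ∀ t, 0 ≤ t → HasSymmetryType (u t) τ) :
    ∃ a b : Parity, τ = fun l => (Pi.single l 1 + a, Pi.single l 1 + b) := by
  have key : ∀ (c : ℂ) (α : Fin 3 → Parity),
      (∀ t, 0 ≤ t → ∀ l, HasParity (fun x => (c * u t l x).re) (α l)) →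
      (∀ l, ¬ ∀ t, 0 ≤ t → ∀ᵐ x, (c * u t l x).re = 0) → ∃ a : Parity, ∀ l, α l = Pi.single l 1 + a := by
    intro c α h1 h2
    have h : ¬ ∃ l, Pi.single l 1 + α l ≠ Pi.single 0 1 + α 0 := by
      intro h
      obtain ⟨l, hl⟩ := exists_isolated (c := fun k => Pi.single k 1 + α k) h
      exact h2 l fun t ht => re_eq_zero_of_parity (hu.divergence_free t ht) c (h1 t ht) hl
    push Not at h
    refine ⟨Pi.single 0 1 + α 0, fun l => ?_⟩
    have : ∀ x y : Parity, y = x + (x + y) := by decide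
    rw [← h l]
    exact this _ _
  obtain ⟨a, ha⟩ := key 1 (fun l => (τ l).1) (fun t ht l => by simpa using (hτ t ht l).1)
    (fun l h => (hn l).1 ⟨0, fun t ht => by simpa using h t ht⟩)
  obtain ⟨b, hb⟩ := key (-Complex.I) (fun l => (τ l).2) (fun t ht l => by simpa using (hτ t ht l).2)
    (fun l h => (hn l).2 ⟨0, fun t ht => by simpa using h t ht⟩)
  exact ⟨a, b, funext fun l => Prod.ext (ha l) (hb l)⟩

/-! ### Heat flow under the symmetries, and solutions sent to their negatives -/

theorem heatPath_smul (c : ℂ) (g : L2) {t : ℝ} (ht : 0 ≤ t) :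
    heatPath (c • g) t = c • heatPath g t := by
  refine Lp.ext ?_
  filter_upwards [coeFn_heatPath (c • g) ht, coeFn_heatPath g ht, Lp.coeFn_smul c g,
    Lp.coeFn_smul c (heatPath g t)] with ξ e1 e2 e3 e4
  rw [e1, e4, e3, Pi.smul_apply, Pi.smul_apply, e2]; simp only [smul_eq_mul]; ring

theorem gauss_reflect (t : ℝ) (γ : Parity) (ξ : E3) : gauss t (reflect γ ξ) = gauss t ξ := by
  unfold gauss; rw [norm_reflect]

theorem reflL2_heatPath (γ : Parity) (g : L2) {t : ℝ} (ht : 0 ≤ t) :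
    reflL2 γ (heatPath g t) = heatPath (reflL2 γ g) t := by
  refine Lp.ext ?_
  filter_upwards [coeFn_heatPath (reflL2 γ g) ht, ae_reflect γ (coeFn_heatPath g ht),
    coeFn_reflL2 γ g, coeFn_reflL2 γ (heatPath g t)] with ξ e1 e2 e3 e4
  rw [e4, e2, e1, e3, gauss_reflect]

theorem conjL2_heatPath (g : L2) {t : ℝ} (ht : 0 ≤ t) :
    conjL2 (heatPath g t) = heatPath (conjL2 g) t := by
  refine Lp.ext ?_
  filter_upwards [coeFn_heatPath (conjL2 g) ht, coeFn_heatPath g ht,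
    coeFn_conjL2 g, coeFn_conjL2 (heatPath g t)] with ξ e1 e2 e3 e4
  rw [e4, e2, e1, e3, map_mul, Complex.conj_ofReal]

theorem eq_zero_of_weakHeat_zero {w : ℝ → L2} {Φ : ℝ → E3 → ℂ} (hw : WeakHeat w Φ)
    (h0 : ∀ t, 0 < t → w t = 0) {t : ℝ} (ht : 0 < t) (hΦ : LocallyIntegrable (Φ t)) :
    Φ t =ᵐ[volume] 0 := by
  have hl : LocallyIntegrable fun ξ => ((‖ξ‖ ^ 2 : ℝ) : ℂ) * Φ t ξ := by
    have := (locallyIntegrableOn_univ.2 hΦ).continuousOn_mul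
      (by fun_prop : Continuous fun ξ : E3 => ((‖ξ‖ ^ 2 : ℝ) : ℂ)).continuousOn isOpen_univ.isLocallyClosed
    exact locallyIntegrableOn_univ.1 this
  have key : (fun ξ => ((‖ξ‖ ^ 2 : ℝ) : ℂ) * Φ t ξ) =ᵐ[volume] 0 := by
    refine ae_eq_zero_of_forall_schwartz hl fun χ hχ hs => ?_
    have hz : ∀ s, 0 < s → ∀ᵐ ξ, w s ξ = 0 := fun s hs' => by
      rw [h0 s hs']; exact Lp.coeFn_zero _ _ _
    have h1 : HasDerivAt (fun s => ∫ ξ, ((‖ξ‖ ^ 2 : ℝ) : ℂ) * χ ξ * w s ξ) 0 t := by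
      refine (hasDerivAt_const t (0 : ℂ)).congr_of_eventuallyEq ?_
      filter_upwards [Ioi_mem_nhds ht] with s hs'
      rw [← integral_zero E3 ℂ]
      refine integral_congr_ae ?_
      filter_upwards [hz s hs'] with ξ e
      rw [e, mul_zero]
    have h2 := (hw t ht χ hχ hs).unique h1
    rw [← neg_eq_zero, ← integral_neg, ← h2]
    refine integral_congr_ae ?_
    filter_upwards [hz t ht] with ξ e
    rw [e]; ring
  filter_upwards [key, ae_ne_zero] with ξ h1 h2
  simpa [h2] using h1

/-- A solution which is mapped to its negative by a symmetry of the equation solves the heat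
equation, and its nonlinear term vanishes. -/
theorem FourierSolution.eq_heatPath_of_neg {U W : ℝ → VField} (hU : FourierSolution U)
    (hW : FourierSolution W) (h : ∀ t, 0 ≤ t → W t = -U t) :
    (∀ t, 0 ≤ t → ∀ l, U t l = heatPath (U 0 l) t) ∧
      ∀ t, 0 < t → ∀ l, nonlin (fn (U t)) (fn (U t)) l =ᵐ[volume] 0 := by
  have hli : ∀ (X : ℝ → VField) l (s : ℝ), LocallyIntegrable (nonlin (fn (X s)) (fn (X s)) l) :=
    fun X l s => locallyIntegrable_nonlin (X s) (X s) l
  -- The quadratic term is even, so it cancels in the equation for U - W = 2U.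
  have hnl : ∀ t, 0 < t → ∀ l, nonlin (fn (W t)) (fn (W t)) l = nonlin (fn (U t)) (fn (U t)) l := by
    intro t ht l
    rw [h t ht.le]
    funext ξ
    unfold nonlin
    refine Finset.sum_congr rfl fun k _ => Finset.sum_congr rfl fun m _ => ?_
    have hm : ∀ m, fn (-U t) m =ᵐ[volume] fun x => -U t m x := fun m => Lp.coeFn_neg _
    rw [conv_congr (hm m) (hm k)]
    unfold conv fn
    simp
  have hd : ∀ t, 0 ≤ t → ∀ l, U t l = heatPath (U 0 l) t := by
    intro t ht l
    have hsub := ((hU.weak l).sub (hW.weak l) (fun s _ => hli U l s) (fun s _ => hli W l s)).congr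
      (Ψ := 0) fun s hs => by rw [hnl s hs l]; exact Eventually.of_forall fun ξ => sub_self _
    have h1 := hsub.eq_heatPath ((hU.continuousOn l).sub (hW.continuousOn l)) ht
    have h2 : ∀ s, 0 ≤ s → U s l - W s l = (2 : ℂ) • U s l := fun s hs => by
      rw [h s hs, Pi.neg_apply, sub_neg_eq_add, two_smul]
    rw [h2 t ht, h2 0 le_rfl, heatPath_smul _ _ ht] at h1
    exact smul_right_injective _ (two_ne_zero) h1
  refine ⟨hd, fun t ht l => ?_⟩
  -- U minus its own heat flow is identically zero yet solves the heat equation with the quadratic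
  -- term as forcing, so that forcing vanishes.
  have h1 := (hU.weak l).sub (weakHeat_heatPath (U 0 l)) (fun s _ => hli U l s)
    (fun s _ => locallyIntegrable_zero)
  have h2 := eq_zero_of_weakHeat_zero h1 (fun s hs => by rw [← hd s hs.le l, sub_self]) ht
    (by simpa using hli U l t)
  filter_upwards [h2] with ξ e
  simpa using e

/-- For a ≠ 0 some γ has eigenvalue -1, so a symmetry of the equation maps u to -u. -/
theorem beltrami_of_keeps {u₀ : VField} {u : ℝ → VField} (hu : IsStrongSolution u₀ u) {a b : Parity}
    (h : ∀ t, 0 ≤ t → HasSymmetryType (u t) fun l => (Pi.single l 1 + a, Pi.single l 1 + b))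
    (ha : a ≠ 0) : IsBeltramiType u₀ := by
  obtain ⟨γ, hγ⟩ := exists_sgn_eq_neg_one ha
  obtain ⟨h1, h2⟩ := hu.fourierSolution.eq_heatPath_of_neg
    (hu.fourierSolution.actS γ (sgn γ a = sgn γ b)) fun t ht => by
      rw [(hasSymmetryType_iff _ a b).1 (h t ht) γ, hγ]; simp
  refine ⟨fun t ht l => ?_, hu.initial ▸ hu.divergence_free 0 le_rfl⟩
  rw [lerayConvection_eq_zero_iff]
  have ht' : (0 : ℝ) < t := ht
  have e : (fun m => (𝓕 (heat t (u₀ m)) : L2)) = hat (u t) := by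
    funext m
    rw [fourier_heat, ← hu.initial]
    exact (h1 t ht'.le m).symm
  have h3 := h2 t ht' l
  rw [← e] at h3
  exact h3

/-- The matched types are those with a = 0: each symmetry fixes the initial value, and uniqueness
carries this to all times. -/
theorem keeps_of_matched {u₀ : VField} {u : ℝ → VField} (hu : IsStrongSolution u₀ u) {b : Parity}
    (h : HasSymmetryType u₀ (matchedType b)) (t : ℝ) (ht : 0 ≤ t) :
    HasSymmetryType (u t) (matchedType b) := by
  have e : matchedType b = fun l => (Pi.single l 1 + 0, Pi.single l 1 + b) := by
    funext l; simp [matchedType]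
  rw [e, hasSymmetryType_iff] at h ⊢
  intro γ
  have h0 := h γ
  simp only [sgn_zero, Complex.ofReal_one, one_smul] at h0 ⊢
  exact (hu.fourierSolution.actS γ _).unique hu.fourierSolution (by rw [hu.initial]; exact h0) t ht

/-- The condition makes the heat flow of u₀ a solution of the full equation, and the H¹ bound at
time 0 gives it the H² integrability needed for uniqueness. -/
theorem eq_heat_of_beltrami {u₀ : VField} {u : ℝ → VField} (hu : IsStrongSolution u₀ u)
    (h : IsBeltramiType u₀) (t : ℝ) (ht : 0 ≤ t) (l : Fin 3) :
    (𝓕 (u t l) : L2) = heatPath (𝓕 (u₀ l)) t := by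
  have hV : FourierSolution fun t => fun l => heatPath (𝓕 (u₀ l)) t :=
    { continuousOn := fun l => continuousOn_heatPath _
      weak := fun l => (weakHeat_heatPath _).congr fun t ht => by
        have := (lerayConvection_eq_zero_iff _ _ l).1 (h.1 ⟨t, ht.le⟩ ht l)
        have e : (fun m => ((𝓕 (heat ⟨t, ht.le⟩ (u₀ m)) : L2) : E3 → ℂ)) =
            fn fun m => heatPath (𝓕 (u₀ m)) t :=
          funext fun m => congrArg (fun f : L2 => (f : E3 → ℂ)) (fourier_heat ⟨t, ht.le⟩ (u₀ m))
        rw [e] at this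
        exact this.symm
      h2 := fun T l => by
        obtain ⟨M, hM⟩ := hu.bounded_H1 0
        have := hM 0 (by simp) l
        rw [hu.initial] at this
        refine lintegral_h2sq_heatPath_lt_top ?_ T
        unfold sobolevSq at this
        simp_rw [pow_one] at this
        exact this.trans_lt ENNReal.coe_lt_top }
  have := hu.fourierSolution.unique hV (by
    funext l
    rw [hu.initial, heatPath_zero]; rfl) t ht
  exact congrFun this l

theorem keeps_of_beltrami {u₀ : VField} {u : ℝ → VField} (hu : IsStrongSolution u₀ u)
    (h : IsBeltramiType u₀) {τ : SymmetryType} (hτ : HasSymmetryType u₀ τ) (t : ℝ) (ht : 0 ≤ t) :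
    HasSymmetryType (u t) τ := by
  unfold HasSymmetryType at hτ ⊢
  simp_rw [hasParity_re_im_iff] at hτ ⊢
  intro l γ
  have hF : ∀ (c : ℂ) (f : L2), (𝓕 (c • f) : L2) = c • 𝓕 f := fun c f =>
    (Lp.fourierTransformₗᵢ E3 ℂ).map_smul c f
  have e := eq_heat_of_beltrami hu h t ht l
  refine fourier_L2_injective ?_
  simp only [fourier_reflL2, hF]
  rw [e, reflL2_heatPath γ _ ht, ← fourier_reflL2, hτ l γ, hF, heatPath_smul _ _ ht]
  split_ifs
  · rw [e]
  · rw [fourier_conjL2, fourier_conjL2, e, reflL2_heatPath 1 _ ht, conjL2_heatPath _ ht]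

/-! ### The persistence criterion and the form of admissible types -/

theorem keepsSymmetryType_iff {u₀ : VField} {u : ℝ → VField} (hu : IsStrongSolution u₀ u)
    (hn : NonconstantComponents u) (hτ : ∃ τ, HasSymmetryType u₀ τ) :
    KeepsSymmetryType u ↔
      (∃ β₀ : Parity, HasSymmetryType u₀ (matchedType β₀)) ∨ IsBeltramiType u₀ := by
  constructor
  · rintro ⟨τ, h⟩
    obtain ⟨a, b, rfl⟩ := exists_type_of_keeps hu hn h
    by_cases ha : a = 0
    · refine Or.inl ⟨b, ?_⟩
      have := h 0 le_rfl
      rw [hu.initial] at this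
      unfold matchedType
      simpa only [ha, add_zero] using this
    · exact Or.inr (beltrami_of_keeps hu h ha)
  · rintro (⟨b, hb⟩ | hB)
    · exact ⟨_, keeps_of_matched hu hb⟩
    · obtain ⟨τ, hτ⟩ := hτ
      exact ⟨τ, keeps_of_beltrami hu hB hτ⟩

theorem exists_matched_of_isAdmissible {τ : SymmetryType} (h : IsAdmissible τ) :
    ∃ b, matchedType b = τ := by
  obtain ⟨u₀, u, hu, hn, hB, hτ⟩ := h
  obtain ⟨a, b, rfl⟩ := exists_type_of_keeps hu hn hτ
  by_cases ha : a = 0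
  · exact ⟨b, by funext l; simp [matchedType, ha]⟩
  · exact absurd (beltrami_of_keeps hu hτ ha) hB

theorem matchedType_injective : Function.Injective matchedType := by
  intro b c h
  have := congrArg Prod.snd (congrFun h 0)
  simpa [matchedType] using this

/-! ### A weight adapted to the quadratic term -/

/-- The weight `1 / (|ξ| (1 + |ξ|²)²)`. -/
def wt (ξ : E3) : ℝ := (‖ξ‖ * (1 + ‖ξ‖ ^ 2) ^ 2)⁻¹

/-- The integrable function `1 / (|ξ|² (1 + |ξ|²))`. -/
def rad (ξ : E3) : ℝ := (‖ξ‖ ^ 2 * (1 + ‖ξ‖ ^ 2))⁻¹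

theorem wt_nonneg (ξ : E3) : 0 ≤ wt ξ := by unfold wt; positivity

theorem rad_nonneg (ξ : E3) : 0 ≤ rad ξ := by unfold rad; positivity

theorem measurable_wt : Measurable wt := by unfold wt; fun_prop

theorem integrable_rad : Integrable rad := by
  have h : Integrable (fun ξ : E3 => (fun y : ℝ => (y ^ 2 * (1 + y ^ 2))⁻¹) ‖ξ‖) := by
    refine (integrable_fun_norm_addHaar (volume : Measure E3)
      (f := fun y : ℝ => (y ^ 2 * (1 + y ^ 2))⁻¹)).2 ?_
    refine (integrable_inv_one_add_sq.integrableOn (s := Ioi 0)).congr_fun (fun y hy => ?_)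
      measurableSet_Ioi
    have hy' : y ≠ 0 := (mem_Ioi.1 hy).ne'
    simp only [finrank_euclideanSpace, Fintype.card_fin, smul_eq_mul]
    field_simp
  exact h

/-- The factor (1+|x+y|²)² is at most 8((1+|x|²)² + (1+|y|²)²), which cancels the decay of one of
the two weights at a time. The remaining 1/(|x||y|(1+|y|²)²) is split by the arithmetic–geometric
mean into functions integrable in a single variable. -/
theorem wt_mul_wt_le (x y : E3) : (1 + ‖x + y‖ ^ 2) ^ 2 * (wt x * wt y) ≤ 16 * (rad x + rad y) := by
  have key : ∀ a b : ℝ, 0 < a → 0 < b →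
      (a * b * (1 + b ^ 2) ^ 2)⁻¹ ≤ (a ^ 2 * (1 + a ^ 2))⁻¹ + (b ^ 2 * (1 + b ^ 2))⁻¹ := by
    intro a b ha hb
    have h1 : (a * b)⁻¹ ≤ ((a ^ 2)⁻¹ + (b ^ 2)⁻¹) / 2 := by
      have := two_mul_le_add_sq a⁻¹ b⁻¹
      rw [mul_inv, ← inv_pow, ← inv_pow]
      linarith
    have h2 : (b ^ 2 * (1 + b ^ 2) ^ 2)⁻¹ ≤ (b ^ 2 * (1 + b ^ 2))⁻¹ := by
      gcongr
      exact le_self_pow₀ (by nlinarith [sq_nonneg b]) two_ne_zero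
    have h3 : (a ^ 2 * (1 + b ^ 2) ^ 2)⁻¹ ≤ 2 * (a ^ 2 * (1 + a ^ 2))⁻¹ + (b ^ 2 * (1 + b ^ 2))⁻¹ := by
      rcases le_total a 1 with h | h
      · have : (a ^ 2 * (1 + b ^ 2) ^ 2)⁻¹ ≤ 2 * (a ^ 2 * (1 + a ^ 2))⁻¹ := by
          rw [mul_inv, mul_inv, mul_left_comm]
          gcongr
          calc ((1 + b ^ 2) ^ 2)⁻¹ ≤ 1 := inv_le_one_of_one_le₀ (one_le_pow₀ (by nlinarith [sq_nonneg b]))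
            _ = 2 * 2⁻¹ := by norm_num
            _ ≤ 2 * (1 + a ^ 2)⁻¹ := by gcongr; nlinarith
        have : 0 ≤ (b ^ 2 * (1 + b ^ 2))⁻¹ := by positivity
        linarith
      · have : (a ^ 2 * (1 + b ^ 2) ^ 2)⁻¹ ≤ (b ^ 2 * (1 + b ^ 2))⁻¹ := by
          refine inv_anti₀ (by positivity) ?_
          have : 1 ≤ a ^ 2 := by nlinarith
          nlinarith [sq_nonneg b, mul_nonneg (sub_nonneg.2 this) (sq_nonneg (1 + b ^ 2))]
        have : 0 ≤ (a ^ 2 * (1 + a ^ 2))⁻¹ := by positivity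
        linarith
    have h4 : (a * b * (1 + b ^ 2) ^ 2)⁻¹ ≤
        ((a ^ 2 * (1 + b ^ 2) ^ 2)⁻¹ + (b ^ 2 * (1 + b ^ 2) ^ 2)⁻¹) / 2 := by
      rw [mul_inv, mul_inv (a ^ 2), mul_inv (b ^ 2), ← add_mul, mul_div_right_comm]
      gcongr
    linarith
  rcases eq_or_ne x 0 with rfl | hx
  · have : wt 0 = 0 := by simp [wt]
    rw [this]
    have := rad_nonneg (0 : E3); have := rad_nonneg y
    simp only [zero_mul, mul_zero]; linarith
  rcases eq_or_ne y 0 with rfl | hy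
  · have : wt 0 = 0 := by simp [wt]
    rw [this]
    have := rad_nonneg (0 : E3); have := rad_nonneg x
    simp only [mul_zero]; linarith
  have ha := norm_pos_iff.2 hx
  have hb := norm_pos_iff.2 hy
  have hz := norm_add_le x y
  have hz0 := norm_nonneg (x + y)
  unfold wt rad
  set a := ‖x‖
  set b := ‖y‖
  have h1 : (1 + ‖x + y‖ ^ 2) ^ 2 ≤ 8 * ((1 + a ^ 2) ^ 2 + (1 + b ^ 2) ^ 2) := by
    have : ‖x + y‖ ^ 2 ≤ 2 * a ^ 2 + 2 * b ^ 2 := by nlinarith [sq_nonneg (a - b)]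
    have h3 : 1 + ‖x + y‖ ^ 2 ≤ 2 * ((1 + a ^ 2) + (1 + b ^ 2)) := by linarith
    calc _ ≤ (2 * ((1 + a ^ 2) + (1 + b ^ 2))) ^ 2 := by gcongr
      _ ≤ _ := by nlinarith [sq_nonneg ((1 + a ^ 2) - (1 + b ^ 2))]
  calc _ ≤ 8 * ((1 + a ^ 2) ^ 2 + (1 + b ^ 2) ^ 2) *
        ((a * (1 + a ^ 2) ^ 2)⁻¹ * (b * (1 + b ^ 2) ^ 2)⁻¹) := by gcongr
    _ = 8 * ((a * b * (1 + b ^ 2) ^ 2)⁻¹ + (b * a * (1 + a ^ 2) ^ 2)⁻¹) := by field_simp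
    _ ≤ _ := by linarith [key a b ha hb, key b a hb ha]

/-- The constant of the convolution estimate `norm_conv_le_wt`. -/
def wtConst : ℝ := 32 * ∫ ξ, rad ξ

theorem wtConst_nonneg : 0 ≤ wtConst :=
  mul_nonneg (by norm_num) (integral_nonneg rad_nonneg)

theorem integrable_rad_sub (ξ : E3) : Integrable fun η => rad (ξ - η) :=
  integrable_rad.comp_sub_left ξ

theorem wt_sub_mul_wt_le (ξ η : E3) :
    wt (ξ - η) * wt η ≤ ((1 + ‖ξ‖ ^ 2) ^ 2)⁻¹ * (16 * (rad (ξ - η) + rad η)) := by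
  have h := wt_mul_wt_le (ξ - η) η
  rw [sub_add_cancel] at h
  rw [inv_mul_eq_div, le_div_iff₀ (by positivity), mul_comm]
  exact h

theorem integrable_wt_conv (ξ : E3) : Integrable fun η => wt (ξ - η) * wt η := by
  refine Integrable.mono' ((((integrable_rad_sub ξ).add integrable_rad).const_mul 16).const_mul
    ((1 + ‖ξ‖ ^ 2) ^ 2)⁻¹) ?_ (Eventually.of_forall fun η => ?_)
  · exact ((measurable_wt.comp (measurable_const.sub measurable_id)).mul
      measurable_wt).aestronglyMeasurable
  · rw [Real.norm_eq_abs, abs_of_nonneg (mul_nonneg (wt_nonneg _) (wt_nonneg _))]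
    exact wt_sub_mul_wt_le ξ η

theorem integral_wt_conv_le (ξ : E3) :
    ∫ η, wt (ξ - η) * wt η ≤ wtConst * ((1 + ‖ξ‖ ^ 2) ^ 2)⁻¹ := by
  calc _ ≤ ∫ η, ((1 + ‖ξ‖ ^ 2) ^ 2)⁻¹ * (16 * (rad (ξ - η) + rad η)) :=
        integral_mono (integrable_wt_conv ξ) ((((integrable_rad_sub ξ).add
          integrable_rad).const_mul 16).const_mul _) (wt_sub_mul_wt_le ξ)
    _ = _ := by
        rw [integral_const_mul, integral_const_mul,
          integral_add (integrable_rad_sub ξ) integrable_rad,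
          integral_sub_left_eq_self (fun η => rad η) volume ξ]
        unfold wtConst; ring

theorem norm_mul_le_wt {f g : E3 → ℂ} {M N : ℝ} (hf : ∀ ξ, ‖f ξ‖ ≤ M * wt ξ)
    (hg : ∀ ξ, ‖g ξ‖ ≤ N * wt ξ) (ξ η : E3) : ‖f (ξ - η) * g η‖ ≤ M * N * (wt (ξ - η) * wt η) := by
  rw [norm_mul]
  calc _ ≤ (M * wt (ξ - η)) * (N * wt η) :=
        mul_le_mul (hf _) (hg _) (norm_nonneg _) ((norm_nonneg _).trans (hf _))
    _ = _ := by ring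

theorem norm_conv_le_wt {f g : E3 → ℂ} {M N : ℝ} (hM : 0 ≤ M) (hN : 0 ≤ N)
    (hf : ∀ ξ, ‖f ξ‖ ≤ M * wt ξ) (hg : ∀ ξ, ‖g ξ‖ ≤ N * wt ξ) (ξ : E3) :
    ‖conv f g ξ‖ ≤ M * N * (wtConst * ((1 + ‖ξ‖ ^ 2) ^ 2)⁻¹) := by
  calc _ ≤ ∫ η, M * N * (wt (ξ - η) * wt η) :=
        norm_integral_le_of_norm_le ((integrable_wt_conv ξ).const_mul _)
          (Eventually.of_forall fun η => norm_mul_le_wt hf hg ξ η)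
    _ ≤ _ := by
        rw [integral_const_mul]
        gcongr
        exact integral_wt_conv_le ξ

theorem integrable_conv_of_wt {f g : E3 → ℂ} {M N : ℝ} (hfm : Measurable f) (hgm : Measurable g)
    (hf : ∀ ξ, ‖f ξ‖ ≤ M * wt ξ) (hg : ∀ ξ, ‖g ξ‖ ≤ N * wt ξ) (ξ : E3) :
    Integrable fun η => f (ξ - η) * g η := by
  refine Integrable.mono' ((integrable_wt_conv ξ).const_mul (M * N)) ?_
    (Eventually.of_forall fun η => norm_mul_le_wt hf hg ξ η)
  exact ((hfm.comp (measurable_const.sub measurable_id)).mul hgm).aestronglyMeasurable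

/-- The quadratic term divided by `2π|ξ|`, in terms of bounds on the convolutions. -/
theorem norm_nonlin_le_of_conv {a b : Fin 3 → E3 → ℂ} {ξ : E3} {K : ℝ}
    (h : ∀ m k, ‖conv (a m) (b k) ξ‖ ≤ K) (l : Fin 3) :
    ‖nonlin a b l ξ‖ ≤ 36 * Real.pi * ‖ξ‖ * K := by
  refine (norm_nonlin_le _ _ _ _).trans ?_
  calc _ ≤ 2 * Real.pi * ‖ξ‖ * (2 * ∑ _k : Fin 3, ∑ _m : Fin 3, K) := by
        gcongr with k _ m _
        exact h _ _
    _ = _ := by simp; ring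

theorem norm_nonlin_le_wt {a b : Fin 3 → E3 → ℂ} {M N : ℝ} (hM : 0 ≤ M) (hN : 0 ≤ N)
    (ha : ∀ m ξ, ‖a m ξ‖ ≤ M * wt ξ) (hb : ∀ m ξ, ‖b m ξ‖ ≤ N * wt ξ) (l : Fin 3) (ξ : E3) :
    ‖nonlin a b l ξ‖ ≤ 36 * Real.pi * wtConst * M * N * (‖ξ‖ * ((1 + ‖ξ‖ ^ 2) ^ 2)⁻¹) := by
  refine (norm_nonlin_le_of_conv (fun m k => norm_conv_le_wt hM hN (ha m) (hb k) ξ) l).trans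
    (le_of_eq ?_)
  ring

theorem norm_nonlin_sub_le_wt {a b : Fin 3 → E3 → ℂ} {M D : ℝ} (hM : 0 ≤ M) (hD : 0 ≤ D)
    (ham : ∀ m, Measurable (a m)) (hbm : ∀ m, Measurable (b m))
    (ha : ∀ m ξ, ‖a m ξ‖ ≤ M * wt ξ) (hb : ∀ m ξ, ‖b m ξ‖ ≤ M * wt ξ)
    (hd : ∀ m ξ, ‖a m ξ - b m ξ‖ ≤ D * wt ξ) (l : Fin 3) (ξ : E3) :
    ‖nonlin a a l ξ - nonlin b b l ξ‖ ≤
      72 * Real.pi * wtConst * M * D * (‖ξ‖ * ((1 + ‖ξ‖ ^ 2) ^ 2)⁻¹) := by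
  have e : nonlin a a l ξ - nonlin b b l ξ =
      nonlin (fun m ξ => a m ξ - b m ξ) a l ξ + nonlin b (fun m ξ => a m ξ - b m ξ) l ξ := by
    unfold nonlin
    rw [← Finset.sum_sub_distrib, ← Finset.sum_add_distrib]
    refine Finset.sum_congr rfl fun k _ => ?_
    rw [← Finset.sum_sub_distrib, ← Finset.sum_add_distrib]
    refine Finset.sum_congr rfl fun m _ => ?_
    have h1 : conv (a m) (a k) ξ - conv (b m) (a k) ξ = conv (fun ξ => a m ξ - b m ξ) (a k) ξ := by
      unfold conv
      rw [← integral_sub (integrable_conv_of_wt (ham m) (ham k) (ha m) (ha k) ξ)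
        (integrable_conv_of_wt (hbm m) (ham k) (hb m) (ha k) ξ)]
      simp_rw [sub_mul]
    have h2 : conv (b m) (a k) ξ - conv (b m) (b k) ξ = conv (b m) (fun ξ => a k ξ - b k ξ) ξ := by
      unfold conv
      rw [← integral_sub (integrable_conv_of_wt (hbm m) (ham k) (hb m) (ha k) ξ)
        (integrable_conv_of_wt (hbm m) (hbm k) (hb m) (hb k) ξ)]
      simp_rw [mul_sub]
    rw [← h1, ← h2]; ring
  rw [e]
  have h := add_le_add (norm_nonlin_le_wt hD hM hd ha l ξ) (norm_nonlin_le_wt hM hD hb hd l ξ)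
  exact (norm_add_le _ _).trans (h.trans (le_of_eq (by ring)))

/-! ### Global solutions for small data on the Fourier side -/

/-- A path of vector fields on the Fourier side, pointwise continuous in time, which is controlled
by the weight `wt`. -/
structure WtPath (M : ℝ) (a : ℝ → Fin 3 → E3 → ℂ) : Prop where
  cont : ∀ l ξ, Continuous fun t => a t l ξ
  meas : ∀ t l, Measurable (a t l)
  bound : ∀ t l ξ, ‖a t l ξ‖ ≤ M * wt ξ

theorem WtPath.mono {M N : ℝ} {a : ℝ → Fin 3 → E3 → ℂ} (ha : WtPath M a) (h : M ≤ N) : WtPath N a :=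
  ⟨ha.cont, ha.meas, fun t l ξ => (ha.bound t l ξ).trans
    (mul_le_mul_of_nonneg_right h (wt_nonneg ξ))⟩

theorem WtPath.measurable_uncurry {M : ℝ} {a : ℝ → Fin 3 → E3 → ℂ} (ha : WtPath M a) (l : Fin 3) :
    Measurable fun p : ℝ × E3 => a p.1 l p.2 :=
  measurable_uncurry_of_continuous_of_measurable (u := fun t ξ => a t l ξ) (fun ξ => ha.cont l ξ)
    fun t => ha.meas t l

theorem WtPath.continuous_conv {M : ℝ} {a : ℝ → Fin 3 → E3 → ℂ} (ha : WtPath M a) (m k : Fin 3)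
    (ξ : E3) : Continuous fun s => conv (a s m) (a s k) ξ := by
  refine continuous_of_dominated (bound := fun η => M * M * (wt (ξ - η) * wt η)) (fun s => ?_)
    (fun s => Eventually.of_forall fun η => norm_mul_le_wt (ha.bound s m) (ha.bound s k) ξ η)
    ((integrable_wt_conv ξ).const_mul _)
    (Eventually.of_forall fun η => (ha.cont m _).mul (ha.cont k _))
  exact (integrable_conv_of_wt (ha.meas s m) (ha.meas s k) (ha.bound s m) (ha.bound s k)
    ξ).aestronglyMeasurable

theorem WtPath.continuous_nonlin {M : ℝ} {a : ℝ → Fin 3 → E3 → ℂ} (ha : WtPath M a) (l : Fin 3)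
    (ξ : E3) : Continuous fun s => nonlin (a s) (a s) l ξ := by
  unfold nonlin
  exact continuous_finsetSum _ fun k _ => continuous_finsetSum _ fun m _ =>
    continuous_const.mul (continuous_const.mul (ha.continuous_conv m k ξ))

theorem WtPath.measurable_nonlin {M : ℝ} {a : ℝ → Fin 3 → E3 → ℂ} (ha : WtPath M a) (l : Fin 3) :
    Measurable fun p : ℝ × E3 => nonlin (a p.1) (a p.1) l p.2 := by
  have hc : ∀ m k, Measurable fun p : ℝ × E3 => conv (a p.1 m) (a p.1 k) p.2 := by
    intro m k
    have h : Measurable fun q : (ℝ × E3) × E3 => a q.1.1 m (q.1.2 - q.2) * a q.1.1 k q.2 := by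
      refine Measurable.mul ?_ ?_
      · exact (ha.measurable_uncurry m).comp
          ((measurable_fst.fst).prodMk ((measurable_fst.snd).sub measurable_snd))
      · exact (ha.measurable_uncurry k).comp ((measurable_fst.fst).prodMk measurable_snd)
    exact (h.stronglyMeasurable.integral_prod_right').measurable
  unfold nonlin
  refine Finset.measurable_sum _ fun k _ => Finset.measurable_sum _ fun m _ => Measurable.mul ?_
    (Measurable.mul ?_ (hc m k))
  · exact (hasTemperateGrowth_derivSymbol m).1.continuous.measurable.comp measurable_snd
  · exact (measurable_leraySymbol l k).comp measurable_snd

/-- The right hand side of Duhamel's formula on the Fourier side. -/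
def duhamel (a₀ : Fin 3 → E3 → ℂ) (a : ℝ → Fin 3 → E3 → ℂ) (t : ℝ) (l : Fin 3) (ξ : E3) : ℂ :=
  (gauss (max t 0) ξ : ℂ) *
    (a₀ l ξ - ∫ s in 0..max t 0, (gauss (-s) ξ : ℂ) * nonlin (a s) (a s) l ξ)

theorem gauss_mul_neg (t : ℝ) (ξ : E3) : gauss t ξ * gauss (-t) ξ = 1 := by
  rw [← gauss_add, add_neg_cancel, gauss_zero]

theorem continuous_gauss_neg (ξ : E3) : Continuous fun s => (gauss (-s) ξ : ℂ) :=
  Complex.continuous_ofReal.comp ((continuous_gauss_time ξ).comp continuous_neg)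

/-- The Gaussian integrates in time to at most 1/(4π²|ξ|²), and |ξ|(1+|ξ|²)⁻² divided by |ξ|² is `wt
ξ`. Thus the bound of `norm_nonlin_le_wt` leads back to the same weight, which explains the choice
of `wt`. -/
theorem norm_duhamel_term_le {n : ℝ → ℂ} {ξ : E3} {N t : ℝ} (hN : 0 ≤ N) (ht : 0 ≤ t)
    (h : ∀ s, ‖n s‖ ≤ N * (‖ξ‖ * ((1 + ‖ξ‖ ^ 2) ^ 2)⁻¹)) :
    ‖(gauss t ξ : ℂ) * ∫ s in 0..t, (gauss (-s) ξ : ℂ) * n s‖ ≤ N / (4 * Real.pi ^ 2) * wt ξ := by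
  rcases eq_or_ne ξ 0 with rfl | hξ
  · have h0 : ∀ s, n s = 0 := fun s => by simpa using h s
    have := wt_nonneg (0 : E3)
    simp only [h0, mul_zero, intervalIntegral.integral_zero, norm_zero]
    positivity
  have hx := norm_pos_iff.2 hξ
  set c : ℝ := 4 * Real.pi ^ 2 * ‖ξ‖ ^ 2 with hc
  have hc0 : 0 < c := by positivity
  set B : ℝ := N * (‖ξ‖ * ((1 + ‖ξ‖ ^ 2) ^ 2)⁻¹) with hB
  have hB0 : 0 ≤ B := by positivity
  have hcont : Continuous fun s => gauss (-s) ξ := (continuous_gauss_time ξ).comp continuous_neg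
  have h1 : ∫ s in 0..t, gauss (-s) ξ * B = (gauss (-t) ξ - 1) / c * B := by
    rw [intervalIntegral.integral_mul_const, intervalIntegral.integral_eq_sub_of_hasDerivAt
      (f := fun s => gauss (-s) ξ / c) (fun s _ => ?_) (hcont.intervalIntegrable _ _)]
    · simp only [neg_zero, gauss_zero]; ring
    · have := ((hasDerivAt_gauss (-s) ξ).comp s (hasDerivAt_neg s)).div_const c
      refine this.congr_deriv ?_
      rw [← hc]; field_simp
  rw [norm_mul, Complex.norm_real, Real.norm_eq_abs, abs_of_pos (gauss_pos _ _)]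
  have h2 : ‖∫ s in 0..t, (gauss (-s) ξ : ℂ) * n s‖ ≤ ∫ s in 0..t, gauss (-s) ξ * B := by
    refine intervalIntegral.norm_integral_le_of_norm_le ht
      (Eventually.of_forall fun s _ => ?_) ((hcont.mul continuous_const).intervalIntegrable _ _)
    rw [norm_mul, Complex.norm_real, Real.norm_eq_abs, abs_of_pos (gauss_pos _ _)]
    exact mul_le_mul_of_nonneg_left (h s) (gauss_pos _ _).le
  have h3 := gauss_mul_neg t ξ
  have hg := gauss_pos t ξ
  calc _ ≤ gauss t ξ * ((gauss (-t) ξ - 1) / c * B) := by rw [← h1]; gcongr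
    _ = (1 - gauss t ξ) / c * B := by
        linear_combination (B / c) * h3
    _ ≤ 1 / c * B := by gcongr; linarith
    _ = _ := by rw [hc, hB]; unfold wt; field_simp

theorem WtPath.intervalIntegrable {M : ℝ} {a : ℝ → Fin 3 → E3 → ℂ} (ha : WtPath M a) (l : Fin 3)
    (ξ : E3) (x y : ℝ) :
    IntervalIntegrable (fun s => (gauss (-s) ξ : ℂ) * nonlin (a s) (a s) l ξ) volume x y :=
  ((continuous_gauss_neg ξ).mul (ha.continuous_nonlin l ξ)).intervalIntegrable _ _

theorem nine_div_pi_le : 36 * Real.pi / (4 * Real.pi ^ 2) ≤ 3 := by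
  have := Real.pi_gt_three
  rw [div_le_iff₀ (by positivity)]
  nlinarith

theorem measurable_comp_swap {F : ℝ × E3 → ℂ} (h : Measurable F) :
    Measurable fun q : E3 × ℝ => F (q.2, q.1) :=
  h.comp (measurable_snd.prodMk measurable_fst)

/-- The constant 3 bounds 36π/(4π²) = 9/π. The use of `max t 0` extends the path by its initial
value to negative times, so continuity holds on the whole line. -/
theorem WtPath.duhamel {M ε : ℝ} {a : ℝ → Fin 3 → E3 → ℂ} {a₀ : Fin 3 → E3 → ℂ} (ha : WtPath M a)
    (hM : 0 ≤ M) (h₀m : ∀ l, Measurable (a₀ l)) (h₀ : ∀ l ξ, ‖a₀ l ξ‖ ≤ ε * wt ξ) :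
    WtPath (ε + 3 * wtConst * M ^ 2) (duhamel a₀ a) where
  cont l ξ := by
    have hmax : Continuous fun t : ℝ => max t 0 := by fun_prop
    refine Continuous.mul ?_ (continuous_const.sub ?_)
    · exact Complex.continuous_ofReal.comp ((continuous_gauss_time ξ).comp hmax)
    · exact (intervalIntegral.continuous_primitive (fun x y => ha.intervalIntegrable l ξ x y) 0).comp hmax
  meas t l := by
    refine Measurable.mul ?_ ((h₀m l).sub ?_)
    · exact (Complex.continuous_ofReal.comp (continuous_gauss _)).measurable
    · simp_rw [intervalIntegral.integral_of_le (le_max_right t 0)]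
      have h1 := measurable_comp_swap (ha.measurable_nonlin l)
      have h2 : Measurable fun q : E3 × ℝ => (gauss (-q.2) q.1 : ℂ) := by
        refine (Complex.continuous_ofReal.comp ?_).measurable
        unfold gauss; fun_prop
      have h : Measurable fun q : E3 × ℝ =>
          (gauss (-q.2) q.1 : ℂ) * nonlin (a q.2) (a q.2) l q.1 := h2.mul h1
      exact (h.stronglyMeasurable.integral_prod_right').measurable
  bound t l ξ := by
    have ht := le_max_right t 0
    have hn : ∀ s, ‖nonlin (a s) (a s) l ξ‖ ≤
        36 * Real.pi * wtConst * M * M * (‖ξ‖ * ((1 + ‖ξ‖ ^ 2) ^ 2)⁻¹) := fun s =>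
      norm_nonlin_le_wt hM hM (ha.bound s) (ha.bound s) l ξ
    have hw := wtConst_nonneg
    have h1 := norm_duhamel_term_le (by positivity) ht hn
    unfold NSSymmetry.duhamel
    rw [mul_sub]
    refine (norm_sub_le _ _).trans ?_
    rw [add_mul]
    refine add_le_add ?_ (h1.trans ?_)
    · rw [norm_mul, Complex.norm_real, Real.norm_eq_abs, abs_of_pos (gauss_pos _ _)]
      exact (mul_le_of_le_one_left (norm_nonneg _) (gauss_le_one ht ξ)).trans (h₀ l ξ)
    · refine mul_le_mul_of_nonneg_right ?_ (wt_nonneg ξ)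
      have e : 36 * Real.pi * wtConst * M * M / (4 * Real.pi ^ 2) =
        36 * Real.pi / (4 * Real.pi ^ 2) * (wtConst * M ^ 2) := by ring
      rw [e, mul_assoc]
      exact mul_le_mul_of_nonneg_right nine_div_pi_le (by positivity)

theorem norm_duhamel_sub_le {M D : ℝ} {a b : ℝ → Fin 3 → E3 → ℂ} (a₀ : Fin 3 → E3 → ℂ)
    (ha : WtPath M a) (hb : WtPath M b) (hM : 0 ≤ M) (hD : 0 ≤ D)
    (h : ∀ t l ξ, ‖a t l ξ - b t l ξ‖ ≤ D * wt ξ) (t : ℝ) (l : Fin 3) (ξ : E3) :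
    ‖duhamel a₀ a t l ξ - duhamel a₀ b t l ξ‖ ≤ 6 * wtConst * M * D * wt ξ := by
  have ht := le_max_right t 0
  have hn : ∀ s, ‖nonlin (a s) (a s) l ξ - nonlin (b s) (b s) l ξ‖ ≤
      72 * Real.pi * wtConst * M * D * (‖ξ‖ * ((1 + ‖ξ‖ ^ 2) ^ 2)⁻¹) := fun s =>
    norm_nonlin_sub_le_wt hM hD (ha.meas s) (hb.meas s) (ha.bound s) (hb.bound s) (h s) l ξ
  have hw := wtConst_nonneg
  have h1 := norm_duhamel_term_le (by positivity) ht hn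
  have e : duhamel a₀ a t l ξ - duhamel a₀ b t l ξ = -((gauss (max t 0) ξ : ℂ) *
      ∫ s in 0..max t 0, (gauss (-s) ξ : ℂ) * (nonlin (a s) (a s) l ξ - nonlin (b s) (b s) l ξ)) := by
    unfold duhamel
    simp_rw [mul_sub (gauss (-_) ξ : ℂ)]
    rw [intervalIntegral.integral_sub (ha.intervalIntegrable l ξ _ _) (hb.intervalIntegrable l ξ _ _)]
    ring
  rw [e, norm_neg]
  refine h1.trans (mul_le_mul_of_nonneg_right ?_ (wt_nonneg ξ))
  have e : 72 * Real.pi * wtConst * M * D / (4 * Real.pi ^ 2) =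
    36 * Real.pi / (4 * Real.pi ^ 2) * (2 * wtConst * M * D) := by ring
  rw [e]
  calc _ ≤ 3 * (2 * wtConst * M * D) :=
        mul_le_mul_of_nonneg_right nine_div_pi_le (by positivity)
    _ = _ := by ring

/-- The Picard iterates. -/
def picard (a₀ : Fin 3 → E3 → ℂ) : ℕ → ℝ → Fin 3 → E3 → ℂ
  | 0 => fun _ _ _ => 0
  | n + 1 => duhamel a₀ (picard a₀ n)

/-- With C = `wtConst` and radius 2ε, the new bound is ε + 3C(2ε)² = ε(1 + 12Cε) ≤ 2ε. The
contraction factor 6C · 2ε in `norm_picard_sub_le` is at most 1/2 under the same smallness. -/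
theorem wtPath_picard {a₀ : Fin 3 → E3 → ℂ} {ε : ℝ} (hε : 0 ≤ ε)
    (hsmall : 24 * wtConst * ε ≤ 1) (h₀m : ∀ l, Measurable (a₀ l))
    (h₀ : ∀ l ξ, ‖a₀ l ξ‖ ≤ ε * wt ξ) (n : ℕ) : WtPath (2 * ε) (picard a₀ n) := by
  induction n with
  | zero => exact ⟨fun _ _ => continuous_const, fun _ _ => measurable_const, fun _ _ ξ => by
      have := wt_nonneg ξ
      simp only [picard, norm_zero]; positivity⟩
  | succ n ih =>
    refine (ih.duhamel (by positivity) h₀m h₀).mono ?_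
    nlinarith

theorem norm_picard_sub_le {a₀ : Fin 3 → E3 → ℂ} {ε : ℝ} (hε : 0 ≤ ε)
    (hsmall : 24 * wtConst * ε ≤ 1) (h₀m : ∀ l, Measurable (a₀ l))
    (h₀ : ∀ l ξ, ‖a₀ l ξ‖ ≤ ε * wt ξ) (n : ℕ) (t : ℝ) (l : Fin 3) (ξ : E3) :
    ‖picard a₀ (n + 1) t l ξ - picard a₀ n t l ξ‖ ≤ 2 * ε * (1 / 2) ^ n * wt ξ := by
  induction n generalizing t l ξ with
  | zero =>
    have := (wtPath_picard hε hsmall h₀m h₀ 1).bound t l ξ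
    simpa [picard] using this
  | succ n ih =>
    refine (norm_duhamel_sub_le a₀ (wtPath_picard hε hsmall h₀m h₀ (n + 1))
      (wtPath_picard hε hsmall h₀m h₀ n) (by positivity) (by positivity) ih t l ξ).trans ?_
    refine mul_le_mul_of_nonneg_right ?_ (wt_nonneg ξ)
    have h1 : 6 * wtConst * (2 * ε) ≤ 1 / 2 := by linarith
    calc _ ≤ 1 / 2 * (2 * ε * (1 / 2) ^ n) := by gcongr
      _ = _ := by rw [pow_succ]; ring

/-- The iterates converge geometrically at each frequency, uniformly in time, so the limit inherits
continuity in t, measurability in ξ and the bound; completeness of ℂ is enough. -/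
theorem exists_duhamel_fixedPoint {a₀ : Fin 3 → E3 → ℂ} {ε : ℝ} (hε : 0 ≤ ε)
    (hsmall : 24 * wtConst * ε ≤ 1) (h₀m : ∀ l, Measurable (a₀ l))
    (h₀ : ∀ l ξ, ‖a₀ l ξ‖ ≤ ε * wt ξ) :
    ∃ a, WtPath (2 * ε) a ∧ duhamel a₀ a = a := by
  have hP := wtPath_picard hε hsmall h₀m h₀
  have hd : ∀ t l ξ n, dist (picard a₀ n t l ξ) (picard a₀ (n + 1) t l ξ) ≤
      2 * ε * wt ξ * (1 / 2) ^ n := fun t l ξ n => by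
    rw [dist_comm, dist_eq_norm]
    exact (norm_picard_sub_le hε hsmall h₀m h₀ n t l ξ).trans (le_of_eq (by ring))
  have hlim : ∀ t l ξ, ∃ z, Tendsto (fun n => picard a₀ n t l ξ) atTop (𝓝 z) := fun t l ξ =>
    cauchySeq_tendsto_of_complete (cauchySeq_of_le_geometric (1 / 2) _ (by norm_num) (hd t l ξ))
  choose a ha using hlim
  have hdist : ∀ n t l ξ, ‖a t l ξ - picard a₀ n t l ξ‖ ≤ 4 * ε * (1 / 2) ^ n * wt ξ := by
    intro n t l ξ
    have := dist_le_of_le_geometric_of_tendsto (1 / 2) _ (by norm_num) (hd t l ξ) (ha t l ξ) n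
    rw [dist_comm, dist_eq_norm] at this
    exact this.trans (le_of_eq (by ring))
  have hgeo : ∀ c : ℝ, Tendsto (fun n : ℕ => 4 * ε * (1 / 2) ^ n * c) atTop (𝓝 0) := by
    intro c
    have := ((tendsto_pow_atTop_nhds_zero_of_lt_one (r := (1 / 2 : ℝ)) (by norm_num)
      (by norm_num)).const_mul (4 * ε)).mul_const c
    simpa using this
  have hA : WtPath (2 * ε) a :=
    { cont := fun l ξ => by
        have hu : TendstoUniformly (fun n t => picard a₀ n t l ξ) (fun t => a t l ξ) atTop := by
          rw [Metric.tendstoUniformly_iff]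
          intro r hr
          filter_upwards [(hgeo (wt ξ)).eventually_lt_const hr] with n hn t
          rw [dist_eq_norm]
          exact (hdist n t l ξ).trans_lt hn
        exact hu.continuous (Frequently.of_forall fun n => (hP n).cont l ξ)
      meas := fun t l => measurable_of_tendsto_metrizable (fun n => (hP n).meas t l)
        (tendsto_pi_nhds.2 fun ξ => ha t l ξ)
      bound := fun t l ξ => le_of_tendsto (ha t l ξ).norm
        (Eventually.of_forall fun n => (hP n).bound t l ξ) }
  refine ⟨a, hA, ?_⟩
  funext t l ξ
  have h1 : Tendsto (fun n => picard a₀ (n + 1) t l ξ) atTop (𝓝 (a t l ξ)) :=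
    (ha t l ξ).comp (tendsto_add_atTop_nat 1)
  refine tendsto_nhds_unique ?_ h1
  rw [tendsto_iff_norm_sub_tendsto_zero]
  refine squeeze_zero (fun _ => norm_nonneg _) (fun n => ?_)
    (hgeo (6 * wtConst * (2 * ε) * wt ξ))
  rw [norm_sub_rev]
  refine (norm_duhamel_sub_le a₀ hA (hP n) (by positivity) (by positivity) (hdist n) t l ξ).trans
    (le_of_eq ?_)
  ring

/-! ### From the Fourier side to strong solutions -/

theorem duhamel_zero (a₀ : Fin 3 → E3 → ℂ) (a : ℝ → Fin 3 → E3 → ℂ) (l : Fin 3) (ξ : E3) :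
    duhamel a₀ a 0 l ξ = a₀ l ξ := by
  simp [duhamel, gauss_zero]

theorem WtPath.hasDerivAt {M : ℝ} {a : ℝ → Fin 3 → E3 → ℂ} {a₀ : Fin 3 → E3 → ℂ}
    (ha : WtPath M a) (hfix : NSSymmetry.duhamel a₀ a = a) {t : ℝ} (ht : 0 < t) (l : Fin 3) (ξ : E3) :
    HasDerivAt (fun s => a s l ξ)
      (((-(4 * Real.pi ^ 2 * ‖ξ‖ ^ 2) : ℝ) : ℂ) * a t l ξ - nonlin (a t) (a t) l ξ) t := by
  set n : ℝ → ℂ := fun s => (gauss (-s) ξ : ℂ) * nonlin (a s) (a s) l ξ with hn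
  have hnc : Continuous n := (continuous_gauss_neg ξ).mul (ha.continuous_nonlin l ξ)
  have h1 : ∀ s, 0 < s → a s l ξ = (gauss s ξ : ℂ) * (a₀ l ξ - ∫ r in 0..s, n r) := by
    intro s hs
    conv_lhs => rw [← hfix]
    simp only [NSSymmetry.duhamel, max_eq_left hs.le, hn]
  have h2 : HasDerivAt (fun s => (gauss s ξ : ℂ) * (a₀ l ξ - ∫ r in 0..s, n r)) _ t :=
    (hasDerivAt_gauss t ξ).ofReal_comp.mul
      ((intervalIntegral.integral_hasDerivAt_right (hnc.intervalIntegrable 0 t)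
        (hnc.stronglyMeasurableAtFilter _ _) hnc.continuousAt).const_sub (a₀ l ξ))
  refine (h2.congr_of_eventuallyEq ?_).congr_deriv ?_
  · filter_upwards [Ioi_mem_nhds ht] with s hs using h1 s hs
  · rw [h1 t ht]
    have h3 : (gauss t ξ : ℂ) * (gauss (-t) ξ : ℂ) = 1 := by
      rw [← Complex.ofReal_mul, gauss_mul_neg, Complex.ofReal_one]
    simp only [hn]
    push_cast
    linear_combination (-nonlin (a t) (a t) l ξ) * h3

theorem sum_coord_mul_nonlin (a b : Fin 3 → E3 → ℂ) (ξ : E3) :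
    ∑ l, (ξ l : ℂ) * nonlin a b l ξ = 0 := by
  have h : ∀ k, ∑ l, (ξ l : ℂ) * leraySymbol l k ξ = 0 := by
    intro k
    rcases eq_or_ne ξ 0 with rfl | hξ
    · simp
    have h1 := sum_derivSymbol_mul_projSymbol k ξ
    have h2 : ∑ l, derivSymbol l ξ * projSymbol l k ξ =
        (2 * Real.pi * Complex.I * ((‖ξ‖ ^ 2 : ℝ) : ℂ)) * ∑ l, (ξ l : ℂ) * leraySymbol l k ξ := by
      rw [Finset.mul_sum]
      refine Finset.sum_congr rfl fun l _ => ?_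
      rw [projSymbol_eq]
      have : leraySymbol k l ξ = leraySymbol l k ξ := by
        unfold leraySymbol; simp only [eq_comm (a := k), mul_comm (ξ k)]
      rw [this]; unfold derivSymbol; ring
    rw [h2] at h1
    refine (mul_eq_zero.1 h1).resolve_left ?_
    simp [Real.pi_ne_zero, hξ]
  unfold nonlin
  simp_rw [Finset.mul_sum]
  rw [Finset.sum_comm]
  refine Finset.sum_eq_zero fun k _ => ?_
  rw [Finset.sum_comm]
  refine Finset.sum_eq_zero fun m _ => ?_
  calc _ = derivSymbol m ξ * conv (a m) (b k) ξ * ∑ l, (ξ l : ℂ) * leraySymbol l k ξ := by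
        rw [Finset.mul_sum]; exact Finset.sum_congr rfl fun l _ => by ring
    _ = 0 := by rw [h, mul_zero]

theorem WtPath.sum_coord_mul {M : ℝ} {a : ℝ → Fin 3 → E3 → ℂ} {a₀ : Fin 3 → E3 → ℂ}
    (ha : WtPath M a) (hfix : NSSymmetry.duhamel a₀ a = a) (h₀ : ∀ ξ : E3, ∑ l, (ξ l : ℂ) * a₀ l ξ = 0)
    (t : ℝ) (ξ : E3) : ∑ l, (ξ l : ℂ) * a t l ξ = 0 := by
  have h1 : ∑ l, (ξ l : ℂ) * ∫ s in 0..max t 0, (gauss (-s) ξ : ℂ) * nonlin (a s) (a s) l ξ = 0 := by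
    simp_rw [← intervalIntegral.integral_const_mul]
    rw [← intervalIntegral.integral_finsetSum
      fun l _ => (ha.intervalIntegrable l ξ _ _).const_mul _]
    have : ∀ s, ∑ l, (ξ l : ℂ) * ((gauss (-s) ξ : ℂ) * nonlin (a s) (a s) l ξ) = 0 := by
      intro s
      calc _ = (gauss (-s) ξ : ℂ) * ∑ l, (ξ l : ℂ) * nonlin (a s) (a s) l ξ := by
            rw [Finset.mul_sum]; exact Finset.sum_congr rfl fun l _ => by ring
        _ = 0 := by rw [sum_coord_mul_nonlin, mul_zero]
    simp_rw [this]
    simp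
  rw [← hfix]
  unfold NSSymmetry.duhamel
  calc _ = (gauss (max t 0) ξ : ℂ) * (∑ l, (ξ l : ℂ) * a₀ l ξ -
        ∑ l, (ξ l : ℂ) * ∫ s in 0..max t 0, (gauss (-s) ξ : ℂ) * nonlin (a s) (a s) l ξ) := by
        rw [← Finset.sum_sub_distrib, Finset.mul_sum]
        exact Finset.sum_congr rfl fun l _ => by ring
    _ = 0 := by rw [h₀, h1]; simp

/-- The Fourier transform of the pressure. -/
def pressureHat (a : Fin 3 → E3 → ℂ) (ξ : E3) : ℂ :=
  ∑ k, ∑ m, ((ξ m * ξ k / ‖ξ‖ ^ 2 : ℝ) : ℂ) * conv (a m) (a k) ξ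

/-- What the projection removes from the convection term is a gradient. Its potential is bounded in
ξ by `WtPath.memLp_pressureHat`, hence defines the tempered pressure of the momentum equation. -/
theorem nonlin_eq_sub_pressure (a : Fin 3 → E3 → ℂ) (l : Fin 3) (ξ : E3) :
    nonlin a a l ξ =
      ∑ m, derivSymbol m ξ * conv (a m) (a l) ξ - derivSymbol l ξ * pressureHat a ξ := by
  have h1 : ∑ m, derivSymbol m ξ * conv (a m) (a l) ξ =
      ∑ k, ∑ m, derivSymbol m ξ * (((if l = k then 1 else 0 : ℝ) : ℂ) * conv (a m) (a k) ξ) := by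
    rw [Finset.sum_comm]
    refine Finset.sum_congr rfl fun m _ => ?_
    rw [Finset.sum_eq_single l (fun k _ hk => by simp [Ne.symm hk]) (by simp)]
    simp
  unfold nonlin pressureHat
  rw [h1, Finset.mul_sum, ← Finset.sum_sub_distrib]
  refine Finset.sum_congr rfl fun k _ => ?_
  rw [Finset.mul_sum, ← Finset.sum_sub_distrib]
  refine Finset.sum_congr rfl fun m _ => ?_
  unfold leraySymbol derivSymbol
  push_cast; ring

/-- Paths bounded by the weight are therefore bounded in H² uniformly in time, which yields all
regularity required of a strong solution. -/
theorem wt_sq_le (ξ : E3) : (1 + ‖ξ‖ ^ 2) ^ 2 * wt ξ ^ 2 ≤ rad ξ := by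
  unfold wt rad
  rcases eq_or_ne ξ 0 with rfl | hξ
  · simp
  have := norm_pos_iff.2 hξ
  have e : (1 + ‖ξ‖ ^ 2) ^ 2 * (‖ξ‖ * (1 + ‖ξ‖ ^ 2) ^ 2)⁻¹ ^ 2 =
      (‖ξ‖ ^ 2 * (1 + ‖ξ‖ ^ 2) ^ 2)⁻¹ := by field_simp
  rw [e]
  gcongr
  exact le_self_pow₀ (by nlinarith [sq_nonneg ‖ξ‖]) two_ne_zero

theorem sobolev_weight_le {s : ℕ} (hs : s ≤ 2) (ξ : E3) : (1 + ‖ξ‖ ^ 2) ^ s * wt ξ ^ 2 ≤ rad ξ :=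
  (mul_le_mul_of_nonneg_right (pow_le_pow_right₀ (by nlinarith [sq_nonneg ‖ξ‖]) hs)
    (sq_nonneg _)).trans (wt_sq_le ξ)

theorem memLp_wt : MemLp wt 2 (volume : Measure E3) := by
  rw [memLp_two_iff_integrable_sq measurable_wt.aestronglyMeasurable]
  refine integrable_rad.mono' (measurable_wt.pow_const 2).aestronglyMeasurable
    (Eventually.of_forall fun ξ => ?_)
  rw [Real.norm_eq_abs, abs_of_nonneg (sq_nonneg _)]
  simpa using sobolev_weight_le (s := 0) (by norm_num) ξ

theorem WtPath.memLp {M : ℝ} {a : ℝ → Fin 3 → E3 → ℂ} (ha : WtPath M a) (t : ℝ) (l : Fin 3) :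
    MemLp (a t l) 2 volume :=
  (memLp_wt.const_mul M).mono' (ha.meas t l).aestronglyMeasurable
    (Eventually.of_forall fun ξ => ha.bound t l ξ)

/-- The path of vector fields with given Fourier transforms. -/
def WtPath.field {M : ℝ} {a : ℝ → Fin 3 → E3 → ℂ} (ha : WtPath M a) (t : ℝ) : VField :=
  fun l => 𝓕⁻ ((ha.memLp t l).toLp (a t l) : L2)

theorem WtPath.fourier_field {M : ℝ} {a : ℝ → Fin 3 → E3 → ℂ} (ha : WtPath M a) (t : ℝ)
    (l : Fin 3) : (𝓕 (ha.field t l) : L2) =ᵐ[volume] a t l := by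
  unfold WtPath.field
  rw [FourierTransform.fourier_fourierInv_eq]
  exact (ha.memLp t l).coeFn_toLp

theorem WtPath.continuous_field {M : ℝ} {a : ℝ → Fin 3 → E3 → ℂ} (ha : WtPath M a) :
    Continuous ha.field := by
  refine continuous_pi fun l => ?_
  have h : Continuous fun t => ((ha.memLp t l).toLp (a t l) : L2) := by
    rw [continuous_iff_continuousAt]
    intro t
    exact tendsto_L2_of_dominated (memLp_wt.const_mul M)
      (Eventually.of_forall fun s => (ha.memLp s l).coeFn_toLp) (ha.memLp t l).coeFn_toLp
      (Eventually.of_forall fun s ξ => ha.bound s l ξ) (ha.bound t l)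
      fun ξ => (ha.cont l ξ).tendsto t
  exact (Lp.fourierTransformₗᵢ E3 ℂ).symm.continuous.comp h

theorem WtPath.sobolevSq_field_le {M : ℝ} {a : ℝ → Fin 3 → E3 → ℂ} (ha : WtPath M a) {s : ℕ}
    (hs : s ≤ 2) (t : ℝ) (l : Fin 3) :
    sobolevSq s (ha.field t l) ≤ ENNReal.ofReal (∫ ξ, M ^ 2 * rad ξ) := by
  rw [ofReal_integral_eq_lintegral_ofReal (integrable_rad.const_mul _)
    (Eventually.of_forall fun ξ => mul_nonneg (sq_nonneg _) (rad_nonneg ξ))]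
  unfold sobolevSq
  refine lintegral_mono_ae ?_
  filter_upwards [ha.fourier_field t l] with ξ e
  rw [e, ← ofReal_norm, ← ENNReal.ofReal_pow (norm_nonneg _), ← ENNReal.ofReal_mul (by positivity)]
  refine ENNReal.ofReal_le_ofReal ?_
  calc _ ≤ (1 + ‖ξ‖ ^ 2) ^ s * (M * wt ξ) ^ 2 := by gcongr; exact ha.bound t l ξ
    _ = M ^ 2 * ((1 + ‖ξ‖ ^ 2) ^ s * wt ξ ^ 2) := by ring
    _ ≤ _ := by gcongr; exact sobolev_weight_le hs ξ

theorem norm_mul_inv_le_one (ξ : E3) : ‖ξ‖ * ((1 + ‖ξ‖ ^ 2) ^ 2)⁻¹ ≤ 1 := by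
  rw [← div_eq_mul_inv, div_le_one (by positivity)]
  nlinarith [sq_nonneg (‖ξ‖ - 1), sq_nonneg ‖ξ‖, norm_nonneg ξ, sq_nonneg (‖ξ‖ ^ 2)]

theorem sq_mul_wt_le_one (ξ : E3) : ‖ξ‖ ^ 2 * wt ξ ≤ 1 := by
  refine le_trans (le_of_eq ?_) (norm_mul_inv_le_one ξ)
  unfold wt
  rcases eq_or_ne ξ 0 with rfl | hξ
  · simp
  have := norm_pos_iff.2 hξ
  field_simp

theorem WtPath.memLp_pressureHat {M : ℝ} {a : ℝ → Fin 3 → E3 → ℂ} (ha : WtPath M a) (t : ℝ) :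
    MemLp (pressureHat (a t)) ⊤ volume := by
  unfold pressureHat
  refine memLp_finsetSum _ fun k _ => memLp_finsetSum _ fun m _ => ?_
  have h1 : MemLp (conv (a t m) (a t k)) ⊤ volume := by
    have e : conv (a t m) (a t k) = conv (hat (ha.field t) m) (hat (ha.field t) k) := funext fun ξ =>
      conv_congr (ha.fourier_field t m).symm (ha.fourier_field t k).symm ξ
    rw [e]
    exact memLp_top_of_bound (NSSymmetry.continuous_conv _ _).aestronglyMeasurable _
      (Eventually.of_forall fun ξ => norm_conv_le_L2 _ _ ξ)
  refine MemLp.mul' (p := ⊤) (q := ⊤) h1 ?_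
  refine memLp_top_of_bound (C := 1) ?_ (Eventually.of_forall fun ξ => ?_)
  · exact (by fun_prop : Measurable fun ξ : E3 =>
      ((ξ m * ξ k / ‖ξ‖ ^ 2 : ℝ) : ℂ)).aestronglyMeasurable
  · rw [Complex.norm_real, norm_div, norm_mul, norm_pow, norm_norm]
    refine div_le_one_of_le₀ ?_ (by positivity)
    rw [sq]
    exact mul_le_mul (PiLp.norm_apply_le ξ m) (PiLp.norm_apply_le ξ k)
      (norm_nonneg _) (norm_nonneg _)

theorem measurable_comp_prodMk {F : ℝ × E3 → ℂ} (h : Measurable F) (t : ℝ) :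
    Measurable fun ξ : E3 => F (t, ξ) :=
  h.comp measurable_prodMk_left

theorem WtPath.hasDerivAt_integral {M : ℝ} {a : ℝ → Fin 3 → E3 → ℂ} {a₀ : Fin 3 → E3 → ℂ}
    (ha : WtPath M a) (hM : 0 ≤ M) (hfix : NSSymmetry.duhamel a₀ a = a) {t : ℝ} (ht : 0 < t)
    (l : Fin 3) (ψ : 𝓢(E3, ℂ)) :
    HasDerivAt (fun s => ∫ ξ, ψ ξ * a s l ξ)
      (∫ ξ, ψ ξ * (((-(4 * Real.pi ^ 2 * ‖ξ‖ ^ 2) : ℝ) : ℂ) * a t l ξ -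
        nonlin (a t) (a t) l ξ)) t := by
  set K : ℝ := 4 * Real.pi ^ 2 * M + 36 * Real.pi * wtConst * M * M with hK
  have hm : ∀ s, AEStronglyMeasurable (fun ξ => ψ ξ * a s l ξ) volume := fun s =>
    (ψ.continuous.measurable.mul (ha.meas s l)).aestronglyMeasurable
  have hi : ∀ s, Integrable fun ξ => ψ ξ * a s l ξ := by
    intro s
    refine (integrable_schwartz_mul_L2 ψ (𝓕 (ha.field s l) : L2)).congr ?_
    filter_upwards [ha.fourier_field s l] with ξ e
    rw [e]
  refine (hasDerivAt_integral_of_dominated_loc_of_deriv_le (μ := volume) (𝕜 := ℝ)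
    (F := fun s ξ => ψ ξ * a s l ξ)
    (F' := fun s ξ => ψ ξ * (((-(4 * Real.pi ^ 2 * ‖ξ‖ ^ 2) : ℝ) : ℂ) * a s l ξ -
      nonlin (a s) (a s) l ξ)) (x₀ := t) (s := Ioi 0) (bound := fun ξ => ‖ψ ξ‖ * K)
    (Ioi_mem_nhds ht) (Eventually.of_forall hm) (hi t) ?_ ?_ (ψ.integrable.norm.mul_const K) ?_).2
  · have h1 : Measurable fun ξ => nonlin (a t) (a t) l ξ :=
      measurable_comp_prodMk (ha.measurable_nonlin l) t
    have h2 : Measurable fun ξ : E3 => ((-(4 * Real.pi ^ 2 * ‖ξ‖ ^ 2) : ℝ) : ℂ) := by fun_prop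
    exact (ψ.continuous.measurable.mul ((h2.mul (ha.meas t l)).sub h1)).aestronglyMeasurable
  · refine Eventually.of_forall fun ξ s _ => ?_
    rw [norm_mul]
    refine mul_le_mul_of_nonneg_left ((norm_sub_le _ _).trans <| add_le_add ?_ ?_) (norm_nonneg _)
    · rw [norm_mul, Complex.norm_real, norm_neg, Real.norm_eq_abs, abs_of_nonneg (by positivity)]
      calc _ ≤ 4 * Real.pi ^ 2 * ‖ξ‖ ^ 2 * (M * wt ξ) := by gcongr; exact ha.bound s l ξ
        _ = 4 * Real.pi ^ 2 * M * (‖ξ‖ ^ 2 * wt ξ) := by ring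
        _ ≤ _ := mul_le_of_le_one_right (by positivity) (sq_mul_wt_le_one ξ)
    · have hw := wtConst_nonneg
      exact (norm_nonlin_le_wt hM hM (ha.bound s) (ha.bound s) l ξ).trans
        (mul_le_of_le_one_right (by positivity) (norm_mul_inv_le_one ξ))
  · exact Eventually.of_forall fun ξ s hs => (ha.hasDerivAt hfix hs l ξ).const_mul (ψ ξ)

theorem WtPath.isStrongSolution {M : ℝ} {a : ℝ → Fin 3 → E3 → ℂ} {a₀ : Fin 3 → E3 → ℂ}
    (ha : WtPath M a) (hM : 0 ≤ M) (hfix : NSSymmetry.duhamel a₀ a = a)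
    (h₀ : ∀ ξ : E3, ∑ l, (ξ l : ℂ) * a₀ l ξ = 0) : IsStrongSolution (ha.field 0) ha.field where
  initial := rfl
  continuousOn := ha.continuous_field.continuousOn
  bounded_H1 T := ⟨(ENNReal.ofReal (∫ ξ, M ^ 2 * rad ξ)).toNNReal, fun t _ l => by
    rw [ENNReal.coe_toNNReal ENNReal.ofReal_ne_top]
    exact ha.sobolevSq_field_le (by norm_num) t l⟩
  integrable_H2 T l := by
    refine (lintegral_mono fun t => ha.sobolevSq_field_le le_rfl t l).trans_lt ?_
    rw [lintegral_const, Measure.restrict_apply MeasurableSet.univ, univ_inter, Real.volume_Icc]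
    exact ENNReal.mul_lt_top ENNReal.ofReal_lt_top ENNReal.ofReal_lt_top
  divergence_free t _ := by
    rw [divergence_eq_zero_iff]
    filter_upwards [ae_all_iff.2 fun l => ha.fourier_field t l] with ξ e
    simp_rw [e]
    exact ha.sum_coord_mul hfix h₀ t ξ
  momentum t ht := by
    have hpm := ha.memLp_pressureHat t
    refine ⟨𝓕⁻ (Lp.toTemperedDistribution (hpm.toLp _) : 𝓢'(E3, ℂ)), fun l φ => ?_⟩
    obtain ⟨ψ, rfl⟩ : ∃ ψ : 𝓢(E3, ℂ), 𝓕 ψ = φ := ⟨𝓕⁻ φ, FourierTransform.fourier_fourierInv_eq φ⟩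
    have hint : ∀ s (f : E3 → ℂ), ∫ ξ, f ξ * (𝓕 (ha.field s l) : L2) ξ = ∫ ξ, f ξ * a s l ξ := by
      intro s f
      refine integral_congr_ae ?_
      filter_upwards [ha.fourier_field s l] with ξ e
      rw [e]
    refine ((ha.hasDerivAt_integral hM hfix ht l ψ).congr_of_eventuallyEq
      (Eventually.of_forall fun s => ?_)).congr_deriv ?_
    · rw [distr_fourier_apply, hint]
    · have hg : (fun ξ : E3 => ((-(4 * Real.pi ^ 2 * ‖ξ‖ ^ 2) : ℝ) : ℂ)).HasTemperateGrowth := by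
        fun_prop
      have hconv : ∀ m k ξ, conv (hat (ha.field t) m) (hat (ha.field t) k) ξ =
          conv (a t m) (a t k) ξ := fun m k ξ =>
        conv_congr (ha.fourier_field t m) (ha.fourier_field t k) ξ
      have e1 : (Δ (distr (ha.field t l))) (𝓕 ψ) =
          ∫ ξ, (((-(4 * Real.pi ^ 2 * ‖ξ‖ ^ 2) : ℝ) : ℂ) * ψ ξ) * a t l ξ := by
        rw [laplacian_fourier_test, fourier_distr_apply, hint]
        simp only [SchwartzMap.smulLeftCLM_apply_apply hg, smul_eq_mul]
      have e2 : convection (ha.field t) (ha.field t) l (𝓕 ψ) =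
          ∫ ξ, ψ ξ * ∑ m, derivSymbol m ξ * conv (a t m) (a t l) ξ := by
        rw [convection_fourier_test]
        simp_rw [hconv]
      have e3 : (∂_{basisVec l} (𝓕⁻ (Lp.toTemperedDistribution (hpm.toLp _) : 𝓢'(E3, ℂ)))) (𝓕 ψ) =
          ∫ ξ, (derivSymbol l ξ * ψ ξ) * pressureHat (a t) ξ := by
        rw [lineDeriv_fourier_test, FourierTransform.fourier_fourierInv_eq,
          Lp.toTemperedDistribution_apply]
        refine integral_congr_ae ?_
        filter_upwards [hpm.coeFn_toLp] with ξ e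
        rw [e]
        simp only [SchwartzMap.smulLeftCLM_apply_apply (hasTemperateGrowth_derivSymbol l), smul_eq_mul]
      have i1 : Integrable fun ξ => (((-(4 * Real.pi ^ 2 * ‖ξ‖ ^ 2) : ℝ) : ℂ) * ψ ξ) * a t l ξ := by
        refine (integrable_schwartz_mul_L2 (SchwartzMap.smulLeftCLM ℂ
          (fun ξ : E3 => ((-(4 * Real.pi ^ 2 * ‖ξ‖ ^ 2) : ℝ) : ℂ)) ψ)
          (𝓕 (ha.field t l) : L2)).congr ?_
        filter_upwards [ha.fourier_field t l] with ξ e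
        rw [e]
        simp only [SchwartzMap.smulLeftCLM_apply_apply hg, smul_eq_mul]
      have i2 : Integrable fun ξ => ψ ξ * ∑ m, derivSymbol m ξ * conv (a t m) (a t l) ξ := by
        simp_rw [Finset.mul_sum, ← hconv]
        exact integrable_finsetSum _ fun m _ => integrable_schwartz_mul_conv ψ _ _ m
      have i3 : Integrable fun ξ => (derivSymbol l ξ * ψ ξ) * pressureHat (a t) ξ := by
        refine (integrable_schwartz_mul_of_memLp_top
          (SchwartzMap.smulLeftCLM ℂ (derivSymbol l) ψ) hpm).congr (Eventually.of_forall fun ξ => ?_)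
        simp only [SchwartzMap.smulLeftCLM_apply_apply (hasTemperateGrowth_derivSymbol l), smul_eq_mul]
      have e4 : (Δ (distr (ha.field t l)) - convection (ha.field t) (ha.field t) l +
          ∂_{basisVec l} (𝓕⁻ (Lp.toTemperedDistribution (hpm.toLp _) : 𝓢'(E3, ℂ)))) (𝓕 ψ) =
          (Δ (distr (ha.field t l))) (𝓕 ψ) - convection (ha.field t) (ha.field t) l (𝓕 ψ) +
          (∂_{basisVec l} (𝓕⁻ (Lp.toTemperedDistribution (hpm.toLp _) : 𝓢'(E3, ℂ)))) (𝓕 ψ) := rfl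
      have i12 : Integrable fun ξ => (((-(4 * Real.pi ^ 2 * ‖ξ‖ ^ 2) : ℝ) : ℂ) * ψ ξ) * a t l ξ -
          ψ ξ * ∑ m, derivSymbol m ξ * conv (a t m) (a t l) ξ := i1.sub i2
      rw [e4, e1, e2, e3, ← integral_sub i1 i2, ← integral_add i12 i3]
      refine integral_congr_ae (Eventually.of_forall fun ξ => ?_)
      simp only [nonlin_eq_sub_pressure]
      ring

/-- Small data, measured by the weight `wt`, lead to global strong solutions. -/
theorem exists_isStrongSolution {a₀ : Fin 3 → E3 → ℂ} {ε : ℝ} (hε : 0 ≤ ε)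
    (hsmall : 24 * wtConst * ε ≤ 1) (h₀m : ∀ l, Measurable (a₀ l))
    (h₀ : ∀ l ξ, ‖a₀ l ξ‖ ≤ ε * wt ξ) (hdiv : ∀ ξ : E3, ∑ l, (ξ l : ℂ) * a₀ l ξ = 0) :
    ∃ (u₀ : VField) (u : ℝ → VField), IsStrongSolution u₀ u ∧
      ∀ l, (𝓕 (u₀ l) : L2) =ᵐ[volume] a₀ l := by
  obtain ⟨a, ha, hfix⟩ := exists_duhamel_fixedPoint hε hsmall h₀m h₀
  refine ⟨_, _, ha.isStrongSolution (by positivity) hfix hdiv, fun l => ?_⟩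
  have : a 0 l = a₀ l := by
    conv_lhs => rw [← hfix]
    exact funext fun ξ => duhamel_zero a₀ a l ξ
  rw [← this]
  exact ha.fourier_field 0 l

/-! ### Initial values of matched type -/

/-- A divergence free polynomial vector field with the parities of the coordinates. -/
def pol (μ : ℝ) (l : Fin 3) (ξ : E3) : ℝ :=
  ![ξ 0 * ξ 1 ^ 2, ξ 1 * (-ξ 0 ^ 2 + μ * ξ 2 ^ 2), -μ * (ξ 2 * ξ 1 ^ 2)] l

/-- The monomial `ξ^b`. -/
def mono (b : Parity) (ξ : E3) : ℝ := ∏ j, ξ j ^ (b j).val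

/-- The degree of the monomial `ξ^b`. -/
def deg (b : Parity) : ℕ := ∑ j, (b j).val

/-- The factor `i (1 + δ i^{1+|b|} ξ^b)`. -/
def kap (δ : ℝ) (b : Parity) (ξ : E3) : ℂ :=
  Complex.I * (1 + δ * Complex.I ^ (1 + deg b) * (mono b ξ : ℂ))

/-- A positive radial weight. -/
def weight (c : ℝ) (ξ : E3) : ℝ := c * ((1 + ‖ξ‖ ^ 2) ^ 8)⁻¹

/-- The Fourier transform of the initial value. -/
def datum (c μ δ : ℝ) (b : Parity) (l : Fin 3) (ξ : E3) : ℂ :=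
  ((weight c ξ * pol μ l ξ : ℝ) : ℂ) * kap δ b ξ

theorem continuous_pol (μ : ℝ) (l : Fin 3) : Continuous (pol μ l) := by
  unfold pol
  fin_cases l <;> simp <;> fun_prop

theorem continuous_mono (b : Parity) : Continuous (mono b) := by
  unfold mono
  exact continuous_finsetProd _ fun j _ => by fun_prop

theorem continuous_weight (c : ℝ) : Continuous (weight c) := by
  unfold weight
  exact continuous_const.mul (Continuous.inv₀ (by fun_prop) fun ξ => by positivity)

theorem continuous_kap (δ : ℝ) (b : Parity) : Continuous (kap δ b) := by
  have := continuous_mono b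
  unfold kap; fun_prop

theorem continuous_datum (c μ δ : ℝ) (b : Parity) (l : Fin 3) : Continuous (datum c μ δ b l) :=
  (Complex.continuous_ofReal.comp ((continuous_weight c).mul (continuous_pol μ l))).mul
    (continuous_kap δ b)

theorem pol_reflect (μ : ℝ) (l : Fin 3) (γ : Parity) (ξ : E3) :
    pol μ l (reflect γ ξ) = sgn γ (Pi.single l 1) * pol μ l ξ := by
  have h := fun j : Fin 3 => neg_one_pow_mul_self_real (γ j).val
  rw [sgn_single]
  unfold pol
  simp only [reflect_apply]
  fin_cases l
  · simp
    linear_combination (((-1 : ℝ) ^ (γ 0).val) * ξ 0 * ξ 1 ^ 2) * h 1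
  · simp
    linear_combination (-((-1 : ℝ) ^ (γ 1).val) * ξ 1 * ξ 0 ^ 2) * h 0 +
      (((-1 : ℝ) ^ (γ 1).val) * ξ 1 * μ * ξ 2 ^ 2) * h 2
  · simp
    linear_combination (((-1 : ℝ) ^ (γ 2).val) * μ * ξ 2 * ξ 1 ^ 2) * h 1

theorem mono_reflect (b γ : Parity) (ξ : E3) : mono b (reflect γ ξ) = sgn γ b * mono b ξ := by
  unfold mono sgn
  rw [← Finset.prod_pow_eq_pow_sum, ← Finset.prod_mul_distrib]
  refine Finset.prod_congr rfl fun j _ => ?_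
  rw [reflect_apply, mul_pow, ← pow_mul]

theorem weight_reflect (c : ℝ) (γ : Parity) (ξ : E3) : weight c (reflect γ ξ) = weight c ξ := by
  unfold weight; rw [norm_reflect]

theorem sgn_one (b : Parity) : sgn 1 b = (-1) ^ deg b := by
  unfold sgn deg
  simp [ZMod.val_one]

theorem kap_reflect_one (δ : ℝ) (b : Parity) (ξ : E3) :
    kap δ b (reflect 1 ξ) =
      Complex.I * (1 + δ * Complex.I ^ (1 + deg b) * ((-1) ^ deg b * (mono b ξ : ℂ))) := by
  unfold kap
  rw [mono_reflect, sgn_one]; push_cast; rfl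

/-- A field is real when its transform equals its conjugate at -ξ. This operation changes the sign
of the first term of `kap` and keeps the second; after multiplication by the odd `pol`, the first
term yields the real part of the field and the second the imaginary part. -/
theorem conj_kap_reflect_one (δ : ℝ) (b : Parity) (ξ : E3) :
    (starRingEnd ℂ) (kap δ b (reflect 1 ξ)) =
      -(Complex.I * (1 - δ * Complex.I ^ (1 + deg b) * (mono b ξ : ℂ))) := by
  rw [kap_reflect_one]
  simp only [map_mul, map_add, map_one, map_pow, map_neg, Complex.conj_I, Complex.conj_ofReal]
  rw [neg_pow Complex.I, pow_add (-1 : ℂ)]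
  have : ((-1 : ℂ) ^ deg b) * (-1) ^ deg b = 1 := by rw [← mul_pow]; simp
  linear_combination (Complex.I * δ * Complex.I ^ (1 + deg b) * (mono b ξ : ℂ)) * this

/-- This product enters the convolution square at frequency 0. For even |b| it also has an imaginary
part, so only real parts are compared. -/
theorem re_kap_mul_kap (δ : ℝ) (b : Parity) (ξ : E3) :
    (kap δ b (reflect 1 ξ) * kap δ b ξ).re = -(1 - δ ^ 2 * mono b ξ ^ 2) := by
  rw [kap_reflect_one]
  unfold kap
  have hI : ∀ k : ℕ, Complex.I ^ (2 * k) = (-1) ^ k := fun k => by rw [pow_mul, Complex.I_sq]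
  have hs : ∀ k : ℕ, ((-1 : ℝ) ^ k) ^ 2 = 1 := fun k => by rw [← pow_mul, mul_comm, pow_mul]; simp
  rcases Nat.even_or_odd' (deg b) with ⟨k, hk | hk⟩
  · rw [hk, pow_add, hI, pow_mul (-1 : ℂ)]
    have e : Complex.I * (1 + δ * (Complex.I ^ 1 * (-1) ^ k) * (((-1) ^ 2) ^ k * (mono b ξ : ℂ))) *
        (Complex.I * (1 + δ * (Complex.I ^ 1 * (-1) ^ k) * (mono b ξ : ℂ))) =
        ((-(1 - δ ^ 2 * ((-1) ^ k) ^ 2 * mono b ξ ^ 2) : ℝ) : ℂ) +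
          ((-2 * δ * (-1) ^ k * mono b ξ : ℝ) : ℂ) * Complex.I := by
      push_cast
      simp only [neg_one_sq, one_pow, pow_one, one_mul]
      linear_combination (1 + 2 * δ * Complex.I * (-1) ^ k * (mono b ξ : ℂ) +
        (δ * (-1) ^ k * (mono b ξ : ℂ)) ^ 2 * (Complex.I ^ 2 - 1)) * Complex.I_sq
    rw [e, Complex.add_re, Complex.ofReal_re, Complex.re_ofReal_mul, Complex.I_re, hs]
    ring
  · rw [hk, show 1 + (2 * k + 1) = 2 * (k + 1) by ring, hI]
    have e : Complex.I * (1 + δ * (-1) ^ (k + 1) * ((-1) ^ (2 * k + 1) * (mono b ξ : ℂ))) *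
        (Complex.I * (1 + δ * (-1) ^ (k + 1) * (mono b ξ : ℂ))) =
        ((-(1 - δ ^ 2 * ((-1) ^ (k + 1)) ^ 2 * mono b ξ ^ 2) : ℝ) : ℂ) := by
      push_cast
      rw [(show Odd (2 * k + 1) from ⟨k, rfl⟩).neg_one_pow]
      linear_combination (1 - (δ * (-1) ^ (k + 1) * (mono b ξ : ℂ)) ^ 2) * Complex.I_sq
    rw [e, Complex.ofReal_re, hs]
    ring

theorem sum_coord_mul_datum (c μ δ : ℝ) (b : Parity) (ξ : E3) :
    ∑ l, (ξ l : ℂ) * datum c μ δ b l ξ = 0 := by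
  unfold datum pol
  simp [Fin.sum_univ_three]
  ring

theorem abs_mono_le (b : Parity) (ξ : E3) : |mono b ξ| ≤ (1 + ‖ξ‖ ^ 2) ^ 3 := by
  unfold mono
  rw [Finset.abs_prod]
  calc _ ≤ ∏ _j : Fin 3, (1 + ‖ξ‖ ^ 2) := by
        refine Finset.prod_le_prod (fun _ _ => abs_nonneg _) fun j _ => ?_
        have h1 : |ξ j| ≤ ‖ξ‖ := PiLp.norm_apply_le ξ j
        have h2 : (b j).val = 0 ∨ (b j).val = 1 := by
          have := ZMod.val_lt (b j); omega
        rcases h2 with h | h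
        · rw [h]; simp
        · rw [h, pow_one]; nlinarith [sq_nonneg (‖ξ‖ - 1)]
    _ = _ := by simp

theorem abs_pol_le {μ : ℝ} (h1 : 0 ≤ μ) (h2 : μ ≤ 2) (l : Fin 3) (ξ : E3) :
    |pol μ l ξ| ≤ 3 * ‖ξ‖ ^ 3 := by
  have hc : ∀ j, |ξ j| ≤ ‖ξ‖ := fun j => PiLp.norm_apply_le ξ j
  have h3 : ∀ i j, |ξ i * ξ j ^ 2| ≤ ‖ξ‖ ^ 3 := by
    intro i j
    rw [abs_mul, abs_pow]
    calc _ ≤ ‖ξ‖ * ‖ξ‖ ^ 2 := by gcongr <;> exact hc _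
      _ = _ := by ring
  have hn : 0 ≤ ‖ξ‖ ^ 3 := by positivity
  fin_cases l
  · simp only [pol, Fin.zero_eta, Matrix.cons_val_zero]
    linarith [h3 0 1]
  · simp only [pol, Fin.mk_one, Matrix.cons_val_one, Matrix.cons_val_zero]
    have e : ξ 1 * (-ξ 0 ^ 2 + μ * ξ 2 ^ 2) = -(ξ 1 * ξ 0 ^ 2) + μ * (ξ 1 * ξ 2 ^ 2) := by ring
    rw [e]
    refine (abs_add_le _ _).trans ?_
    rw [abs_neg, abs_mul μ, abs_of_nonneg h1]
    nlinarith [h3 1 0, h3 1 2, abs_nonneg (ξ 1 * ξ 2 ^ 2)]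
  · simp only [pol, Fin.reduceFinMk, Matrix.cons_val]
    rw [abs_mul, abs_neg, abs_of_nonneg h1]
    nlinarith [h3 2 1, abs_nonneg (ξ 2 * ξ 1 ^ 2)]

/-- Of the eight powers of 1 + |ξ|² in `weight`, three compensate the factor on the left, which
dominates the monomial ξ^b; two form `wt`; three dominate |ξ|⁴, that is, the cubic `pol` and the |ξ|
in `wt`. -/
theorem abs_weight_mul_pol_le {c μ : ℝ} (hc : 0 ≤ c) (h1 : 0 ≤ μ) (h2 : μ ≤ 2) (l : Fin 3) (ξ : E3) :
    |weight c ξ * pol μ l ξ| * (1 + ‖ξ‖ ^ 2) ^ 3 ≤ 3 * c * wt ξ := by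
  rcases eq_or_ne ξ 0 with rfl | hξ
  · have : |pol μ l 0| ≤ 0 := by simpa using abs_pol_le h1 h2 l (0 : E3)
    have h0 : pol μ l 0 = 0 := abs_nonpos_iff.1 this
    simp [h0, wt]
  have hx := norm_pos_iff.2 hξ
  have h := abs_pol_le h1 h2 l ξ
  rw [abs_mul, abs_of_nonneg (by unfold weight; positivity : 0 ≤ weight c ξ)]
  unfold weight wt
  calc _ ≤ c * ((1 + ‖ξ‖ ^ 2) ^ 8)⁻¹ * (3 * ‖ξ‖ ^ 3) * (1 + ‖ξ‖ ^ 2) ^ 3 := by gcongr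
    _ = 3 * c * (‖ξ‖ ^ 4 * ((1 + ‖ξ‖ ^ 2) ^ 3)⁻¹ * (‖ξ‖ * (1 + ‖ξ‖ ^ 2) ^ 2)⁻¹) := by
        field_simp
    _ ≤ 3 * c * (1 * (‖ξ‖ * (1 + ‖ξ‖ ^ 2) ^ 2)⁻¹) := by
        gcongr
        rw [← div_eq_mul_inv, div_le_one (by positivity)]
        nlinarith [sq_nonneg (‖ξ‖ ^ 2), sq_nonneg ‖ξ‖, pow_nonneg hx.le 6]
    _ = _ := by rw [one_mul]

theorem norm_kap_le {δ : ℝ} (h1 : 0 ≤ δ) (h2 : δ ≤ 2) (b : Parity) (ξ : E3) :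
    ‖kap δ b ξ‖ ≤ 3 * (1 + ‖ξ‖ ^ 2) ^ 3 := by
  unfold kap
  rw [norm_mul, Complex.norm_I, one_mul]
  refine (norm_add_le _ _).trans ?_
  rw [norm_mul, norm_mul, norm_pow, Complex.norm_I, one_pow, mul_one, Complex.norm_real,
    Complex.norm_real, norm_one, Real.norm_eq_abs, abs_of_nonneg h1, Real.norm_eq_abs]
  have h3 := abs_mono_le b ξ
  have h4 : 1 ≤ (1 + ‖ξ‖ ^ 2) ^ 3 := one_le_pow₀ (by nlinarith [sq_nonneg ‖ξ‖])
  nlinarith [abs_nonneg (mono b ξ)]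

theorem norm_datum_le {c μ δ : ℝ} (hc : 0 ≤ c) (h1 : 0 ≤ μ) (h2 : μ ≤ 2) (h3 : 0 ≤ δ) (h4 : δ ≤ 2)
    (b : Parity) (l : Fin 3) (ξ : E3) : ‖datum c μ δ b l ξ‖ ≤ 9 * c * wt ξ := by
  unfold datum
  rw [norm_mul, Complex.norm_real, Real.norm_eq_abs]
  calc _ ≤ |weight c ξ * pol μ l ξ| * (3 * (1 + ‖ξ‖ ^ 2) ^ 3) := by
        gcongr; exact norm_kap_le h3 h4 b ξ
    _ ≤ _ := by linarith [abs_weight_mul_pol_le hc h1 h2 l ξ]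

/-- Fields with the Fourier transform `datum` are of matched type. -/
theorem hasSymmetryType_of_datum {u : VField} {c μ δ : ℝ} {b : Parity}
    (hu : ∀ l, (𝓕 (u l) : L2) =ᵐ[volume] datum c μ δ b l) : HasSymmetryType u (matchedType b) := by
  have e : matchedType b = fun l => (Pi.single l 1 + 0, Pi.single l 1 + b) := by
    funext l; simp [matchedType]
  rw [e, hasSymmetryType_iff]
  intro γ
  simp only [sgn_zero, Complex.ofReal_one, one_smul]
  funext l
  refine Lp.ext ?_
  have hs := sgn_sq_complex γ (Pi.single l 1)
  by_cases hb : sgn γ 0 = sgn γ b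
  · unfold actS
    rw [if_pos hb]
    filter_upwards [coeFn_actA γ (hat u) l, ae_reflect γ (hu l), hu l] with x e1 e2 e3
    rw [e1, hat_apply, e2, e3]
    unfold datum kap
    rw [weight_reflect, pol_reflect, mono_reflect, ← hb, sgn_zero]
    push_cast
    linear_combination (weight c x * pol μ l x * (Complex.I *
      (1 + δ * Complex.I ^ (1 + deg b) * (mono b x : ℂ)))) * hs
  · have hb' : sgn γ b = -1 := (sgn_eq_or γ b).resolve_left (sgn_zero γ ▸ Ne.symm hb)
    unfold actS
    rw [if_neg hb]
    filter_upwards [coeFn_actA γ (actD (actA 1 (hat u))) l,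
      ae_reflect γ (coeFn_actD (actA 1 (hat u)) l), ae_reflect γ (coeFn_actA 1 (hat u) l),
      ae_reflect γ (ae_reflect 1 (hu l)), hu l] with x e1 e2 e3 e4 e5
    rw [e1, e2, e3, hat_apply, e4, e5, sgn_one_single]
    unfold datum
    simp only [map_mul, conj_kap_reflect_one, Complex.conj_ofReal]
    unfold kap
    rw [weight_reflect, weight_reflect, pol_reflect, pol_reflect, mono_reflect, hb', sgn_one_single]
    push_cast
    linear_combination (weight c x * pol μ l x * (Complex.I *
      (1 + δ * Complex.I ^ (1 + deg b) * (mono b x : ℂ)))) * hs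

/-! ### The Beltrami-type condition fails -/

theorem conv_comm (f g : E3 → ℂ) (ξ : E3) : conv f g ξ = conv g f ξ := by
  unfold conv
  rw [← integral_sub_left_eq_self (fun η => f (ξ - η) * g η) volume ξ]
  simp only [sub_sub_cancel, mul_comm]

theorem continuous_projSymbol (l k : Fin 3) : Continuous (projSymbol l k) :=
  (hasTemperateGrowth_projSymbol l k).1.continuous

theorem continuous_derivSymbol (m : Fin 3) : Continuous (derivSymbol m) :=
  (hasTemperateGrowth_derivSymbol m).1.continuous

/-- Multiplied by |ξ|², the vanishing term is continuous, so it vanishes everywhere. On the ray (s,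
0, s) it equals a constant times s³(C₀₀ + C₂₀ - C₀₂ - C₂₂), with C_{mk} the convolutions. Division
by s³ and s → 0 give the claim, as C₂₀ = C₀₂ by commutativity. -/
theorem conv_zero_eq_of_nonlin {U : VField} (h : nonlin (fn U) (fn U) 0 =ᵐ[volume] 0) :
    conv (U 0) (U 0) 0 = conv (U 2) (U 2) 0 := by
  have hF : (fun ξ => ∑ l, projSymbol l 0 ξ * ∑ m, derivSymbol m ξ * conv (U m) (U l) ξ) = 0 := by
    refine Continuous.ae_eq_iff_eq volume ?_ continuous_zero |>.1 ?_
    · refine continuous_finsetSum _ fun l _ => (continuous_projSymbol l 0).mul ?_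
      exact continuous_finsetSum _ fun m _ => (continuous_derivSymbol m).mul (continuous_conv _ _)
    · filter_upwards [h] with ξ e
      have := nonlin_projSymbol (fn U) (fn U) 0 ξ
      rw [e, Pi.zero_apply, mul_zero] at this
      exact this
  set ray : ℝ → E3 := fun s => WithLp.toLp 2 ![s, 0, s] with hray
  have hrayc : Continuous ray := by
    refine (PiLp.continuous_toLp 2 _).comp (continuous_pi fun j => ?_)
    fin_cases j <;> simp <;> fun_prop
  set G : ℝ → ℂ := fun s => conv (U 0) (U 0) (ray s) + conv (U 2) (U 0) (ray s) -
    conv (U 0) (U 2) (ray s) - conv (U 2) (U 2) (ray s) with hG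
  have hGc : Continuous G := by
    have := fun i j : Fin 3 => (continuous_conv (U i) (U j)).comp hrayc
    exact (((this 0 0).add (this 2 0)).sub (this 0 2)).sub (this 2 2)
  have hG0 : ∀ s, s ≠ 0 → G s = 0 := by
    intro s hs
    have h1 := congrFun hF (ray s)
    have hn : ‖ray s‖ ^ 2 = 2 * s ^ 2 := by
      rw [EuclideanSpace.norm_sq_eq]; simp [hray, Fin.sum_univ_three]; ring
    have hc : ray s 0 = s ∧ ray s 1 = 0 ∧ ray s 2 = s := by simp [hray]
    simp only [Fin.sum_univ_three, projSymbol, derivSymbol, hn, hc.1, hc.2.1, hc.2.2,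
      Pi.zero_apply] at h1
    rw [if_neg (show (2 : Fin 3) ≠ 0 by decide)] at h1
    norm_num at h1
    have h2 : (2 * Real.pi * Complex.I * (s : ℂ) ^ 3) * G s = 0 := by
      rw [← h1]; simp only [hG]; ring
    refine (mul_eq_zero.1 h2).resolve_left ?_
    simp [hs, Real.pi_ne_zero]
  have hG00 : G 0 = 0 := by
    have h1 : Tendsto G (𝓝[≠] 0) (𝓝 (G 0)) := hGc.continuousAt.tendsto.mono_left nhdsWithin_le_nhds
    refine tendsto_nhds_unique h1 (tendsto_const_nhds.congr' ?_)
    filter_upwards [self_mem_nhdsWithin] with s hs using (hG0 s hs).symm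
  have hray0 : ray 0 = 0 := by
    ext j; fin_cases j <;> simp [hray]
  simp only [hG, hray0] at hG00
  rw [conv_comm (U 2) (U 0)] at hG00
  linear_combination hG00

/-- The density appearing in the convolution square of `datum` at the origin. -/
def dens (c μ : ℝ) (l : Fin 3) (ξ : E3) : ℝ := (gauss 1 ξ * (weight c ξ * pol μ l ξ)) ^ 2

theorem continuous_dens (c μ : ℝ) (l : Fin 3) : Continuous (dens c μ l) :=
  ((continuous_gauss 1).mul ((continuous_weight c).mul (continuous_pol μ l))).pow 2

theorem integrable_of_le_wt_sq {f : E3 → ℝ} (hf : Continuous f) {C : ℝ}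
    (h : ∀ ξ, |f ξ| ≤ C * wt ξ ^ 2) : Integrable f :=
  (memLp_wt.integrable_sq.const_mul C).mono' hf.aestronglyMeasurable (Eventually.of_forall h)

theorem integrable_dens_mul {c μ : ℝ} (hc : 0 ≤ c) (h1 : 0 ≤ μ) (h2 : μ ≤ 2) (l : Fin 3)
    {p : E3 → ℝ} (hp : Continuous p) (hb : ∀ ξ, |p ξ| ≤ (1 + ‖ξ‖ ^ 2) ^ 3) :
    Integrable fun ξ => dens c μ l ξ * p ξ ^ 2 := by
  refine integrable_of_le_wt_sq ((continuous_dens c μ l).mul (hp.pow 2)) (C := (3 * c) ^ 2)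
    fun ξ => ?_
  unfold dens
  have e : (gauss 1 ξ * (weight c ξ * pol μ l ξ)) ^ 2 * p ξ ^ 2 =
      (gauss 1 ξ * (|weight c ξ * pol μ l ξ| * |p ξ|)) ^ 2 := by
    rw [mul_pow, mul_pow (gauss 1 ξ), mul_pow (|_|), sq_abs, sq_abs]; ring
  rw [e, abs_of_nonneg (sq_nonneg _), ← mul_pow]
  have hw : 0 ≤ 3 * c * wt ξ := mul_nonneg (by positivity) (wt_nonneg ξ)
  refine pow_le_pow_left₀ (mul_nonneg (gauss_pos _ _).le (by positivity)) ?_ 2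
  calc _ ≤ 1 * (|weight c ξ * pol μ l ξ| * (1 + ‖ξ‖ ^ 2) ^ 3) := by
        gcongr
        · exact gauss_le_one zero_le_one ξ
        · exact hb ξ
    _ ≤ _ := by rw [one_mul]; exact abs_weight_mul_pol_le hc h1 h2 l ξ

theorem integrable_dens {c μ : ℝ} (hc : 0 ≤ c) (h1 : 0 ≤ μ) (h2 : μ ≤ 2) (l : Fin 3) :
    Integrable (dens c μ l) := by
  have := integrable_dens_mul hc h1 h2 l (p := fun _ => 1) continuous_const fun ξ => by
    rw [abs_one]; exact one_le_pow₀ (by nlinarith [sq_nonneg ‖ξ‖])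
  simpa using this

theorem integrable_dens_mono {c μ : ℝ} (hc : 0 ≤ c) (h1 : 0 ≤ μ) (h2 : μ ≤ 2) (l : Fin 3)
    (b : Parity) : Integrable fun ξ => dens c μ l ξ * mono b ξ ^ 2 :=
  integrable_dens_mul hc h1 h2 l (continuous_mono b) (abs_mono_le b)

/-- At frequency 0 the integrand is U(-η)U(η). The minus sign from the odd `pol` cancels the one in
`re_kap_mul_kap`. -/
theorem re_conv_datum {U : L2} {c μ δ : ℝ} (hc : 0 ≤ c) (h1 : 0 ≤ μ) (h2 : μ ≤ 2) {b : Parity}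
    {l : Fin 3} (hU : U =ᵐ[volume] fun ξ => (gauss 1 ξ : ℂ) * datum c μ δ b l ξ) :
    (conv U U 0).re =
      (∫ ξ, dens c μ l ξ) - δ ^ 2 * ∫ ξ, dens c μ l ξ * mono b ξ ^ 2 := by
  have hi : Integrable fun η : E3 => U (0 - η) * U η := integrable_conv_L2 U U 0
  have e : (conv U U 0).re = ∫ η, (U (0 - η) * U η).re := (integral_re hi).symm
  rw [e, ← integral_const_mul, ← integral_sub (integrable_dens hc h1 h2 l)
    ((integrable_dens_mono hc h1 h2 l b).const_mul _)]
  refine integral_congr_ae ?_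
  filter_upwards [hU, ae_reflect 1 hU] with η e1 e2
  rw [zero_sub, ← reflect_one, e1, e2, gauss_reflect]
  unfold datum
  rw [weight_reflect, pol_reflect, sgn_one_single]
  have e3 : (gauss 1 η : ℂ) * (((weight c η * (-1 * pol μ l η) : ℝ) : ℂ) * kap δ b (reflect 1 η)) *
      ((gauss 1 η : ℂ) * (((weight c η * pol μ l η : ℝ) : ℂ) * kap δ b η)) =
      ((-dens c μ l η : ℝ) : ℂ) * (kap δ b (reflect 1 η) * kap δ b η) := by
    unfold dens; push_cast; ring
  rw [e3, Complex.re_ofReal_mul, re_kap_mul_kap]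
  ring

theorem dens_two (c μ : ℝ) (ξ : E3) : dens c μ 2 ξ = μ ^ 2 * dens c 1 2 ξ := by
  simp only [dens, pol, Matrix.cons_val]; ring

theorem dens_zero (c μ : ℝ) (ξ : E3) : dens c μ 0 ξ = dens c 1 0 ξ := by
  simp only [dens, pol, Matrix.cons_val_zero]

theorem integral_dens_pos {c : ℝ} (hc : 0 < c) : 0 < ∫ ξ, dens c 1 2 ξ := by
  have h0 : ∀ ξ, 0 ≤ dens c 1 2 ξ := fun ξ => sq_nonneg _
  refine (integral_nonneg h0).lt_of_ne' fun h => ?_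
  have h1 := (integral_eq_zero_iff_of_nonneg h0
    (integrable_dens hc.le zero_le_one one_le_two 2)).1 h
  have h2 := congrFun (((continuous_dens c 1 2).ae_eq_iff_eq volume continuous_zero).1 h1)
    (WithLp.toLp 2 ![0, 1, 1])
  have hg := gauss_pos 1 (WithLp.toLp 2 ![0, 1, 1] : E3)
  have hw : 0 < weight c (WithLp.toLp 2 ![0, 1, 1] : E3) := by unfold weight; positivity
  simp [dens, pol, hg.ne', hw.ne'] at h2

/-- Otherwise A₀ - δ²B₀ = μ²(A₂ - δ²B₂) for all μ, δ in [1, 2], because the first component of `pol`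
is free of μ and the third is linear in it. Comparing μ = 1 and μ = 2 gives A₂ = δ²B₂ for δ = 1 and
δ = 2, so A₂ = 0, whereas A₂ > 0. No integral has to be computed. -/
theorem exists_not_beltrami {c : ℝ} (hc : 0 < c) (b : Parity) :
    ∃ μ δ : ℝ, 1 ≤ μ ∧ μ ≤ 2 ∧ 1 ≤ δ ∧ δ ≤ 2 ∧ ∀ u : VField,
      (∀ l, (𝓕 (u l) : L2) =ᵐ[volume] datum c μ δ b l) → ¬ IsBeltramiType u := by
  by_contra hcon
  push Not at hcon
  have key : ∀ μ δ : ℝ, 1 ≤ μ → μ ≤ 2 → 1 ≤ δ → δ ≤ 2 →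
      (∫ ξ, dens c 1 0 ξ) - δ ^ 2 * (∫ ξ, dens c 1 0 ξ * mono b ξ ^ 2) =
      μ ^ 2 * ((∫ ξ, dens c 1 2 ξ) - δ ^ 2 * ∫ ξ, dens c 1 2 ξ * mono b ξ ^ 2) := by
    intro μ δ h1 h2 h3 h4
    obtain ⟨u, hu, hB⟩ := hcon μ δ h1 h2 h3 h4
    have h0 : (0 : ℝ) ≤ μ := by linarith
    set U : VField := fun l => heatPath (𝓕 (u l)) 1 with hUd
    have hU : ∀ l, U l =ᵐ[volume] fun ξ => (gauss 1 ξ : ℂ) * datum c μ δ b l ξ := by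
      intro l
      filter_upwards [coeFn_heatPath (𝓕 (u l)) zero_le_one, hu l] with ξ e1 e2
      rw [e1, e2]
    have hnl := (lerayConvection_eq_zero_iff _ _ 0).1 (hB.1 1 one_pos 0)
    have e : (fun m => ((𝓕 (heat 1 (u m)) : L2) : E3 → ℂ)) = fn U :=
      funext fun m => congrArg (fun f : L2 => (f : E3 → ℂ)) (fourier_heat 1 (u m))
    rw [e] at hnl
    have h5 := congrArg Complex.re (conv_zero_eq_of_nonlin hnl)
    rw [re_conv_datum hc.le h0 h2 (hU 0), re_conv_datum hc.le h0 h2 (hU 2)] at h5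
    simp_rw [dens_zero c μ, dens_two c μ, mul_assoc, integral_const_mul] at h5
    rw [h5]; ring
  have hpos := integral_dens_pos hc
  have k11 := key 1 1 le_rfl one_le_two le_rfl one_le_two
  have k21 := key 2 1 one_le_two le_rfl le_rfl one_le_two
  have k12 := key 1 2 le_rfl one_le_two one_le_two le_rfl
  have k22 := key 2 2 one_le_two le_rfl one_le_two le_rfl
  linarith

/-! ### The components are not constant -/

/-- A constant in `L²` of a space of infinite measure is zero. -/
theorem reMul_eq_zero_of_const {c : ℂ} {f : L2} {r : ℝ} (h : ∀ᵐ x, (c * f x).re = r) :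
    reMul c f = 0 := by
  have h1 : reMul c f =ᵐ[volume] fun _ => (r : ℂ) := by
    filter_upwards [coeFn_reMul c f, h] with x e1 e2
    rw [e1, e2]
  have h2 := (memLp_const_iff (by norm_num) (by norm_num)).1 ((memLp_congr_ae h1).1 (Lp.memLp _))
  have h3 : (r : ℂ) = 0 := h2.resolve_right (by simp)
  rw [Lp.eq_zero_iff_ae_eq_zero]
  filter_upwards [h1] with x e
  rw [e, h3]; rfl

/-- The transform of Re(zu) is a continuous expression in `datum` that vanishes almost everywhere,
hence at every ξ; a single point then refutes constancy. -/
theorem datum_of_const {u : L2} {c μ δ : ℝ} {b : Parity} {l : Fin 3} {z : ℂ} {r : ℝ}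
    (hu : (𝓕 u : L2) =ᵐ[volume] datum c μ δ b l) (h : ∀ᵐ x, (z * u x).re = r) (ξ : E3) :
    ((weight c ξ * pol μ l ξ : ℝ) : ℂ) * (z * (1 + δ * Complex.I ^ (1 + deg b) * (mono b ξ : ℂ)) +
      (starRingEnd ℂ) z * (1 - δ * Complex.I ^ (1 + deg b) * (mono b ξ : ℂ))) = 0 := by
  have h0 := reMul_eq_zero_of_const h
  have h1 : (𝓕 (reMul z u) : L2) = 0 := by
    rw [h0]; exact (Lp.fourierTransformₗᵢ E3 ℂ).map_zero
  set F : E3 → ℂ := fun ξ => z / 2 * datum c μ δ b l ξ +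
    (starRingEnd ℂ) z / 2 * (starRingEnd ℂ) (datum c μ δ b l (reflect 1 ξ)) with hF
  have hFc : Continuous F := by
    have h2 := continuous_datum c μ δ b l
    exact (continuous_const.mul h2).add (continuous_const.mul
      (Complex.continuous_conj.comp (h2.comp (continuous_reflect 1))))
  have hF0 : F =ᵐ[volume] 0 := by
    filter_upwards [fourier_reMul z u, hu, ae_reflect 1 hu, Lp.eq_zero_iff_ae_eq_zero.1 h1]
      with ξ e1 e2 e3 e4
    rw [reflect_one] at e3
    rw [e4, e2, e3] at e1
    simp only [hF, reflect_one]
    exact e1.symm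
  have h3 := congrFun ((hFc.ae_eq_iff_eq volume continuous_zero).1 hF0) ξ
  simp only [hF, datum, map_mul, conj_kap_reflect_one, Complex.conj_ofReal, weight_reflect,
    pol_reflect, sgn_one_single, Pi.zero_apply] at h3
  unfold kap at h3
  have h4 : (Complex.I / 2) * (((weight c ξ * pol μ l ξ : ℝ) : ℂ) *
      (z * (1 + δ * Complex.I ^ (1 + deg b) * (mono b ξ : ℂ)) +
      (starRingEnd ℂ) z * (1 - δ * Complex.I ^ (1 + deg b) * (mono b ξ : ℂ)))) = 0 := by
    rw [← h3]; push_cast; ring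
  exact (mul_eq_zero.1 h4).resolve_left (by simp)

theorem not_const_of_datum {u : L2} {c μ δ : ℝ} (hc : 0 < c) (hμ : 1 ≤ μ) (hδ : 1 ≤ δ) {b : Parity}
    {l : Fin 3} (hu : (𝓕 u : L2) =ᵐ[volume] datum c μ δ b l) :
    (¬ ∃ r : ℝ, ∀ᵐ x, (u x).re = r) ∧ ¬ ∃ r : ℝ, ∀ᵐ x, (u x).im = r := by
  -- No coordinate of this point vanishes, so neither does any ξ^b; the components of `pol` there
  -- are 1, 4μ - 1 and -2μ, all nonzero for μ ≥ 1.
  set P : E3 := WithLp.toLp 2 ![1, 1, 2] with hP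
  have hw : 0 < weight c P := by unfold weight; positivity
  have hpol : pol μ l P ≠ 0 := by
    fin_cases l
    · simp [pol, hP]
    · have : (-1 : ℝ) + μ * 2 ^ 2 ≠ 0 := by nlinarith
      simpa [pol, hP] using this
    · have : μ ≠ 0 := by linarith
      simpa [pol, hP] using this
  have hmono : mono b P ≠ 0 := by
    unfold mono
    refine Finset.prod_ne_zero_iff.2 fun j _ => pow_ne_zero _ ?_
    fin_cases j <;> simp [hP]
  have hA : ((weight c P * pol μ l P : ℝ) : ℂ) ≠ 0 := by
    rw [Complex.ofReal_ne_zero]; exact mul_ne_zero hw.ne' hpol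
  have hδ' : (δ : ℂ) ≠ 0 := by rw [Complex.ofReal_ne_zero]; linarith
  constructor
  · rintro ⟨r, hr⟩
    have h := datum_of_const (z := 1) (r := r) hu (by simpa using hr) P
    have h2 := (mul_eq_zero.1 h).resolve_left hA
    simp only [map_one, one_mul] at h2
    norm_num at h2
  · rintro ⟨r, hr⟩
    have h := datum_of_const (z := -Complex.I) (r := r) hu (by simpa using hr) P
    have h2 := (mul_eq_zero.1 h).resolve_left hA
    simp only [map_neg, Complex.conj_I] at h2
    have h3 : -2 * Complex.I * (δ * Complex.I ^ (1 + deg b) * (mono b P : ℂ)) = 0 := by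
      rw [← h2]; ring
    simp [hδ', hmono] at h3

theorem isAdmissible_matchedType (b : Parity) : IsAdmissible (matchedType b) := by
  have hw := wtConst_nonneg
  -- The summand 1 keeps the denominator positive using only `wtConst` ≥ 0. The datum is then taken
  -- with c = ε/9, since `norm_datum_le` bounds it by 9c times the weight.
  set ε : ℝ := (24 * wtConst + 1)⁻¹ with hε
  have hε0 : 0 < ε := by positivity
  have hsmall : 24 * wtConst * ε ≤ 1 := by
    rw [hε, ← div_eq_mul_inv, div_le_one (by positivity)]; linarith
  have hc : 0 < ε / 9 := by positivity
  obtain ⟨μ, δ, h1, h2, h3, h4, hB⟩ := exists_not_beltrami hc b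
  obtain ⟨u₀, u, hu, hu₀⟩ := exists_isStrongSolution (a₀ := datum (ε / 9) μ δ b) hε0.le hsmall
    (fun l => (continuous_datum _ _ _ _ l).measurable)
    (fun l ξ => (norm_datum_le hc.le (by linarith) h2 (by linarith) h4 b l ξ).trans
      (le_of_eq (by ring)))
    (sum_coord_mul_datum _ _ _ b)
  refine ⟨u₀, u, hu, fun l => ?_, hB u₀ hu₀, keeps_of_matched hu (hasSymmetryType_of_datum hu₀)⟩
  have hn := not_const_of_datum hc h1 h3 (hu₀ l)
  constructor
  · rintro ⟨r, hr⟩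
    have := hr 0 le_rfl
    rw [hu.initial] at this
    exact hn.1 ⟨r, this⟩
  · rintro ⟨r, hr⟩
    have := hr 0 le_rfl
    rw [hu.initial] at this
    exact hn.2 ⟨r, this⟩

end

end NSSymmetry

theorem mainTheorem2 :
    (∀ (u₀ : NSSymmetry.VField) (u : ℝ → NSSymmetry.VField),
      NSSymmetry.IsStrongSolution u₀ u →
      NSSymmetry.NonconstantComponents u →
      (∃ τ, NSSymmetry.HasSymmetryType u₀ τ) →
      (NSSymmetry.KeepsSymmetryType u ↔
        (∃ β₀ : NSSymmetry.Parity,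
          NSSymmetry.HasSymmetryType u₀ (NSSymmetry.matchedType β₀)) ∨
        NSSymmetry.IsBeltramiType u₀)) ∧
    {τ | NSSymmetry.IsAdmissible τ} = Set.range NSSymmetry.matchedType ∧
    {τ | NSSymmetry.IsAdmissible τ}.ncard = 8 := by
  have h : {τ | NSSymmetry.IsAdmissible τ} = Set.range NSSymmetry.matchedType := by
    ext τ
    refine ⟨NSSymmetry.exists_matched_of_isAdmissible, ?_⟩
    rintro ⟨b, rfl⟩
    exact NSSymmetry.isAdmissible_matchedType b
  refine ⟨fun u₀ u hu hn hτ => NSSymmetry.keepsSymmetryType_iff hu hn hτ, h, ?_⟩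
  rw [h, ← Set.image_univ, Set.ncard_image_of_injective _ NSSymmetry.matchedType_injective,
    Set.ncard_univ, Nat.card_eq_fintype_card]
  decide
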